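/- Let $d\in\mathbb N$, $0<T<\infty$, and write $f_{s,t}=f_t-f_s$. Besov spaces. Let $(\chi,\rho)$ be a dyadic partition of unity: smooth real radial functions on $\mathbb R^d$, $\chi$ supported in a ball and $\rho$ in an annulus, with $\chi+\sum_{j\ge0}\rho(2^{-j}\cdot)\equiv1$, $\mathrm{supp}\,\chi\cap\mathrm{supp}\,\rho(2^{-j}\cdot)=\emptyset$ for $j\ge1$ and $\mathrm{supp}\,\rho(2^{-i}\cdot)\cap\mathrm{supp}\,\rho(2^{-j}\cdot)=\emptyset$ for $|i-j|\ge2$. With $\rho_{-1}=\chi$, $\rho_j=\rho(2^{-j}\cdot)$ and $K_j=\mathscr F^{-1}\rho_j$ let $\Delta_jf=K_j*f$, and for $\alpha\in\mathbb R$, $p,q\in[1,\infty]$ let $B^\alpha_{p,q}$ be the space of tempered distributions $f$ with $\|f\|_{B^\alpha_{p,q}}=\big\|\big(2^{j\alpha}\|\Delta_jf\|_{L^p}\big)_{j\ge-1}\big\|_{\ell^q}<\infty$. Write $\mathcal C^\alpha=B^\alpha_{\infty,\infty}$. Infinitely regularizing paths. A local time of a measurable path $w:[0,T]\to\mathbb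 R^d$ is a measurable $L:[0,T]\times\mathbb R^d\to\mathbb R_+$ with $L_0\equiv0$ and $\lambda\{s\in[0,t]:w_s\in A\}=\int_AL_t(z)\,dz$ for all $t\in[0,T]$ and all Borel sets $A$, where $\lambda$ is Lebesgue measure. The path $w$ is infinitely regularizing if it has a local time $L\in C^\gamma([0,T],\mathcal C^\alpha)$ for all $\gamma\in(\frac12,1)$ and all $\alpha\in\mathbb R$. If $w$ is moreover continuous, then $L_t$ is (after modification on a null set) smooth with compact support, and for an $\mathbb R^d$-valued tempered distribution $b\in\mathscr S'$ one defines the averaging operator $T^w_tb(x)=\langle b,L_t(\cdot-x)\rangle$, which equals $\int_0^tb(x+w_r)\,dr$ for continuous $b\in\mathscr S'$. Solutions. For $\tau\le T$ a path $y\in C([0,\tau],\mathbb R^d)$ is a solution on $[0,\tau]$ of $$y_t=x+\int_0^tb(y_r)\,dr+w_t\qquad(\ast)$$ if $z=y-w$ is $\varepsilon$-Hölder continuous on $[0,\tau]$ for some $\varepsilon>0$ and $z_t=x+\int_0^tT^w_{dr}b(z_r)$ for all $t\in[0,\tau]$, where the non-linear Young integral is $\int_0^tT^w_{dr}b(z_r)=\lim_{|\mathcal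 P|\to0}\sum_{[u,v]\in\mathcal P}T^w_{u,v}b(z_u)$, the limit being over partitions $\mathcal P$ of $[0,t]$. For $S\in(0,T]\cup\{\infty\}$, a solution on $[0,S)\cap[0,T]$ is a path that is a solution on $[0,\tau]$ for each $\tau\in[0,S)\cap[0,T]$. We say that $S\in(0,T]\cup\{\infty\}$ is the existence time $T^*(x)$ if there is a unique solution $y$ of $(\ast)$ on $[0,S)\cap[0,T]$ and, in case $S<\infty$, $\lim_{t\uparrow S}|y_t|=\infty$. Proposition. Let $w:[0,T]\to\mathbb R^d$ be continuous and infinitely regularizing, and let $b\in\mathscr S'$ satisfy $b\in B^\alpha_{p,q}$ for some $\alpha\in\mathbb R$ and $p,q\in[1,\infty]$. Then $T^*(x)=\infty$ for every $x\in\mathbb R^d$. That is, for every $x$ the value $\infty$ is the existence time, so that $(\ast)$ has a unique solution on the whole interval $[0,T]$, and no $S\in(0,T]$ is an existence time. -/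

import Mathlib

open MeasureTheory Set Filter Topology
open scoped ENNReal NNReal SchwartzMap FourierTransform ContDiff

noncomputable section

namespace PerturbedODE

/-- The Euclidean space `ℝ^d`. -/
abbrev Sp (d : ℕ) : Type := EuclideanSpace ℝ (Fin d)

/-- Real tempered distributions on `ℝ^d` with values in a real normed space `F`: continuous linear
functionals on the real Schwartz space. (Mathlib's `𝓢'(E, F)` is the complex version; the drift of
an equation in `ℝ^d` is real.) -/
abbrev TempDist (d : ℕ) (F : Type*) [NormedAddCommGroup F] [NormedSpace ℝ F] : Type _ :=
  𝓢(Sp d, ℝ) →L[ℝ] F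

/-! ### Littlewood-Paley blocks and Besov spaces -/

/-- A dyadic partition of unity `(χ, ρ)`: smooth radial functions, `χ` supported in a ball and `ρ`
in an annulus, with `χ + ∑_{j ≥ 0} ρ(2^{-j} ·) = 1` and the usual almost-disjointness of the
supports. -/
structure DyadicPartition (d : ℕ) where
  /-- the low-frequency function -/
  χ : Sp d → ℝ
  /-- the annulus function -/
  ρ : Sp d → ℝ
  /-- inner radius of the annulus -/
  a : ℝ
  /-- outer radius of the annulus -/
  b : ℝ
  /-- radius of the ball -/
  c : ℝ
  a_pos : 0 < a
  b_pos : 0 < b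
  c_pos : 0 < c
  χ_smooth : ContDiff ℝ ∞ χ
  ρ_smooth : ContDiff ℝ ∞ ρ
  χ_radial : ∀ x y, ‖x‖ = ‖y‖ → χ x = χ y
  ρ_radial : ∀ x y, ‖x‖ = ‖y‖ → ρ x = ρ y
  χ_supp : tsupport χ ⊆ {x | ‖x‖ ≤ c}
  ρ_supp : tsupport ρ ⊆ {x | a ≤ ‖x‖ ∧ ‖x‖ ≤ b}
  sum_eq_one : ∀ x, HasSum (fun j : ℕ => ρ (((2 : ℝ) ^ j)⁻¹ • x)) (1 - χ x)
  disjoint_χ_ρ : ∀ j : ℕ, 1 ≤ j →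
    Disjoint (tsupport χ) (tsupport fun x => ρ (((2 : ℝ) ^ j)⁻¹ • x))
  disjoint_ρ_ρ : ∀ i j : ℕ, i + 2 ≤ j →
    Disjoint (tsupport fun x => ρ (((2 : ℝ) ^ i)⁻¹ • x))
      (tsupport fun x => ρ (((2 : ℝ) ^ j)⁻¹ • x))

namespace DyadicPartition

variable {d : ℕ} (P : DyadicPartition d)

/-- The functions `ρ_{n-1}`, `n = 0, 1, 2, …`; that is `ρ_{-1} = χ` for `n = 0` and
`ρ_j = ρ(2^{-j} ·)` for `n = j + 1`. The index is shifted by one throughout. -/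
def symbol : ℕ → Sp d → ℝ
  | 0 => P.χ
  | j + 1 => fun x => P.ρ (((2 : ℝ) ^ j)⁻¹ • x)

theorem symbol_smooth (n : ℕ) : ContDiff ℝ ∞ (P.symbol n) := by
  cases n with
  | zero => exact P.χ_smooth
  | succ j => exact P.ρ_smooth.comp (contDiff_const_smul _)

theorem symbol_compactSupport (n : ℕ) : HasCompactSupport (P.symbol n) := by
  have hχ : HasCompactSupport P.χ := by
    refine (isCompact_closedBall (0 : Sp d) P.c).of_isClosed_subset (isClosed_tsupport _) ?_
    intro x hx
    simpa using P.χ_supp hx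
  have hρ : HasCompactSupport P.ρ := by
    refine (isCompact_closedBall (0 : Sp d) P.b).of_isClosed_subset (isClosed_tsupport _) ?_
    intro x hx
    simpa using (P.ρ_supp hx).2
  cases n with
  | zero => exact hχ
  | succ j => exact hρ.comp_smul (by positivity)

/-- `ρ_{n-1}(2π ·)` as a complex Schwartz function. The dilation by `2π` translates between
the convention `e^{i⟨x,z⟩}` (without `2π`) for the Fourier transform and Mathlib's
`e^{2πi⟨x,ξ⟩}`. -/
def symbolSchwartz (n : ℕ) : 𝓢(Sp d, ℂ) :=
  HasCompactSupport.toSchwartzMap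
    (f := fun ξ : Sp d => ((P.symbol n ((2 * Real.pi) • ξ) : ℝ) : ℂ))
    (((P.symbol_compactSupport n).comp_smul (by positivity)).comp_left Complex.ofReal_zero)
    (Complex.ofRealCLM.contDiff.comp ((P.symbol_smooth n).comp (contDiff_const_smul _)))

/-- The kernel `K_{n-1} = 𝓕⁻¹ ρ_{n-1}`, i.e. `x ↦ (2π)^{-d} ∫ e^{i⟨x,z⟩} ρ_{n-1}(z) dz`. It is
real-valued because `ρ_{n-1}` is real and even, so taking the real part only changes the type. -/
def kernel (n : ℕ) : 𝓢(Sp d, ℝ) :=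
  SchwartzMap.postcompCLM (𝕜 := ℝ) Complex.reCLM (𝓕⁻ (P.symbolSchwartz n))

variable {F : Type*} [NormedAddCommGroup F] [NormedSpace ℝ F]

/-- The Schwartz function `z ↦ ψ (x - z)`. -/
def reflectAt (ψ : 𝓢(Sp d, ℝ)) (x : Sp d) : 𝓢(Sp d, ℝ) :=
  SchwartzMap.compSubConstCLM ℝ x
    (SchwartzMap.compCLMOfContinuousLinearEquiv ℝ (ContinuousLinearEquiv.neg ℝ) ψ)

/-- The Littlewood-Paley block `Δ_{n-1} f = K_{n-1} * f`, i.e. `x ↦ ⟨f, K_{n-1}(x - ·)⟩`. -/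
def block (n : ℕ) (f : TempDist d F) (x : Sp d) : F := f (reflectAt (P.kernel n) x)

/-- The Besov norm `‖f‖_{B^α_{p,q}}`, the `ℓ^q` norm over `j = n - 1 ≥ -1` of
`2^{jα} ‖Δ_j f‖_{L^p}`, with value `∞` if `f` is not in the space. -/
def besovNorm (α : ℝ) (p q : ℝ≥0∞) (f : TempDist d F) : ℝ≥0∞ :=
  eLpNorm (fun n : ℕ =>
    ENNReal.ofReal ((2 : ℝ) ^ (((n : ℝ) - 1) * α)) * eLpNorm (P.block n f) p volume)
    q Measure.count

/-- `f ∈ B^α_{p,q}`. -/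
def MemBesov (α : ℝ) (p q : ℝ≥0∞) (f : TempDist d F) : Prop := P.besovNorm α p q f < ⊤

end DyadicPartition

/-! ### Local times and infinitely regularizing paths -/

variable {d : ℕ}

/-- The occupation measure `μ_t(A) = λ {s ∈ [0,t] | w_s ∈ A}`, as a set function. -/
def occupation (w : ℝ → Sp d) (t : ℝ) (A : Set (Sp d)) : ℝ≥0∞ :=
  volume {s : ℝ | s ∈ Icc 0 t ∧ w s ∈ A}

/-- `L` is a local time of the path `w` on `[0,T]`. -/
structure IsLocalTime (T : ℝ) (w : ℝ → Sp d) (L : ℝ → Sp d → ℝ) : Prop where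
  measurable : Measurable fun p : Icc (0 : ℝ) T × Sp d => L p.1 p.2
  nonneg : ∀ t ∈ Icc 0 T, ∀ z, 0 ≤ L t z
  zero : ∀ z, L 0 z = 0
  density : ∀ t ∈ Icc 0 T, ∀ A, MeasurableSet A →
    occupation w t A = ∫⁻ z in A, ENNReal.ofReal (L t z)

/-- `L ∈ C^γ([0,T], 𝒞^α)`, where `𝒞^α = B^α_{∞,∞}` and each `L_t` is regarded as the distribution
`φ ↦ ∫ φ(z) L_t(z) dz`. -/
def MemHolderBesov (P : DyadicPartition d) (T γ α : ℝ) (L : ℝ → Sp d → ℝ) : Prop :=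
  ∃ Λ : ℝ → TempDist d ℝ,
    (∀ t ∈ Icc 0 T, ∀ φ : 𝓢(Sp d, ℝ),
      Integrable (fun z => φ z * L t z) ∧ Λ t φ = ∫ z, φ z * L t z) ∧
    (∀ t ∈ Icc 0 T, P.MemBesov α ⊤ ⊤ (Λ t)) ∧
    ∃ C : ℝ≥0, ∀ s ∈ Icc 0 T, ∀ t ∈ Icc 0 T,
      P.besovNorm α ⊤ ⊤ (Λ t - Λ s) ≤ C * ENNReal.ofReal (|t - s| ^ γ)

/-- The path `w` is infinitely regularizing on `[0,T]`: it has a local time which lies in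
`C^γ([0,T], 𝒞^α)` for all `γ ∈ (1/2, 1)` and all real `α`. -/
def IsInfinitelyRegularizing (P : DyadicPartition d) (T : ℝ) (w : ℝ → Sp d) : Prop :=
  ∃ L : ℝ → Sp d → ℝ, IsLocalTime T w L ∧
    ∀ γ ∈ Ioo (1 / 2 : ℝ) 1, ∀ α : ℝ, MemHolderBesov P T γ α L

/-! ### Averaging operator, non-linear Young integral, solutions -/

/-- `ψ` is a Schwartz version of the local time `L_t` of `w` at time `t`. There is at most one,
since a continuous density is unique. -/
def IsSmoothLocalTimeAt (w : ℝ → Sp d) (t : ℝ) (ψ : 𝓢(Sp d, ℝ)) : Prop :=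
  (∀ z, 0 ≤ ψ z) ∧
    ∀ A, MeasurableSet A → occupation w t A = ∫⁻ z in A, ENNReal.ofReal (ψ z)

open Classical in
/-- The averaging operator `T^w_t b(x) = ⟨b, L_t(· - x)⟩` for a distribution `b`, which extends
`∫_0^t b(x + w_r) dr = ∫ b(x + z) L_t(z) dz`. For a continuous infinitely regularizing `w` the
function `L_t` is smooth with compact support, so that the first case applies for every `t` in
`[0,T]`. -/
def avgOp (w : ℝ → Sp d) (b : TempDist d (Sp d)) (t : ℝ) (x : Sp d) : Sp d :=
  if h : ∃ ψ, IsSmoothLocalTimeAt w t ψ then b (SchwartzMap.compSubConstCLM ℝ x h.choose) else 0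

/-- `I = lim_{|𝒫| → 0} ∑_{[u,v] ∈ 𝒫} Ξ_{u,v}`, the limit over partitions `0 = u_0 < … < u_n = t`
of `[0,t]` as the mesh tends to zero. -/
def IsSewingLimit (Ξ : ℝ → ℝ → Sp d) (t : ℝ) (I : Sp d) : Prop :=
  ∀ ε : ℝ, 0 < ε → ∃ δ : ℝ, 0 < δ ∧ ∀ (n : ℕ) (u : ℕ → ℝ), u 0 = 0 → u n = t →
    (∀ i < n, u i < u (i + 1) ∧ u (i + 1) - u i < δ) →
    ‖(∑ i ∈ Finset.range n, Ξ (u i) (u (i + 1))) - I‖ < ε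

/-- `I = ∫_0^t Y_{dr}(y_r)`, the non-linear Young integral: the limit of the sums of
`Y_v(y_u) - Y_u(y_u)` over partitions. -/
def IsYoungIntegral (Y : ℝ → Sp d → Sp d) (y : ℝ → Sp d) (t : ℝ) (I : Sp d) : Prop :=
  IsSewingLimit (fun u v => Y v (y u) - Y u (y u)) t I

/-- The path `y` solves `y_t = x + ∫_0^t b(y_r) dr + w_t` on `[0,τ]`:
it is continuous, `z = y - w` is `ε`-Hölder on `[0,τ]` for some `ε > 0`, and
`z_t = x + ∫_0^t T^w_{dr} b(z_r)` for `t ∈ [0,τ]`. -/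
def IsSolutionOn (w : ℝ → Sp d) (b : TempDist d (Sp d)) (x : Sp d) (τ : ℝ)
    (y : ℝ → Sp d) : Prop :=
  ContinuousOn y (Icc 0 τ) ∧
    (∃ ε : ℝ≥0, 0 < ε ∧ ∃ C : ℝ≥0, HolderOnWith C ε (fun t => y t - w t) (Icc 0 τ)) ∧
    ∀ t ∈ Icc 0 τ, IsYoungIntegral (avgOp w b) (fun r => y r - w r) t (y t - w t - x)

/-- The interval `[0,S) ∩ [0,T]`, for `S ∈ (0,T] ∪ {∞}`. -/
def lifeInterval (T : ℝ) (S : EReal) : Set ℝ := {t | 0 ≤ t ∧ t ≤ T ∧ (t : EReal) < S}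

/-- `y` is a solution on `[0,S) ∩ [0,T]`: it is one on every `[0,τ]` with
`τ ∈ [0,S) ∩ [0,T]`. -/
def IsSolutionUpTo (T : ℝ) (w : ℝ → Sp d) (b : TempDist d (Sp d)) (x : Sp d) (S : EReal)
    (y : ℝ → Sp d) : Prop :=
  ∀ τ ∈ lifeInterval T S, IsSolutionOn w b x τ y

/-- `S = T^*(x)`: `S ∈ (0,T] ∪ {∞}`, there is a unique solution `y` on `[0,S) ∩ [0,T]`, and if
`S < ∞` it explodes, `lim_{t ↑ S} |y_t| = ∞`. -/
def IsExistenceTime (T : ℝ) (w : ℝ → Sp d) (b : TempDist d (Sp d)) (x : Sp d)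
    (S : EReal) : Prop :=
  0 < S ∧ (S ≤ (T : EReal) ∨ S = ⊤) ∧
    ∃ y : ℝ → Sp d, IsSolutionUpTo T w b x S y ∧
      (∀ y' : ℝ → Sp d, IsSolutionUpTo T w b x S y' → EqOn y' y (lifeInterval T S)) ∧
      (S ≠ ⊤ → Tendsto (fun t => ‖y t‖) (𝓝[<] S.toReal) atTop)

end PerturbedODE

end

noncomputable section

namespace PerturbedODE


/-! With `z = y - w` the equation reads `z_t = x + ∫_0^t A_{dr}(z_r)`, where `A = T^w b`. The
irregular drift enters only through `A`, and the theory of ordinary differential equations survives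
once `A` is `γ`-Hölder in time, with `γ` close to `1`, as a map into bounded functions with bounded
first and second differences (`YoungField`). These bounds are global in space, so solutions exist on
all of `[0,T]`, are bounded there, and cannot explode.

Regularity of `A` (`exists_youngField_avgOp`). The increment is a series `T^w_{s,t} b(x) = ∑_n ∫
ψ_n(z) Δ_n b(z + x) dz`, with `ψ_n` the part of `L_t - L_s` at frequencies next to those of the
`n`-th block. By Bernstein-type estimates, `Δ_n b` and its first and second differences are bounded
by multiples of `2^{nm}`, for some `m` depending on the Besov space (`exists_block_bounds`). It
remains to show that the `L¹` norm of `ψ_n` is at most `C (t - s)^γ 2^{-nN}` for every `N`. The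
hypothesis on the local time controls the supremum of each block by `(t - s)^{γ'}` with arbitrary
decay in `n`. Since occupation measures increase in time, `L_t - L_s` has `L¹` norm exactly `t - s`.
It vanishes outside a fixed ball, because `w` is bounded, so the geometric mean of the two bounds
controls the `L¹` norm of the block, with exponent `(1 + γ')/2`. Taking `γ' = 2γ - 1` gives `γ`. The
same decay makes the Fourier transform of `L_t` decay rapidly, which provides the smooth version of
`L_t` used in `avgOp`.

Existence (`YoungField.exists_solution`) comes from Euler schemes. Davie's estimate bounds the
remainder of the local expansion uniformly in the mesh, directly on the whole of `[0,T]`, and a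
limit along an ultrafilter keeps the bound.

Uniqueness (`YoungField.eq_of_isYoungIntegral`) comes from sewing along dyadic partitions: on short
intervals the `γ`-Hölder constant of the difference of two solutions is at most half of itself. A
solution is only assumed to be `ε`-Hölder after subtraction of `w`, for some `ε > 0`, so `γ` is
chosen after the solutions, above `1 - ε`; the expansion then upgrades them to `γ`-Hölder paths. -/

/-! ### Non-linear Young differential equations -/

section Young

variable {E : Type*} [NormedAddCommGroup E]

/-- The increment `A_{s,t}(x) = A_t(x) - A_s(x)` of a time-dependent field. -/
def incr (A : ℝ → E → E) (s t : ℝ) (x : E) : E := A t x - A s x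

theorem incr_add_incr (A : ℝ → E → E) (s u t : ℝ) (x : E) :
    incr A s u x + incr A u t x = incr A s t x := by
  simp only [incr]; abel

@[simp] theorem incr_self (A : ℝ → E → E) (s : ℝ) (x : E) : incr A s s x = 0 := by simp [incr]

/-- A field on `[0,T]` which is `γ`-Hölder in time with values in the fields that are bounded,
Lipschitz and have bounded second differences. -/
structure YoungField (T M γ : ℝ) (A : ℝ → E → E) : Prop where
  nonneg : 0 ≤ M
  bound : ∀ s t x, 0 ≤ s → s ≤ t → t ≤ T → ‖incr A s t x‖ ≤ M * (t - s) ^ γ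
  lipschitz : ∀ s t x y, 0 ≤ s → s ≤ t → t ≤ T →
    ‖incr A s t x - incr A s t y‖ ≤ M * (t - s) ^ γ * ‖x - y‖
  second : ∀ s t p h k, 0 ≤ s → s ≤ t → t ≤ T →
    ‖incr A s t (p + h + k) - incr A s t (p + h) - incr A s t (p + k) + incr A s t p‖
      ≤ M * (t - s) ^ γ * (‖h‖ * ‖k‖)

/-- Writing `p^κ = p * p^{κ-1}` extracts the gain `(2/3)^{κ-1} < 1`. The ratio `2/3` rather than
`1/2` leaves room for splitting an odd number of Euler steps. -/
theorem rpow_add_rpow_le {κ p q : ℝ} (hκ : 1 < κ) (hp : 0 ≤ p) (hq : 0 ≤ q)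
    (hp' : p ≤ 2 / 3 * (p + q)) (hq' : q ≤ 2 / 3 * (p + q)) :
    p ^ κ + q ^ κ ≤ (2 / 3) ^ (κ - 1) * (p + q) ^ κ := by
  have key : ∀ x : ℝ, 0 ≤ x → x ^ κ = x * x ^ (κ - 1) := fun x hx => by
    rw [← Real.rpow_one_add' hx (by linarith)]; congr 1; ring
  rw [key p hp, key q hq, key (p + q) (by positivity)]
  have h1 : p ^ (κ - 1) ≤ (2 / 3) ^ (κ - 1) * (p + q) ^ (κ - 1) := by
    rw [← Real.mul_rpow (by norm_num) (by positivity)]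
    exact Real.rpow_le_rpow hp hp' (by linarith)
  have h2 : q ^ (κ - 1) ≤ (2 / 3) ^ (κ - 1) * (p + q) ^ (κ - 1) := by
    rw [← Real.mul_rpow (by norm_num) (by positivity)]
    exact Real.rpow_le_rpow hq hq' (by linarith)
  nlinarith [mul_le_mul_of_nonneg_left h1 hp, mul_le_mul_of_nonneg_left h2 hq]

namespace YoungField

variable {T M γ : ℝ} {A : ℝ → E → E}

/-- Interpolation between the Lipschitz bound at small distance and the supremum bound at large
distance. The square root makes the constant of Davie's estimate enter its own induction as `√C`, so
that a large `C` closes it without `T` being small; the price is the condition `3γ/2 > 1`. -/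
theorem sqrt_holder (hA : YoungField T M γ A) {s t : ℝ} (hs : 0 ≤ s) (hst : s ≤ t) (ht : t ≤ T)
    (x y : E) :
    ‖incr A s t x - incr A s t y‖ ≤ 2 * M * (t - s) ^ γ * √‖x - y‖ := by
  have hτ : 0 ≤ M * (t - s) ^ γ := mul_nonneg hA.nonneg (Real.rpow_nonneg (by linarith) _)
  rcases le_total ‖x - y‖ 1 with h | h
  · have h1 : ‖x - y‖ ≤ √‖x - y‖ := by
      nlinarith [Real.sq_sqrt (norm_nonneg (x - y)), Real.sqrt_nonneg ‖x - y‖,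
        Real.sqrt_le_one.2 h]
    have := hA.lipschitz s t x y hs hst ht
    nlinarith [mul_le_mul_of_nonneg_left h1 hτ, mul_nonneg hτ (Real.sqrt_nonneg ‖x - y‖)]
  · have h1 : 1 ≤ √‖x - y‖ := Real.one_le_sqrt.2 h
    have := norm_sub_le (incr A s t x) (incr A s t y)
    have h2 := hA.bound s t x hs hst ht
    have h3 := hA.bound s t y hs hst ht
    nlinarith [mul_le_mul_of_nonneg_left h1 hτ]

/-- The point `x' + (y - y')` completes a parallelogram with `y'`, `y`, `x'`. The second difference
handles the parallelogram, and moving `x` to its fourth vertex costs a Lipschitz term. -/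
theorem second' (hA : YoungField T M γ A) {s t : ℝ} (hs : 0 ≤ s) (hst : s ≤ t) (ht : t ≤ T)
    (x x' y y' : E) :
    ‖(incr A s t x - incr A s t x') - (incr A s t y - incr A s t y')‖
      ≤ M * (t - s) ^ γ * (‖(x - x') - (y - y')‖ + ‖y - y'‖ * ‖x' - y'‖) := by
  have h1 := hA.lipschitz s t x (x' + (y - y')) hs hst ht
  have h2 := hA.second s t y' (y - y') (x' - y') hs hst ht
  have e1 : y' + (y - y') + (x' - y') = x' + (y - y') := by abel
  have e2 : y' + (y - y') = y := by abel
  have e3 : y' + (x' - y') = x' := by abel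
  have e4 : x - (x' + (y - y')) = (x - x') - (y - y') := by abel
  rw [e1, e2, e3] at h2
  rw [e4] at h1
  have e : (incr A s t x - incr A s t x') - (incr A s t y - incr A s t y') =
      (incr A s t x - incr A s t (x' + (y - y'))) + (incr A s t (x' + (y - y')) -
        incr A s t y - incr A s t x' + incr A s t y') := by abel
  rw [e, mul_add]
  exact (norm_add_le _ _).trans (add_le_add h1 h2)

/-- Davie's estimate: the one-step remainder of the Euler scheme is of order `3γ/2`, uniformly in
the step size. -/
theorem exists_euler_remainder_le (hA : YoungField T M γ A) (hT : 0 ≤ T) (hγ : 2 / 3 < γ) :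
    ∃ C : ℝ, 0 ≤ C ∧ ∀ (η : ℝ) (n : ℕ) (z : ℕ → E), 0 ≤ η → n * η ≤ T →
      (∀ i < n, z (i + 1) = z i + incr A (i * η) ((i + 1 : ℕ) * η) (z i)) →
      ∀ m i : ℕ, i + m ≤ n →
        ‖z (i + m) - z i - incr A (i * η) ((i + m : ℕ) * η) (z i)‖
          ≤ C * (m * η) ^ (3 * γ / 2) := by
  set κ := 3 * γ / 2 with hκ
  have hκ1 : 1 < κ := by linarith
  set θ : ℝ := (2 / 3) ^ (κ - 1) with hθ
  have hθ1 : θ < 1 := Real.rpow_lt_one (by norm_num) (by norm_num) (by linarith)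
  set a : ℝ := T ^ (γ / 2) with ha
  have ha0 : 0 ≤ a := Real.rpow_nonneg hT _
  have hM := hA.nonneg
  set q : ℝ := 2 * M * √(a + M) / (1 - θ) with hq
  set C : ℝ := (max 1 q) ^ 2 with hC
  have hC1 : 1 ≤ C := by nlinarith [le_max_left 1 q]
  have hCs : √C = max 1 q := Real.sqrt_sq (by positivity)
  have hCa : C * θ + 2 * M * √(C * a + M) ≤ C := by
    have h1 : √(C * a + M) ≤ √C * √(a + M) := by
      rw [← Real.sqrt_mul (by positivity)]
      exact Real.sqrt_le_sqrt (by nlinarith)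
    have h2 : 2 * M * √(a + M) ≤ (1 - θ) * √C := by
      rw [hCs]
      have : 2 * M * √(a + M) = (1 - θ) * q := by rw [hq]; field_simp [(by linarith : 1 - θ ≠ 0)]
      rw [this]
      exact mul_le_mul_of_nonneg_left (le_max_right _ _) (by linarith)
    have h3 : √C * √C = C := Real.mul_self_sqrt (by positivity)
    calc C * θ + 2 * M * √(C * a + M) ≤ C * θ + 2 * M * (√C * √(a + M)) := by gcongr
      _ = C * θ + √C * (2 * M * √(a + M)) := by ring
      _ ≤ C * θ + √C * ((1 - θ) * √C) := by gcongr
      _ = C * θ + (1 - θ) * (√C * √C) := by ring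
      _ = C := by rw [h3]; ring
  refine ⟨C, by linarith, fun η n z hη hn hz => ?_⟩
  intro m
  induction m using Nat.strong_induction_on with
  | _ m ih =>
  intro i hi
  rcases Nat.lt_or_ge m 2 with hm | hm
  · have : z (i + m) - z i - incr A (i * η) ((i + m : ℕ) * η) (z i) = 0 := by
      interval_cases m
      · simp
      · rw [hz i (by omega)]; abel
    rw [this, norm_zero]
    positivity
  -- Both halves have at most two thirds of the `m ≥ 2` steps; the worst case is `m = 3`. The
  -- remainder over `m` steps is the sum of those over the halves and of a spatial difference of `A`
  -- on the second half.
  · obtain ⟨k, l, hkl, hk1, hk, hl1, hl⟩ : ∃ k l : ℕ, k + l = m ∧ k < m ∧ 3 * k ≤ 2 * m ∧ l < m ∧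
        3 * l ≤ 2 * m := ⟨m / 2, m - m / 2, by omega, by omega, by omega, by omega, by omega⟩
    have hk' : (3 : ℝ) * k ≤ 2 * m := by exact_mod_cast hk
    have hl' : (3 : ℝ) * l ≤ 2 * m := by exact_mod_cast hl
    have hkl' : (k : ℝ) + l = m := by exact_mod_cast hkl
    have h1 := ih k hk1 i (by omega)
    have h2 := ih l hl1 (i + k) (by omega)
    rw [show i + k + l = i + m by omega] at h2
    set X : ℝ := m * η with hX
    have hX0 : 0 ≤ X := by positivity
    have hXT : X ≤ T := by
      refine le_trans ?_ hn
      rw [hX]; gcongr; omega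
    have hkX : (k : ℝ) * η ≤ X := by rw [hX]; gcongr; 
    have hlX : (l : ℝ) * η ≤ X := by rw [hX]; gcongr; 
    have hik : (i : ℝ) * η ≤ (i + k : ℕ) * η := by push_cast; nlinarith [Nat.cast_nonneg (α := ℝ) k]
    have him : ((i + k : ℕ) : ℝ) * η ≤ (i + m : ℕ) * η := by gcongr
    have hmT : ((i + m : ℕ) : ℝ) * η ≤ T := le_trans (by gcongr) hn
    have e1 : ((i + k : ℕ) : ℝ) * η - i * η = k * η := by push_cast; ring
    have e2 : ((i + m : ℕ) : ℝ) * η - (i + k : ℕ) * η = l * η := by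
      push_cast; rw [← hkl']; ring
    have b1 := hA.bound (i * η) ((i + k : ℕ) * η) (z i) (by positivity) hik (him.trans hmT)
    rw [e1] at b1
    have h3 : ‖z (i + k) - z i‖ ≤ (C * a + M) * X ^ γ := by
      have : z (i + k) - z i = (z (i + k) - z i - incr A (i * η) ((i + k : ℕ) * η) (z i)) +
        incr A (i * η) ((i + k : ℕ) * η) (z i) := by abel
      rw [this]
      refine (norm_add_le _ _).trans ?_
      have c1 : ((k : ℝ) * η) ^ κ ≤ a * X ^ γ := by
        calc ((k : ℝ) * η) ^ κ ≤ X ^ κ := Real.rpow_le_rpow (by positivity) hkX (by linarith)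
          _ = X ^ (γ / 2) * X ^ γ := by
            rw [← Real.rpow_add' hX0 (by linarith)]; congr 1; rw [hκ]; ring
          _ ≤ a * X ^ γ := by
            gcongr
            exact Real.rpow_le_rpow hX0 hXT (by linarith)
      have c2 : ((k : ℝ) * η) ^ γ ≤ X ^ γ := Real.rpow_le_rpow (by positivity) hkX (by linarith)
      calc _ ≤ C * ((k : ℝ) * η) ^ κ + M * ((k : ℝ) * η) ^ γ := add_le_add h1 b1
        _ ≤ C * (a * X ^ γ) + M * X ^ γ := by gcongr
        _ = _ := by ring
    have h4 := hA.sqrt_holder (by positivity) him hmT (z (i + k)) (z i)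
    rw [e2] at h4
    have h5 : ‖incr A ((i + k : ℕ) * η) ((i + m : ℕ) * η) (z (i + k)) -
        incr A ((i + k : ℕ) * η) ((i + m : ℕ) * η) (z i)‖ ≤ 2 * M * √(C * a + M) * X ^ κ := by
      refine h4.trans ?_
      have c1 : √‖z (i + k) - z i‖ ≤ √(C * a + M) * X ^ (γ / 2) := by
        refine (Real.sqrt_le_sqrt h3).trans_eq ?_
        rw [Real.sqrt_mul (by positivity), Real.sqrt_eq_rpow (X ^ γ), ← Real.rpow_mul hX0]
        congr 2; ring
      have c2 : ((l : ℝ) * η) ^ γ ≤ X ^ γ := Real.rpow_le_rpow (by positivity) hlX (by linarith)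
      calc 2 * M * ((l : ℝ) * η) ^ γ * √‖z (i + k) - z i‖
          ≤ 2 * M * X ^ γ * (√(C * a + M) * X ^ (γ / 2)) := by gcongr
        _ = 2 * M * √(C * a + M) * (X ^ (γ / 2) * X ^ γ) := by ring
        _ = _ := by
          rw [← Real.rpow_add' hX0 (by linarith)]; congr 2; rw [hκ]; ring
    have h6 := rpow_add_rpow_le (p := k * η) (q := l * η) hκ1 (by positivity) (by positivity)
      (by rw [← add_mul, hkl', ← mul_assoc]; exact mul_le_mul_of_nonneg_right (by linarith) hη)
      (by rw [← add_mul, hkl', ← mul_assoc]; exact mul_le_mul_of_nonneg_right (by linarith) hη)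
    rw [← add_mul, hkl'] at h6
    have e : z (i + m) - z i - incr A (i * η) ((i + m : ℕ) * η) (z i) =
        (z (i + k) - z i - incr A (i * η) ((i + k : ℕ) * η) (z i)) +
        (z (i + m) - z (i + k) - incr A ((i + k : ℕ) * η) ((i + m : ℕ) * η) (z (i + k))) +
        (incr A ((i + k : ℕ) * η) ((i + m : ℕ) * η) (z (i + k)) -
        incr A ((i + k : ℕ) * η) ((i + m : ℕ) * η) (z i)) := by
      rw [← incr_add_incr A (i * η) ((i + k : ℕ) * η) ((i + m : ℕ) * η) (z i)]; abel
    rw [e]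
    calc _ ≤ C * (k * η) ^ κ + C * (l * η) ^ κ + 2 * M * √(C * a + M) * X ^ κ :=
          (norm_add₃_le).trans (add_le_add (add_le_add h1 h2) h5)
      _ = C * ((k * η) ^ κ + (l * η) ^ κ) + 2 * M * √(C * a + M) * X ^ κ := by ring
      _ ≤ C * (θ * X ^ κ) + 2 * M * √(C * a + M) * X ^ κ := by gcongr
      _ = (C * θ + 2 * M * √(C * a + M)) * X ^ κ := by ring
      _ ≤ C * X ^ κ := by gcongr

/-- Existence for non-linear Young equations, in the form of a path with the local expansion
`z_t = z_s + A_{s,t}(z_s) + O(|t - s|^{3γ/2})`. -/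
theorem exists_solution [ProperSpace E] (hA : YoungField T M γ A) (hT : 0 < T) (hγ : 2 / 3 < γ)
    (x : E) :
    ∃ (z : ℝ → E) (C : ℝ), 0 ≤ C ∧ z 0 = x ∧ ∀ s t, 0 ≤ s → s ≤ t → t ≤ T →
      ‖z t - z s - incr A s t (z s)‖ ≤ C * (t - s) ^ (3 * γ / 2) := by
  obtain ⟨C, hC0, hC⟩ := hA.exists_euler_remainder_le hT.le hγ
  have hM := hA.nonneg
  set η : ℕ → ℝ := fun n => T / (n + 1 : ℕ) with hη
  have hηpos : ∀ n, 0 < η n := fun n => by simp only [hη]; positivity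
  have hηT : ∀ n, ((n + 1 : ℕ) : ℝ) * η n = T := fun n => by simp only [hη]; field_simp
  let u : ℕ → ℕ → E := fun n i =>
    Nat.rec x (fun j y => y + incr A (j * η n) ((j + 1 : ℕ) * η n) y) i
  have hu0 : ∀ n, u n 0 = x := fun n => rfl
  have hus : ∀ n i, u n (i + 1) = u n i + incr A (i * η n) ((i + 1 : ℕ) * η n) (u n i) :=
    fun n i => rfl
  -- Index of the last grid point before `t`; the scheme is extended to all times as a step
  -- function.
  let g : ℕ → ℝ → ℕ := fun n t => ⌊t / η n⌋₊
  have hgle : ∀ n t, 0 ≤ t → (g n t : ℝ) * η n ≤ t := fun n t ht => by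
    have := Nat.floor_le (div_nonneg ht (hηpos n).le)
    calc (g n t : ℝ) * η n ≤ t / η n * η n := by gcongr
      _ = t := by field_simp [(hηpos n).ne']
  have hglt : ∀ n t, t < (g n t : ℝ) * η n + η n := fun n t => by
    have := Nat.lt_floor_add_one (t / η n)
    rw [div_lt_iff₀ (hηpos n)] at this
    linarith
  have hgn : ∀ n t, 0 ≤ t → t ≤ T → g n t ≤ n + 1 := fun n t h0 h1 => by
    apply Nat.floor_le_of_le
    rw [div_le_iff₀ (hηpos n), hηT]; exact h1
  have hgmono : ∀ n s t, s ≤ t → g n s ≤ g n t := fun n s t h =>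
    Nat.floor_mono (by have := hηpos n; gcongr)
  have hrem : ∀ n s t, 0 ≤ s → s ≤ t → t ≤ T →
      ‖u n (g n t) - u n (g n s) - incr A (g n s * η n) (g n t * η n) (u n (g n s))‖
        ≤ C * (g n t * η n - g n s * η n) ^ (3 * γ / 2) := fun n s t h0 h1 h2 => by
    have h := hC (η n) (n + 1) (u n) (hηpos n).le (hηT n).le (fun i _ => hus n i)
      (g n t - g n s) (g n s) (by have := hgn n t (h0.trans h1) h2; have := hgmono n s t h1; omega)
    rw [Nat.add_sub_cancel' (hgmono n s t h1), Nat.cast_sub (hgmono n s t h1), sub_mul] at h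
    exact h
  have hηlim : Tendsto η atTop (𝓝 0) := by
    simp only [hη]
    exact (tendsto_const_div_atTop_nhds_zero_nat T).comp (tendsto_add_atTop_nat 1)
  have hglim : ∀ t, 0 ≤ t → Tendsto (fun n => (g n t : ℝ) * η n) atTop (𝓝 t) := fun t ht => by
    refine tendsto_of_tendsto_of_tendsto_of_le_of_le (g := fun n => t - η n) (h := fun _ => t)
      (by simpa using tendsto_const_nhds.sub hηlim) tendsto_const_nhds
      (fun n => by have := hglt n t; simp only; linarith) (fun n => hgle n t ht)
  set R : ℝ := C * T ^ (3 * γ / 2) + M * T ^ γ with hR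
  have hbd : ∀ t, 0 ≤ t → t ≤ T → ∀ n, u n (g n t) ∈ Metric.closedBall x R := fun t h0 h1 n => by
    have hg0 : g n 0 = 0 := by simp [g]
    have h := hrem n 0 t le_rfl h0 h1
    rw [hg0, hu0] at h
    simp only [Nat.cast_zero, zero_mul, sub_zero] at h
    have hb := hA.bound 0 (g n t * η n) x le_rfl (by have := hηpos n; positivity)
      ((hgle n t h0).trans h1)
    rw [sub_zero] at hb
    have hgt : (g n t : ℝ) * η n ≤ T := (hgle n t h0).trans h1
    have hg0 : 0 ≤ (g n t : ℝ) * η n := by have := hηpos n; positivity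
    rw [mem_closedBall_iff_norm]
    calc ‖u n (g n t) - x‖ = ‖(u n (g n t) - x - incr A 0 (g n t * η n) x) +
          incr A 0 (g n t * η n) x‖ := by congr 1; abel
      _ ≤ C * (g n t * η n) ^ (3 * γ / 2) + M * (g n t * η n) ^ γ :=
        (norm_add_le _ _).trans (add_le_add h hb)
      _ ≤ R := by rw [hR]; gcongr
  -- The approximations stay in one compact ball, so a single non-principal ultrafilter makes them
  -- converge at every time at once, with no extraction of subsequences.
  have hlim : ∀ t, ∃ y : E, 0 ≤ t → t ≤ T →
      Tendsto (fun n => u n (g n t)) (hyperfilter ℕ : Filter ℕ) (𝓝 y) := fun t => by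
    by_cases h : 0 ≤ t ∧ t ≤ T
    · obtain ⟨y, -, hy⟩ := (isCompact_closedBall x R).ultrafilter_le_nhds
        ((hyperfilter ℕ).map fun n => u n (g n t))
        (le_principal_iff.2 (Filter.mem_map.2 (Filter.univ_mem' fun n => hbd t h.1 h.2 n)))
      exact ⟨y, fun _ _ => hy⟩
    · exact ⟨0, fun h0 h1 => absurd ⟨h0, h1⟩ h⟩
  choose z hz using hlim
  have hle : (hyperfilter ℕ : Filter ℕ) ≤ atTop := by
    rw [← Nat.cofinite_eq_atTop]; exact hyperfilter_le_cofinite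
  refine ⟨z, C, hC0, ?_, fun s t h0 hst hT' => ?_⟩
  · have h1 := hz 0 le_rfl hT.le
    have h2 : (fun n => u n (g n 0)) = fun _ => x := by
      funext n; simp [g, hu0]
    rw [h2] at h1
    exact tendsto_nhds_unique h1 tendsto_const_nhds
  · have ht0 := h0.trans hst
    have hsT := hst.trans hT'
    have hzs := hz s h0 hsT
    have hzt := hz t ht0 hT'
    have gs := (hglim s h0).mono_left hle
    have gt := (hglim t ht0).mono_left hle
    -- Replacing the grid times by `s` and `t` costs `M` times the `γ`-th power of the grid error;
    -- replacing the scheme by its limit costs a Lipschitz term.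
    have hinc : Tendsto (fun n => incr A (g n s * η n) (g n t * η n) (u n (g n s)))
        (hyperfilter ℕ : Filter ℕ) (𝓝 (incr A s t (z s))) := by
      rw [tendsto_iff_norm_sub_tendsto_zero]
      have hb : ∀ n, ‖incr A (g n s * η n) (g n t * η n) (u n (g n s)) - incr A s t (z s)‖ ≤
          M * (s - g n s * η n) ^ γ + M * (t - g n t * η n) ^ γ +
            M * (t - s) ^ γ * ‖u n (g n s) - z s‖ := fun n => by
        have b1 := hA.bound (g n s * η n) s (u n (g n s)) (by have := hηpos n; positivity)
          (hgle n s h0) hsT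
        have b2 := hA.bound (g n t * η n) t (u n (g n s)) (by have := hηpos n; positivity)
          (hgle n t ht0) hT'
        have b3 := hA.lipschitz s t (u n (g n s)) (z s) h0 hst hT'
        have e : incr A (g n s * η n) (g n t * η n) (u n (g n s)) - incr A s t (z s) =
            incr A (g n s * η n) s (u n (g n s)) - incr A (g n t * η n) t (u n (g n s)) +
            (incr A s t (u n (g n s)) - incr A s t (z s)) := by
          simp only [incr]; abel
        rw [e]
        exact (norm_add_le _ _).trans (add_le_add ((norm_sub_le _ _).trans (add_le_add b1 b2)) b3)
      refine squeeze_zero (fun n => norm_nonneg _) hb ?_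
      have l1 : Tendsto (fun n => (s - g n s * η n) ^ γ) (hyperfilter ℕ : Filter ℕ) (𝓝 0) := by
        have := (tendsto_const_nhds (x := s).sub gs).rpow_const (p := γ) (Or.inr (by linarith))
        simpa [Real.zero_rpow (by linarith : γ ≠ 0)] using this
      have l2 : Tendsto (fun n => (t - g n t * η n) ^ γ) (hyperfilter ℕ : Filter ℕ) (𝓝 0) := by
        have := (tendsto_const_nhds (x := t).sub gt).rpow_const (p := γ) (Or.inr (by linarith))
        simpa [Real.zero_rpow (by linarith : γ ≠ 0)] using this
      have l3 : Tendsto (fun n => ‖u n (g n s) - z s‖) (hyperfilter ℕ : Filter ℕ) (𝓝 0) :=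
        tendsto_iff_norm_sub_tendsto_zero.1 hzs
      simpa using ((l1.const_mul M).add (l2.const_mul M)).add (l3.const_mul (M * (t - s) ^ γ))
    refine le_of_tendsto_of_tendsto (((hzt.sub hzs).sub hinc).norm)
      (((gt.sub gs).rpow_const (Or.inr (by linarith))).const_mul C)
      (Eventually.of_forall fun n => hrem n s t h0 hst hT')

end YoungField

end Young

/-! ### Sewing along dyadic partitions -/

section Sewing

variable {E : Type*} [NormedAddCommGroup E]

/-- The sum of a two-parameter function over the dyadic partition of `[s,t]` of level `k`. -/
def dyadicSum (Ξ : ℝ → ℝ → E) : ℕ → ℝ → ℝ → E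
  | 0, s, t => Ξ s t
  | k + 1, s, t => dyadicSum Ξ k s ((s + t) / 2) + dyadicSum Ξ k ((s + t) / 2) t

theorem dyadicSum_eq_sum (Ξ : ℝ → ℝ → E) (k : ℕ) (s t : ℝ) :
    dyadicSum Ξ k s t = ∑ i ∈ Finset.range (2 ^ k),
      Ξ (s + (t - s) * (i / 2 ^ k)) (s + (t - s) * ((i + 1 : ℕ) / 2 ^ k)) := by
  induction k generalizing s t with
  | zero => simp [dyadicSum]
  | succ k ih =>
    rw [dyadicSum, ih, ih, pow_succ, mul_two, Finset.sum_range_add]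
    have hk : (2 : ℝ) ^ k ≠ 0 := by positivity
    congr 1 <;> refine Finset.sum_congr rfl fun i _ => ?_
    · congr 1 <;> push_cast <;> field_simp <;> ring
    · congr 1 <;> push_cast <;> field_simp <;> ring

/-- Halving an interval multiplies the total bound over its two halves by `2 * 2^{-κ} = 2^{1-κ} <
1`. The constant `D = K / (1 - 2^{1-κ})` is the fixed point of `D ↦ D 2^{1-κ} + K`, hence does not
depend on the level. -/
theorem norm_dyadicSum_sub_le {Ξ : ℝ → ℝ → E} {K κ s t : ℝ} (hκ : 1 < κ) (hst : s ≤ t)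
    (h : ∀ a b, s ≤ a → a ≤ b → b ≤ t →
      ‖Ξ a ((a + b) / 2) + Ξ ((a + b) / 2) b - Ξ a b‖ ≤ K * (b - a) ^ κ) (k : ℕ) :
    ‖dyadicSum Ξ k s t - Ξ s t‖ ≤ K / (1 - 2 ^ (1 - κ)) * (t - s) ^ κ := by
  have h2 : (2 : ℝ) ^ (1 - κ) < 1 := Real.rpow_lt_one_of_one_lt_of_neg (by norm_num) (by linarith)
  induction k generalizing s t with
  | zero =>
    simp only [dyadicSum, sub_self, norm_zero]
    have h0 := (norm_nonneg _).trans (h s t le_rfl hst le_rfl)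
    rw [div_mul_eq_mul_div]
    exact div_nonneg h0 (by linarith)
  | succ k ih =>
    have i1 := ih (s := s) (t := (s + t) / 2) (by linarith)
      (fun a b h1 h2 h3 => h a b h1 h2 (by linarith))
    have i2 := ih (s := (s + t) / 2) (t := t) (by linarith)
      (fun a b h1 h2 h3 => h a b (by linarith) h2 h3)
    have i3 := h s t le_rfl hst le_rfl
    set D := K / (1 - 2 ^ (1 - κ)) with hD
    have hDK : D * 2 ^ (1 - κ) + K = D := by
      rw [hD]; field_simp [(by linarith : (1 : ℝ) - 2 ^ (1 - κ) ≠ 0)]; ring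
    have e1 : ((s + t) / 2 - s) = (t - s) * 2⁻¹ := by ring
    have e2 : (t - (s + t) / 2) = (t - s) * 2⁻¹ := by ring
    have e3 : (2 : ℝ)⁻¹ ^ κ * 2 = 2 ^ (1 - κ) := by
      rw [Real.inv_rpow (by norm_num), Real.rpow_sub (by norm_num), Real.rpow_one]; field_simp
    rw [e1, Real.mul_rpow (by linarith) (by norm_num)] at i1
    rw [e2, Real.mul_rpow (by linarith) (by norm_num)] at i2
    have e : dyadicSum Ξ (k + 1) s t - Ξ s t =
        (dyadicSum Ξ k s ((s + t) / 2) - Ξ s ((s + t) / 2)) +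
        (dyadicSum Ξ k ((s + t) / 2) t - Ξ ((s + t) / 2) t) +
        (Ξ s ((s + t) / 2) + Ξ ((s + t) / 2) t - Ξ s t) := by rw [dyadicSum]; abel
    rw [e]
    refine (norm_add₃_le.trans (add_le_add (add_le_add i1 i2) i3)).trans_eq ?_
    calc _ = (D * (2⁻¹ ^ κ * 2) + K) * (t - s) ^ κ := by ring
      _ = _ := by rw [e3, hDK]

theorem partition_le {n : ℕ} {u : ℕ → ℝ} (h : ∀ i < n, u i < u (i + 1)) {i j : ℕ} (hij : i ≤ j)
    (hj : j ≤ n) : u i ≤ u j := by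
  induction j, hij using Nat.le_induction with
  | base => rfl
  | succ j _ ih => exact (ih (by omega)).trans (h j (by omega)).le

theorem exists_partition {s δ : ℝ} (hs : 0 ≤ s) (hδ : 0 < δ) :
    ∃ (n : ℕ) (u : ℕ → ℝ), u 0 = 0 ∧ u n = s ∧
      ∀ i < n, u i < u (i + 1) ∧ u (i + 1) - u i < δ := by
  rcases hs.eq_or_lt with rfl | hs
  · exact ⟨0, fun _ => 0, rfl, rfl, by simp⟩
  obtain ⟨n, hn⟩ := exists_nat_gt (s / δ)
  have hn0 : (0 : ℝ) < n := (by positivity : 0 < s / δ).trans hn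
  refine ⟨n, fun i => s * (i / n), by simp, by field_simp, fun i _ => ?_⟩
  have e : s * (((i + 1 : ℕ) : ℝ) / n) - s * (i / n) = s / n := by push_cast; field_simp; ring
  have : 0 < s / n := by positivity
  refine ⟨by simp only; linarith, ?_⟩
  simp only
  rw [e, div_lt_iff₀ hn0]
  rwa [div_lt_iff₀ hδ, mul_comm] at hn

end Sewing

/-! ### Young integrals, local expansions and uniqueness -/

variable {d : ℕ}

theorem IsSewingLimit.sub {Ξ Ξ' : ℝ → ℝ → Sp d} {t : ℝ} {I I' : Sp d} (h : IsSewingLimit Ξ t I)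
    (h' : IsSewingLimit Ξ' t I') :
    IsSewingLimit (fun u v => Ξ u v - Ξ' u v) t (I - I') := by
  intro ε hε
  obtain ⟨δ, hδ, H⟩ := h (ε / 2) (by positivity)
  obtain ⟨δ', hδ', H'⟩ := h' (ε / 2) (by positivity)
  refine ⟨min δ δ', lt_min hδ hδ', fun n u h0 hn hu => ?_⟩
  have h1 := H n u h0 hn fun i hi => ⟨(hu i hi).1, (hu i hi).2.trans_le (min_le_left _ _)⟩
  have h2 := H' n u h0 hn fun i hi => ⟨(hu i hi).1, (hu i hi).2.trans_le (min_le_right _ _)⟩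
  rw [Finset.sum_sub_distrib, sub_sub_sub_comm]
  exact (norm_sub_le _ _).trans_lt (by linarith)

/-- The partition of `[0,0]` has no cells, so its sum is zero. This fixes the initial value of a
solution. -/
theorem IsSewingLimit.eq_zero {Ξ : ℝ → ℝ → Sp d} {I : Sp d} (h : IsSewingLimit Ξ 0 I) : I = 0 := by
  by_contra hI
  obtain ⟨δ, -, H⟩ := h ‖I‖ (norm_pos_iff.2 hI)
  simpa using H 0 (fun _ => 0) rfl rfl (by simp)

/-- Sewing limits are defined on intervals starting at `0`. A fixed fine partition of `[0,s]`, put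
in front of the dyadic partitions of `[s,t]`, transfers them to `[s,t]`: its sum is close to `I`,
and the total sum is close to `J`. -/
theorem IsSewingLimit.tendsto_dyadicSum {Ξ : ℝ → ℝ → Sp d} {s t : ℝ} {I J : Sp d}
    (hI : IsSewingLimit Ξ s I) (hJ : IsSewingLimit Ξ t J) (hs : 0 ≤ s) (hst : s < t) :
    Tendsto (fun k => dyadicSum Ξ k s t) atTop (𝓝 (J - I)) := by
  rw [Metric.tendsto_atTop]
  intro ε hε
  obtain ⟨δ, hδ, H⟩ := hI (ε / 2) (by positivity)
  obtain ⟨δ', hδ', H'⟩ := hJ (ε / 2) (by positivity)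
  obtain ⟨n, u, u0, un, hu⟩ := exists_partition hs (lt_min hδ hδ')
  have hlim : Tendsto (fun k : ℕ => (t - s) / 2 ^ k) atTop (𝓝 0) :=
    tendsto_const_nhds.div_atTop (tendsto_pow_atTop_atTop_of_one_lt (by norm_num))
  obtain ⟨k₀, hk₀⟩ := eventually_atTop.1 (hlim.eventually (gt_mem_nhds hδ'))
  refine ⟨k₀, fun k hk => ?_⟩
  have hkδ := hk₀ k hk
  have hpow : (0 : ℝ) < 2 ^ k := by positivity
  -- The concatenated partition; the two formulas agree at index `n`, where both give `s`.
  let v : ℕ → ℝ := fun i => if i < n then u i else s + (t - s) * (((i - n : ℕ) : ℝ) / 2 ^ k)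
  have hv1 : ∀ i ≤ n, v i = u i := fun i hi => by
    rcases hi.lt_or_eq with h | rfl
    · simp [v, h]
    · simp [v, un]
  have hv2 : ∀ i, v (n + i) = s + (t - s) * ((i : ℝ) / 2 ^ k) := fun i => by simp [v]
  have hv3 : ∀ i, v (n + i + 1) = s + (t - s) * (((i + 1 : ℕ) : ℝ) / 2 ^ k) := fun i => by
    rw [add_assoc, hv2]
  have h1 := H n u u0 un fun i hi => ⟨(hu i hi).1, (hu i hi).2.trans_le (min_le_left _ _)⟩
  have h2 := H' (n + 2 ^ k) v (by rw [hv1 0 (Nat.zero_le _), u0])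
    (by rw [hv2]; push_cast; rw [div_self hpow.ne']; ring) fun i hi => by
      rcases Nat.lt_or_ge i n with h | h
      · rw [hv1 i h.le, hv1 (i + 1) h]
        exact ⟨(hu i h).1, (hu i h).2.trans_le (min_le_right _ _)⟩
      · obtain ⟨j, rfl⟩ := Nat.exists_eq_add_of_le h
        have e : v (n + j + 1) - v (n + j) = (t - s) / 2 ^ k := by
          rw [hv2, hv3]; push_cast; field_simp; ring
        have : 0 < (t - s) / 2 ^ k := div_pos (by linarith) hpow
        exact ⟨by linarith, by linarith⟩
  rw [Finset.sum_range_add] at h2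
  have e1 : ∑ i ∈ Finset.range n, Ξ (v i) (v (i + 1)) =
      ∑ i ∈ Finset.range n, Ξ (u i) (u (i + 1)) := Finset.sum_congr rfl fun i hi => by
    have := Finset.mem_range.1 hi
    rw [hv1 i this.le, hv1 (i + 1) this]
  have e2 : ∑ i ∈ Finset.range (2 ^ k), Ξ (v (n + i)) (v (n + i + 1)) = dyadicSum Ξ k s t := by
    rw [dyadicSum_eq_sum]
    exact Finset.sum_congr rfl fun i _ => by rw [hv2, hv3]
  rw [e1, e2] at h2
  rw [dist_eq_norm]
  set S := ∑ i ∈ Finset.range n, Ξ (u i) (u (i + 1))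
  have e : dyadicSum Ξ k s t - (J - I) = (S + dyadicSum Ξ k s t - J) - (S - I) := by abel
  rw [e]
  exact (norm_sub_le _ _).trans_lt (by linarith)

/-- A path with a local expansion of order greater than one solves the integral equation. -/
theorem isYoungIntegral_of_local {A : ℝ → Sp d → Sp d} {z : ℝ → Sp d} {C κ t : ℝ} (hC : 0 ≤ C)
    (hκ : 1 < κ)
    (h : ∀ u v, 0 ≤ u → u ≤ v → v ≤ t → ‖z v - z u - incr A u v (z u)‖ ≤ C * (v - u) ^ κ)
    (ht : 0 ≤ t) : IsYoungIntegral A z t (z t - z 0) := by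
  intro ε hε
  have hq : 0 < ε / (C * t + 1) := by positivity
  -- With this mesh `δ^{κ-1} = ε / (C t + 1)`, so the local errors add up to at most `C t δ^{κ-1} <
  -- ε`.
  refine ⟨(ε / (C * t + 1)) ^ (1 / (κ - 1)), Real.rpow_pos_of_pos hq _, fun n u u0 un hu => ?_⟩
  set δ := (ε / (C * t + 1)) ^ (1 / (κ - 1)) with hδ
  have hδκ : δ ^ (κ - 1) = ε / (C * t + 1) := by
    rw [hδ, ← Real.rpow_mul hq.le, one_div, inv_mul_cancel₀ (by linarith), Real.rpow_one]
  have hmono := fun i (hi : i < n) => (hu i hi).1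
  have hterm : ∀ i ∈ Finset.range n, ‖z (u (i + 1)) - z (u i) - incr A (u i) (u (i + 1)) (z (u i))‖
      ≤ C * δ ^ (κ - 1) * (u (i + 1) - u i) := fun i hi => by
    have hi' := Finset.mem_range.1 hi
    have a1 : 0 ≤ u i := u0 ▸ partition_le hmono (Nat.zero_le i) hi'.le
    have a2 : u (i + 1) ≤ t := un ▸ partition_le hmono hi' le_rfl
    have a3 := hu i hi'
    refine (h _ _ a1 a3.1.le a2).trans ?_
    have hΔ : 0 ≤ u (i + 1) - u i := by linarith [a3.1]
    have e : (u (i + 1) - u i) ^ κ = (u (i + 1) - u i) * (u (i + 1) - u i) ^ (κ - 1) := by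
      rw [← Real.rpow_one_add' hΔ (by linarith)]; congr 1; ring
    have : (u (i + 1) - u i) ^ (κ - 1) ≤ δ ^ (κ - 1) :=
      Real.rpow_le_rpow hΔ a3.2.le (by linarith)
    rw [e]
    calc C * ((u (i + 1) - u i) * (u (i + 1) - u i) ^ (κ - 1))
        ≤ C * ((u (i + 1) - u i) * δ ^ (κ - 1)) := by gcongr
      _ = _ := by ring
  have e : (∑ i ∈ Finset.range n, (A (u (i + 1)) (z (u i)) - A (u i) (z (u i)))) - (z t - z 0) =
      -∑ i ∈ Finset.range n, (z (u (i + 1)) - z (u i) - incr A (u i) (u (i + 1)) (z (u i))) := by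
    rw [Finset.sum_sub_distrib (fun i => z (u (i + 1)) - z (u i)),
      Finset.sum_range_sub (fun i => z (u i)), u0, un]
    simp only [incr]; abel
  rw [e, norm_neg]
  calc _ ≤ ∑ i ∈ Finset.range n, C * δ ^ (κ - 1) * (u (i + 1) - u i) :=
        (norm_sum_le _ _).trans (Finset.sum_le_sum hterm)
    _ = C * t * (ε / (C * t + 1)) := by
        rw [← Finset.mul_sum, Finset.sum_range_sub, u0, un, hδκ]; ring
    _ < ε := by
        rw [mul_div_assoc', div_lt_iff₀ (by positivity)]; nlinarith

namespace YoungField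

variable {T M γ : ℝ} {A : ℝ → Sp d → Sp d}

/-- A Hölder solution of the integral equation has a local expansion. -/
theorem exists_local_of_isYoungIntegral (hA : YoungField T M γ A) (hγ : 0 ≤ γ)
    {z : ℝ → Sp d} {x : Sp d} {H ε : ℝ} (hε : 0 ≤ ε) (hγε : 1 < γ + ε) (hH : 0 ≤ H)
    (hz : ∀ s t, 0 ≤ s → s ≤ t → t ≤ T → ‖z t - z s‖ ≤ H * (t - s) ^ ε)
    (hI : ∀ t, 0 ≤ t → t ≤ T → IsYoungIntegral A z t (z t - x)) :
    ∃ C, 0 ≤ C ∧ ∀ s t, 0 ≤ s → s ≤ t → t ≤ T →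
      ‖z t - z s - incr A s t (z s)‖ ≤ C * (t - s) ^ (γ + ε) := by
  have h2 : (2 : ℝ) ^ (1 - (γ + ε)) < 1 :=
    Real.rpow_lt_one_of_one_lt_of_neg (by norm_num) (by linarith)
  have hM := hA.nonneg
  refine ⟨M * H / (1 - 2 ^ (1 - (γ + ε))), div_nonneg (by positivity) (by linarith),
    fun s t hs hst ht => ?_⟩
  rcases hst.eq_or_lt with rfl | hst'
  · simp [Real.zero_rpow (by linarith : γ + ε ≠ 0)]
  have hlim := (hI s hs (hst.trans ht)).tendsto_dyadicSum (hI t (hs.trans hst) ht) hs hst'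
  have e : z t - x - (z s - x) = z t - z s := by abel
  rw [e] at hlim
  refine le_of_tendsto ((hlim.sub_const _).norm) (Eventually.of_forall fun k => ?_)
  refine norm_dyadicSum_sub_le (Ξ := fun u v => incr A u v (z u)) hγε hst (fun a b ha hab hb => ?_) k
  set m := (a + b) / 2 with hm
  have ham : a ≤ m := by rw [hm]; linarith
  have hmb : m ≤ b := by rw [hm]; linarith
  -- By additivity of `A` in time, only the change of the base point on the second half remains. It
  -- is of order `γ + ε > 1` in the length.
  have e' : incr A a m (z a) + incr A m b (z m) - incr A a b (z a) =
      incr A m b (z m) - incr A m b (z a) := by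
    rw [← incr_add_incr A a m b (z a)]; abel
  rw [e']
  have b1 := hA.lipschitz m b (z m) (z a) (by linarith) hmb (by linarith)
  have b2 := hz a m (by linarith) ham (by linarith)
  have hba : 0 ≤ b - a := by linarith
  have c1 : (b - m) ^ γ ≤ (b - a) ^ γ := Real.rpow_le_rpow (by linarith) (by linarith) hγ
  have c2 : (m - a) ^ ε ≤ (b - a) ^ ε := Real.rpow_le_rpow (by linarith) (by linarith) hε
  calc _ ≤ M * (b - m) ^ γ * ‖z m - z a‖ := b1
    _ ≤ M * (b - a) ^ γ * (H * (b - a) ^ ε) := by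
      refine mul_le_mul (by gcongr) (b2.trans (by gcongr)) (norm_nonneg _) ?_
      exact mul_nonneg hM (Real.rpow_nonneg hba _)
    _ = M * H * (b - a) ^ (γ + ε) := by rw [Real.rpow_add' hba (by linarith)]; ring

/-- In the expansion of `z`, the main term is of order `γ` and the remainder of order at least `γ`.
This raises the Hölder exponent of a solution from an arbitrary `ε` to that of the field. -/
theorem holder_of_local (hA : YoungField T M γ A) {z : ℝ → Sp d} {C ε : ℝ}
    (hC : 0 ≤ C) (hε : 0 ≤ ε) (hγε : 0 < γ + ε)
    (hz : ∀ s t, 0 ≤ s → s ≤ t → t ≤ T →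
      ‖z t - z s - incr A s t (z s)‖ ≤ C * (t - s) ^ (γ + ε)) :
    ∀ s t, 0 ≤ s → s ≤ t → t ≤ T → ‖z t - z s‖ ≤ (M + C * T ^ ε) * (t - s) ^ γ := by
  intro s t hs hst ht
  have hts : 0 ≤ t - s := by linarith
  have b1 := hA.bound s t (z s) hs hst ht
  have b2 := hz s t hs hst ht
  have b3 : (t - s) ^ ε ≤ T ^ ε := Real.rpow_le_rpow hts (by linarith) hε
  have e : z t - z s = incr A s t (z s) + (z t - z s - incr A s t (z s)) := by abel
  rw [e]
  calc _ ≤ M * (t - s) ^ γ + C * (t - s) ^ (γ + ε) := (norm_add_le _ _).trans (add_le_add b1 b2)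
    _ = M * (t - s) ^ γ + C * ((t - s) ^ γ * (t - s) ^ ε) := by
      rw [Real.rpow_add' hts hγε.ne']
    _ ≤ M * (t - s) ^ γ + C * ((t - s) ^ γ * T ^ ε) := by
      have := Real.rpow_nonneg hts γ
      gcongr
    _ = _ := by ring

/-- Uniqueness for non-linear Young equations. -/
theorem eq_of_isYoungIntegral (hA : YoungField T M γ A) (hγ : 1 / 2 < γ)
    {z z' : ℝ → Sp d} {x : Sp d} {H : ℝ} (hH : 0 ≤ H)
    (hz : ∀ s t, 0 ≤ s → s ≤ t → t ≤ T → ‖z t - z s‖ ≤ H * (t - s) ^ γ)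
    (hz' : ∀ s t, 0 ≤ s → s ≤ t → t ≤ T → ‖z' t - z' s‖ ≤ H * (t - s) ^ γ)
    (hI : ∀ t, 0 ≤ t → t ≤ T → IsYoungIntegral A z t (z t - x))
    (hI' : ∀ t, 0 ≤ t → t ≤ T → IsYoungIntegral A z' t (z' t - x)) :
    ∀ t, 0 ≤ t → t ≤ T → z t = z' t := by
  have hM := hA.nonneg
  have hκ : 1 < γ + γ := by linarith
  have h2 : (2 : ℝ) ^ (1 - (γ + γ)) < 1 :=
    Real.rpow_lt_one_of_one_lt_of_neg (by norm_num) (by linarith)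
  set D : ℝ := 1 / (1 - 2 ^ (1 - (γ + γ))) with hD
  have hD0 : 0 ≤ D := div_nonneg zero_le_one (by linarith)
  -- The summand `(1 + H) * D` comes from the sewing remainder and the summand `1` from the
  -- Lipschitz bound on the main term. The length `h` below is such that `Q * h^γ ≤ 1/2` and `h^γ ≤
  -- 1`.
  set Q : ℝ := M * (1 + (1 + H) * D) with hQ
  have hQ0 : 0 ≤ Q := by positivity
  set h : ℝ := (1 / (2 * Q + 1)) ^ (1 / γ) with hh
  have hh0 : 0 < h := Real.rpow_pos_of_pos (by positivity) _
  have hhγ : h ^ γ = 1 / (2 * Q + 1) := by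
    rw [hh, ← Real.rpow_mul (by positivity), one_div_mul_cancel (by linarith), Real.rpow_one]
  have hhγ1 : h ^ γ ≤ 1 := by
    rw [hhγ, div_le_one (by positivity)]; linarith
  have hQh : Q * h ^ γ ≤ 1 / 2 := by
    rw [hhγ, mul_one_div, div_le_div_iff₀ (by positivity) (by norm_num)]; linarith
  -- If the paths agree at `c`, a Hölder constant `N` of their difference on `[c, c + h]` also
  -- bounds its size there by `N h^γ`. Both terms of the expansion of the difference are then
  -- proportional to `N`.
  have contract : ∀ c, 0 ≤ c → z c = z' c → ∀ N, 0 ≤ N →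
      (∀ s t, c ≤ s → s ≤ t → t ≤ c + h → t ≤ T →
        ‖(z t - z' t) - (z s - z' s)‖ ≤ N * (t - s) ^ γ) →
      ∀ s t, c ≤ s → s ≤ t → t ≤ c + h → t ≤ T →
        ‖(z t - z' t) - (z s - z' s)‖ ≤ N / 2 * (t - s) ^ γ := by
    intro c hc hzc N hN hb s t hcs hst hth htT
    rcases hst.eq_or_lt with rfl | hst'
    · simp [Real.zero_rpow (by linarith : γ ≠ 0)]
    have hvs : ∀ r, c ≤ r → r ≤ c + h → r ≤ T → ‖z r - z' r‖ ≤ N * h ^ γ := fun r h1 h2 h3 => by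
      have := hb c r le_rfl h1 h2 h3
      rw [hzc, sub_self, sub_zero] at this
      refine this.trans ?_
      gcongr
      linarith
    have h0s : 0 ≤ s := hc.trans hcs
    have hlim := ((hI s h0s (hst.trans htT)).sub (hI' s h0s (hst.trans htT))).tendsto_dyadicSum
      ((hI t (h0s.trans hst) htT).sub (hI' t (h0s.trans hst) htT)) h0s hst'
    have e : z t - x - (z' t - x) - (z s - x - (z' s - x)) = (z t - z' t) - (z s - z' s) := by abel
    rw [e] at hlim
    have hts : 0 ≤ t - s := by linarith
    have hrem : ‖(z t - z' t) - (z s - z' s) - (incr A s t (z s) - incr A s t (z' s))‖ ≤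
        M * (1 + H) * N / (1 - 2 ^ (1 - (γ + γ))) * (t - s) ^ (γ + γ) := by
      refine le_of_tendsto ((hlim.sub_const _).norm) (Eventually.of_forall fun k => ?_)
      refine norm_dyadicSum_sub_le (Ξ := fun u v => incr A u v (z u) - incr A u v (z' u)) hκ hst
        (fun a b ha hab hb' => ?_) k
      set m := (a + b) / 2 with hm
      have ham : a ≤ m := by rw [hm]; linarith
      have hmb : m ≤ b := by rw [hm]; linarith
      have e' : (incr A a m (z a) - incr A a m (z' a)) + (incr A m b (z m) - incr A m b (z' m)) -
          (incr A a b (z a) - incr A a b (z' a)) =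
          (incr A m b (z m) - incr A m b (z' m)) - (incr A m b (z a) - incr A m b (z' a)) := by
        rw [← incr_add_incr A a m b (z a), ← incr_add_incr A a m b (z' a)]; abel
      rw [e']
      -- The four-point estimate separates the increment of `z - z'` from its size times the
      -- increment of `z'`; each is at most a multiple of `N (b - a)^γ`.
      have b0 := hA.second' (by linarith) hmb (by linarith) (z m) (z' m) (z a) (z' a)
      have b1 := hb a m (by linarith) ham (by linarith) (by linarith)
      have b2 := (hvs a (by linarith) (by linarith) (by linarith)).trans
        (mul_le_of_le_one_right hN hhγ1)
      have b3 := hz' a m (by linarith) ham (by linarith)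
      have hba : 0 ≤ b - a := by linarith
      have hbaγ : 0 ≤ (b - a) ^ γ := Real.rpow_nonneg hba _
      have c1 : (b - m) ^ γ ≤ (b - a) ^ γ :=
        Real.rpow_le_rpow (by linarith) (by linarith) (by linarith)
      have c2 : (m - a) ^ γ ≤ (b - a) ^ γ :=
        Real.rpow_le_rpow (by linarith) (by linarith) (by linarith)
      calc _ ≤ M * (b - m) ^ γ * (‖(z m - z' m) - (z a - z' a)‖ + ‖z a - z' a‖ * ‖z' m - z' a‖) :=
            b0
        _ ≤ M * (b - a) ^ γ * (N * (b - a) ^ γ + N * (H * (b - a) ^ γ)) := by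
          refine mul_le_mul (by gcongr) (add_le_add (b1.trans (by gcongr)) ?_) (by positivity)
            (by positivity)
          exact mul_le_mul b2 (b3.trans (by gcongr)) (norm_nonneg _) hN
        _ = M * (1 + H) * N * (b - a) ^ (γ + γ) := by
          rw [Real.rpow_add' hba (by linarith)]; ring
    have b4 := hA.lipschitz s t (z s) (z' s) h0s hst htT
    have b5 := hvs s hcs (by linarith) (by linarith)
    have htsγ : 0 ≤ (t - s) ^ γ := Real.rpow_nonneg hts _
    have c3 : (t - s) ^ (γ + γ) ≤ h ^ γ * (t - s) ^ γ := by
      rw [Real.rpow_add' hts (by linarith)]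
      gcongr
      linarith
    have hK : M * (1 + H) * N / (1 - 2 ^ (1 - (γ + γ))) = M * (1 + H) * N * D := by
      rw [hD]; ring
    rw [hK] at hrem
    have e'' : (z t - z' t) - (z s - z' s) =
        ((z t - z' t) - (z s - z' s) - (incr A s t (z s) - incr A s t (z' s))) +
        (incr A s t (z s) - incr A s t (z' s)) := by abel
    rw [e'']
    calc _ ≤ M * (1 + H) * N * D * (t - s) ^ (γ + γ) + M * (t - s) ^ γ * ‖z s - z' s‖ :=
          (norm_add_le _ _).trans (add_le_add hrem b4)
      _ ≤ M * (1 + H) * N * D * (h ^ γ * (t - s) ^ γ) + M * (t - s) ^ γ * (N * h ^ γ) := by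
        gcongr
      _ = N * (Q * h ^ γ) * (t - s) ^ γ := by rw [hQ]; ring
      _ ≤ N * (1 / 2) * (t - s) ^ γ := by gcongr
      _ = _ := by ring
  have step : ∀ c, 0 ≤ c → z c = z' c → ∀ t, c ≤ t → t ≤ c + h → t ≤ T → z t = z' t := by
    intro c hc hzc t hct hth htT
    -- The triangle inequality gives the first constant `2 * H`; contraction halves it indefinitely.
    have hall : ∀ k : ℕ, ∀ s t, c ≤ s → s ≤ t → t ≤ c + h → t ≤ T →
        ‖(z t - z' t) - (z s - z' s)‖ ≤ 2 * H / 2 ^ k * (t - s) ^ γ := by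
      intro k
      induction k with
      | zero =>
        intro s t h1 h2 h3 h4
        have a1 := hz s t (hc.trans h1) h2 h4
        have a2 := hz' s t (hc.trans h1) h2 h4
        have e : (z t - z' t) - (z s - z' s) = (z t - z s) - (z' t - z' s) := by abel
        rw [e]
        refine (norm_sub_le _ _).trans ((add_le_add a1 a2).trans_eq ?_)
        ring
      | succ k ih =>
        intro s t h1 h2 h3 h4
        have := contract c hc hzc _ (by positivity) ih s t h1 h2 h3 h4
        rwa [div_div, ← pow_succ] at this
    have hl : Tendsto (fun k : ℕ => 2 * H / 2 ^ k * (t - c) ^ γ) atTop (𝓝 0) := by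
      have : Tendsto (fun k : ℕ => 2 * H / (2 : ℝ) ^ k) atTop (𝓝 0) :=
        tendsto_const_nhds.div_atTop (tendsto_pow_atTop_atTop_of_one_lt (by norm_num))
      simpa using this.mul_const ((t - c) ^ γ)
    have := ge_of_tendsto' hl fun k => hall k c t le_rfl hct hth htT
    rw [hzc, sub_self, sub_zero] at this
    exact sub_eq_zero.1 (norm_le_zero_iff.1 this)
  intro t ht htT
  -- The length `h` does not depend on the starting point, so finitely many intervals cover `[0,T]`.
  have hall : ∀ k : ℕ, ∀ t, 0 ≤ t → t ≤ T → t ≤ k * h → z t = z' t := by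
    intro k
    induction k with
    | zero =>
      intro t ht htT htk
      obtain rfl : t = 0 := le_antisymm (by simpa using htk) ht
      rw [sub_eq_zero.1 (hI 0 le_rfl htT).eq_zero, sub_eq_zero.1 (hI' 0 le_rfl htT).eq_zero]
    | succ k ih =>
      intro t ht htT htk
      rcases le_total t (k * h) with h1 | h1
      · exact ih t ht htT h1
      · exact step (k * h) (by positivity) (ih _ (by positivity) (h1.trans htT) le_rfl) t h1
          (by push_cast at htk; linarith) htT
  obtain ⟨k, hk⟩ := exists_nat_ge (t / h)
  exact hall k t ht htT (by rwa [div_le_iff₀ hh0] at hk)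

end YoungField

/-! ### Solutions and existence times when the averaged drift is a Young field -/

variable {d : ℕ}

theorem IsSolutionOn.mono {w : ℝ → Sp d} {b : TempDist d (Sp d)} {x : Sp d} {τ τ' : ℝ}
    {y : ℝ → Sp d} (h : IsSolutionOn w b x τ y) (hτ : τ' ≤ τ) : IsSolutionOn w b x τ' y := by
  obtain ⟨hc, ⟨ε, hε, C, hC⟩, hI⟩ := h
  have hsub : Icc 0 τ' ⊆ Icc 0 τ := Icc_subset_Icc_right hτ
  exact ⟨hc.mono hsub, ⟨ε, hε, C, hC.mono hsub⟩, fun t ht => hI t (hsub ht)⟩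

theorem HolderOnWith.norm_sub_le_rpow {f : ℝ → Sp d} {C ε : ℝ≥0} {S : Set ℝ}
    (h : HolderOnWith C ε f S) {s t : ℝ} (hs : s ∈ S) (ht : t ∈ S) (hst : s ≤ t) :
    ‖f t - f s‖ ≤ C * (t - s) ^ (ε : ℝ) := by
  have := h.dist_le ht hs
  rwa [dist_eq_norm, Real.dist_eq, abs_of_nonneg (sub_nonneg.2 hst)] at this

theorem exists_isSolutionOn {T M γ : ℝ} {w : ℝ → Sp d} {b : TempDist d (Sp d)} (hT : 0 < T)
    (hw : ContinuousOn w (Icc 0 T)) (hγ : 2 / 3 < γ) (hA : YoungField T M γ (avgOp w b))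
    (x : Sp d) : ∃ y, IsSolutionOn w b x T y := by
  obtain ⟨z, C, hC, hz0, hz⟩ := hA.exists_solution hT hγ x
  -- The exponent `3γ/2` is read as `γ + γ/2`, with `γ/2` in the role of `ε`.
  have hz' : ∀ s t, 0 ≤ s → s ≤ t → t ≤ T →
      ‖z t - z s - incr (avgOp w b) s t (z s)‖ ≤ C * (t - s) ^ (γ + γ / 2) := fun s t h1 h2 h3 => by
    have := hz s t h1 h2 h3
    rwa [show 3 * γ / 2 = γ + γ / 2 by ring] at this
  have hh := hA.holder_of_local hC (by linarith) (by linarith) hz'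
  set H := M + C * T ^ (γ / 2) with hH
  have hH0 : 0 ≤ H := by have := hA.nonneg; positivity
  have hhol : HolderOnWith H.toNNReal γ.toNNReal z (Icc 0 T) := by
    intro s hs t ht
    have key : ‖z s - z t‖ ≤ H * |s - t| ^ γ := by
      rcases le_total s t with h | h
      · rw [norm_sub_rev, abs_sub_comm, abs_of_nonneg (sub_nonneg.2 h)]
        exact hh s t hs.1 h ht.2
      · rw [abs_of_nonneg (sub_nonneg.2 h)]
        exact hh t s ht.1 h hs.2
    rw [Real.coe_toNNReal γ (by linarith), edist_dist, edist_dist, dist_eq_norm, Real.dist_eq,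
      ENNReal.ofReal_rpow_of_nonneg (abs_nonneg _) (by linarith)]
    change _ ≤ ENNReal.ofReal H * _
    rw [← ENNReal.ofReal_mul hH0]
    exact ENNReal.ofReal_le_ofReal key
  have hγ0 : 0 < γ.toNNReal := Real.toNNReal_pos.2 (by linarith)
  refine ⟨fun t => z t + w t, (hhol.continuousOn hγ0).add hw, ⟨γ.toNNReal, hγ0, H.toNNReal, ?_⟩,
    fun t ht => ?_⟩
  · simpa using hhol
  · have := isYoungIntegral_of_local (t := t) hC (by linarith)
      (fun u v h1 h2 h3 => hz u v h1 h2 (h3.trans ht.2)) ht.1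
    simpa [hz0] using this

/-- The Hölder exponents of the two solutions may be small and different. The field is therefore
needed for all `γ` near `1`: some `γ < 1` exceeds both `1 - ε` and `1 - ε'`, which makes the
integrals Young integrals of order above one. -/
theorem IsSolutionOn.eqOn {T : ℝ} {w : ℝ → Sp d} {b : TempDist d (Sp d)} {x : Sp d} (hT : 0 < T)
    (hA : ∀ γ ∈ Ioo (3 / 4 : ℝ) 1, ∃ M, YoungField T M γ (avgOp w b)) {y y' : ℝ → Sp d}
    (hy : IsSolutionOn w b x T y) (hy' : IsSolutionOn w b x T y') : EqOn y y' (Icc 0 T) := by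
  obtain ⟨-, ⟨ε, hε, C, hC⟩, hI⟩ := hy
  obtain ⟨-, ⟨ε', hε', C', hC'⟩, hI'⟩ := hy'
  obtain ⟨γ, hγ1, hγ2⟩ : ∃ γ, max (3 / 4 : ℝ) (max (1 - ε) (1 - ε')) < γ ∧ γ < 1 :=
    exists_between (by
      have h1 : (0 : ℝ) < ε := hε
      have h2 : (0 : ℝ) < ε' := hε'
      refine max_lt (by norm_num) (max_lt ?_ ?_) <;> linarith)
  simp only [max_lt_iff] at hγ1
  obtain ⟨hγ, hγε, hγε'⟩ := hγ1
  obtain ⟨M, hM⟩ := hA γ ⟨hγ, hγ2⟩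
  have hI2 : ∀ t, 0 ≤ t → t ≤ T → IsYoungIntegral (avgOp w b) (fun r => y r - w r) t
      (y t - w t - x) := fun t h0 h1 => hI t ⟨h0, h1⟩
  have hI2' : ∀ t, 0 ≤ t → t ≤ T → IsYoungIntegral (avgOp w b) (fun r => y' r - w r) t
      (y' t - w t - x) := fun t h0 h1 => hI' t ⟨h0, h1⟩
  obtain ⟨D, hD, hl⟩ := hM.exists_local_of_isYoungIntegral (z := fun r => y r - w r) (by linarith)
    ε.coe_nonneg (by linarith) C.coe_nonneg
    (fun s t h0 h1 h2 => HolderOnWith.norm_sub_le_rpow hC ⟨h0, h1.trans h2⟩ ⟨h0.trans h1, h2⟩ h1) hI2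
  obtain ⟨D', hD', hl'⟩ := hM.exists_local_of_isYoungIntegral (z := fun r => y' r - w r)
    (by linarith) ε'.coe_nonneg (by linarith) C'.coe_nonneg
    (fun s t h0 h1 h2 => HolderOnWith.norm_sub_le_rpow hC' ⟨h0, h1.trans h2⟩ ⟨h0.trans h1, h2⟩ h1)
    hI2'
  have g1 := hM.holder_of_local hD ε.coe_nonneg (by linarith) hl
  have g2 := hM.holder_of_local hD' ε'.coe_nonneg (by linarith) hl'
  set H := M + D * T ^ (ε : ℝ)
  set H' := M + D' * T ^ (ε' : ℝ)
  have hM0 := hM.nonneg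
  have hH0 : 0 ≤ H := by positivity
  intro t ht
  have := hM.eq_of_isYoungIntegral (by linarith) (H := max H H') (hH0.trans (le_max_left _ _))
    (fun s t h0 h1 h2 => (g1 s t h0 h1 h2).trans (mul_le_mul_of_nonneg_right (le_max_left _ _)
      (Real.rpow_nonneg (by linarith) _)))
    (fun s t h0 h1 h2 => (g2 s t h0 h1 h2).trans (mul_le_mul_of_nonneg_right (le_max_right _ _)
      (Real.rpow_nonneg (by linarith) _))) hI2 hI2' t ht.1 ht.2
  exact sub_left_injective this

/-- A continuous solution on all of `[0,T]` is bounded. If `S ≤ T` were an existence time, the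
uniqueness contained in that notion would identify the exploding path with the bounded one before
`S`. -/
theorem isExistenceTime_top_of_youngField {T : ℝ} {w : ℝ → Sp d} {b : TempDist d (Sp d)}
    (hT : 0 < T) (hw : ContinuousOn w (Icc 0 T))
    (hA : ∀ γ ∈ Ioo (3 / 4 : ℝ) 1, ∃ M, YoungField T M γ (avgOp w b)) (x : Sp d) :
    IsExistenceTime T w b x ⊤ ∧ ∀ S : EReal, IsExistenceTime T w b x S → S = ⊤ := by
  obtain ⟨M, hM⟩ := hA (4 / 5) (by norm_num)
  obtain ⟨y, hy⟩ := exists_isSolutionOn hT hw (by norm_num) hM x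
  refine ⟨⟨by simp, Or.inr rfl, y, fun τ hτ => hy.mono hτ.2.1, fun y' hy' t ht => ?_, by simp⟩,
    fun S hS => ?_⟩
  · exact (hy' T ⟨hT.le, le_rfl, EReal.coe_lt_top T⟩).eqOn hT hA hy ⟨ht.1, ht.2.1⟩
  · obtain ⟨hS0, hST, y', hy', huniq, hexp⟩ := hS
    by_contra hne
    have hST' : S ≤ T := hST.resolve_right hne
    have hlim := hexp hne
    obtain ⟨r, rfl⟩ : ∃ r : ℝ, (r : EReal) = S :=
      ⟨S.toReal, EReal.coe_toReal hne (ne_bot_of_gt hS0)⟩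
    have hr0 : 0 < r := by exact_mod_cast hS0
    have hrT : r ≤ T := by exact_mod_cast hST'
    rw [EReal.toReal_coe] at hlim
    have heq : EqOn y y' (lifeInterval T r) := huniq y fun τ hτ => hy.mono hτ.2.1
    obtain ⟨B, hB⟩ := isCompact_Icc.exists_bound_of_continuousOn hy.1
    have h1 : ∀ᶠ t in 𝓝[<] r, B + 1 ≤ ‖y' t‖ := hlim.eventually_ge_atTop _
    have h2 : ∀ᶠ t in 𝓝[<] r, t ∈ Ioo 0 r := Ioo_mem_nhdsLT hr0
    obtain ⟨t, ht1, ht2⟩ := (h1.and h2).exists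
    have ht : t ∈ lifeInterval T r := ⟨ht2.1.le, ht2.2.le.trans hrT, by exact_mod_cast ht2.2⟩
    rw [← heq ht] at ht1
    linarith [hB t ⟨ht.1, ht.2.1⟩]

/-! ### Integrals of families of Schwartz functions -/

section SchwartzIntegral

variable {E F : Type*} [NormedAddCommGroup E] [NormedSpace ℝ E] [NormedAddCommGroup F]
  [NormedSpace ℝ F]

theorem exists_weight_iteratedFDeriv_le (f : 𝓢(E, F)) (k n : ℕ) :
    ∃ C : ℝ, 0 ≤ C ∧ ∀ x, (1 + ‖x‖) ^ k * ‖iteratedFDeriv ℝ n f x‖ ≤ C :=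
  ⟨_, by positivity, fun x => SchwartzMap.one_add_le_sup_seminorm_apply (𝕜 := ℝ) (m := (k, n))
    le_rfl le_rfl f x⟩

theorem one_add_norm_le_mul {E : Type*} [NormedAddCommGroup E] (x z : E) :
    1 + ‖x‖ ≤ (1 + ‖x - z‖) * (1 + ‖z‖) := by
  have : ‖x‖ ≤ ‖x - z‖ + ‖z‖ := by simpa using norm_add_le (x - z) z
  nlinarith [norm_nonneg (x - z), norm_nonneg z, mul_nonneg (norm_nonneg (x - z)) (norm_nonneg z)]

/-- A weighted mean value inequality. -/
theorem weight_norm_sub_le {g : E → F} {k : ℕ} {C : ℝ} (hg : Differentiable ℝ g)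
    (hC : ∀ x, (1 + ‖x‖) ^ k * ‖fderiv ℝ g x‖ ≤ C) {x h : E} (hh : ‖h‖ ≤ 1) :
    (1 + ‖x‖) ^ k * ‖g (x + h) - g x‖ ≤ 2 ^ k * C * ‖h‖ := by
  have hx : 0 < (1 + ‖x‖) ^ k := by positivity
  have key : ‖g (x + h) - g x‖ ≤ 2 ^ k * C / (1 + ‖x‖) ^ k * ‖(x + h) - x‖ := by
    refine (convex_segment x (x + h)).norm_image_sub_le_of_norm_fderiv_le (𝕜 := ℝ)
      (fun y _ => hg y) (fun y hy => ?_) (left_mem_segment ℝ _ _) (right_mem_segment ℝ _ _)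
    have hy1 : ‖x - y‖ ≤ 1 := by
      rw [segment_eq_image'] at hy
      obtain ⟨θ, ⟨h0, h1⟩, rfl⟩ := hy
      have : x - (x + θ • (x + h - x)) = -(θ • h) := by rw [add_sub_cancel_left]; abel
      rw [this, norm_neg, norm_smul, Real.norm_of_nonneg h0]
      nlinarith [norm_nonneg h]
    have hxy : 1 + ‖x‖ ≤ 2 * (1 + ‖y‖) :=
      (one_add_norm_le_mul x y).trans (by gcongr; linarith)
    rw [le_div_iff₀ hx]
    calc ‖fderiv ℝ g y‖ * (1 + ‖x‖) ^ k ≤ ‖fderiv ℝ g y‖ * (2 * (1 + ‖y‖)) ^ k := by gcongr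
      _ = 2 ^ k * ((1 + ‖y‖) ^ k * ‖fderiv ℝ g y‖) := by rw [mul_pow]; ring
      _ ≤ 2 ^ k * C := by gcongr; exact hC y
  rw [add_sub_cancel_left] at key
  calc (1 + ‖x‖) ^ k * ‖g (x + h) - g x‖
      ≤ (1 + ‖x‖) ^ k * (2 ^ k * C / (1 + ‖x‖) ^ k * ‖h‖) := by gcongr
    _ = _ := by field_simp

theorem iteratedFDeriv_compSubConstCLM (f : 𝓢(E, F)) (z : E) (n : ℕ) (x : E) :
    iteratedFDeriv ℝ n (SchwartzMap.compSubConstCLM ℝ z f) x = iteratedFDeriv ℝ n f (x - z) := by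
  have : (SchwartzMap.compSubConstCLM ℝ z f : E → F) = fun y => f (y - z) := by ext; simp
  rw [this, iteratedFDeriv_comp_sub]

theorem exists_seminorm_compSubConstCLM_le (f : 𝓢(E, F)) (k n : ℕ) :
    ∃ C : ℝ, 0 ≤ C ∧ ∀ z, SchwartzMap.seminorm ℝ k n (SchwartzMap.compSubConstCLM ℝ z f) ≤
      C * (1 + ‖z‖) ^ k := by
  obtain ⟨C, hC, h⟩ := exists_weight_iteratedFDeriv_le f k n
  refine ⟨C, hC, fun z => SchwartzMap.seminorm_le_bound ℝ k n _ (by positivity) fun x => ?_⟩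
  rw [iteratedFDeriv_compSubConstCLM]
  calc ‖x‖ ^ k * ‖iteratedFDeriv ℝ n f (x - z)‖
      ≤ ((1 + ‖x - z‖) * (1 + ‖z‖)) ^ k * ‖iteratedFDeriv ℝ n f (x - z)‖ := by
        gcongr
        exact (le_add_of_nonneg_left zero_le_one).trans (one_add_norm_le_mul x z)
    _ = ((1 + ‖x - z‖) ^ k * ‖iteratedFDeriv ℝ n f (x - z)‖) * (1 + ‖z‖) ^ k := by
        rw [mul_pow]; ring
    _ ≤ _ := by gcongr; exact h _

/-- Translation is continuous in the Schwartz topology. -/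
theorem continuous_compSubConstCLM (f : 𝓢(E, F)) :
    Continuous fun z : E => SchwartzMap.compSubConstCLM ℝ z f := by
  rw [continuous_iff_continuousAt]
  intro z₀
  rw [ContinuousAt, (schwartz_withSeminorms ℝ E F).tendsto_nhds]
  rintro ⟨k, n⟩ ε hε
  obtain ⟨C, hC, h⟩ := exists_weight_iteratedFDeriv_le f k (n + 1)
  have hlim : Tendsto (fun z => 2 ^ k * C * ‖z₀ - z‖ * (1 + ‖z₀‖) ^ k) (𝓝 z₀) (𝓝 0) := by
    have : Continuous fun z => 2 ^ k * C * ‖z₀ - z‖ * (1 + ‖z₀‖) ^ k := by fun_prop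
    simpa using this.tendsto z₀
  filter_upwards [hlim.eventually (gt_mem_nhds hε), Metric.ball_mem_nhds z₀ one_pos] with z h1 h2
  refine lt_of_le_of_lt ?_ h1
  rw [SchwartzMap.schwartzSeminormFamily_apply]
  refine SchwartzMap.seminorm_le_bound ℝ k n _ (by positivity) fun x => ?_
  have hsub : iteratedFDeriv ℝ n (⇑(SchwartzMap.compSubConstCLM ℝ z f -
      SchwartzMap.compSubConstCLM ℝ z₀ f)) x =
      iteratedFDeriv ℝ n f ((x - z₀) + (z₀ - z)) - iteratedFDeriv ℝ n f (x - z₀) := by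
    rw [sub_add_sub_cancel, ← iteratedFDeriv_compSubConstCLM, ← iteratedFDeriv_compSubConstCLM]
    exact iteratedFDeriv_sub_apply ((SchwartzMap.smooth _ n).contDiffAt)
      ((SchwartzMap.smooth _ n).contDiffAt)
  rw [hsub]
  have hz : ‖z₀ - z‖ ≤ 1 := by
    rw [← dist_eq_norm, dist_comm]; exact (Metric.mem_ball.1 h2).le
  have hdiff : Differentiable ℝ (iteratedFDeriv ℝ n f) :=
    (f.smooth ⊤).differentiable_iteratedFDeriv (by exact_mod_cast ENat.natCast_lt_top n)
  have := weight_norm_sub_le hdiff (fun y => by rw [norm_fderiv_iteratedFDeriv]; exact h y)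
    (x := x - z₀) hz
  calc ‖x‖ ^ k * _ ≤ ((1 + ‖x - z₀‖) * (1 + ‖z₀‖)) ^ k * _ := by
        gcongr
        exact (le_add_of_nonneg_left zero_le_one).trans (one_add_norm_le_mul x z₀)
    _ = ((1 + ‖x - z₀‖) ^ k * ‖iteratedFDeriv ℝ n f ((x - z₀) + (z₀ - z)) -
        iteratedFDeriv ℝ n f (x - z₀)‖) * (1 + ‖z₀‖) ^ k := by rw [mul_pow]; ring
    _ ≤ _ := by gcongr

variable {Z : Type*} [TopologicalSpace Z] [MeasurableSpace Z] {μ : Measure Z}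

/-- A continuous family of Schwartz functions all of whose seminorms are integrable. -/
structure SchwartzIntegrable (G : Z → 𝓢(E, F)) (μ : Measure Z) : Prop where
  continuous : Continuous G
  integrable : ∀ k n, Integrable (fun z => SchwartzMap.seminorm ℝ k n (G z)) μ

theorem finset_sup_seminorm_le_sum (s : Finset (ℕ × ℕ)) (f : 𝓢(E, F)) :
    (s.sup (schwartzSeminormFamily ℝ E F)) f ≤ ∑ i ∈ s, SchwartzMap.seminorm ℝ i.1 i.2 f := by
  refine (Seminorm.finset_sup_le_sum (schwartzSeminormFamily ℝ E F) s f).trans_eq ?_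
  induction s using Finset.cons_induction with
  | empty => simp
  | cons i s hi ih => rw [Finset.sum_cons, Finset.sum_cons, add_apply, ih]; rfl

theorem exists_norm_le_sum_seminorm {G' : Type*} [NormedAddCommGroup G'] [NormedSpace ℝ G']
    (L : 𝓢(E, F) →L[ℝ] G') : ∃ (s : Finset (ℕ × ℕ)) (C : ℝ), 0 ≤ C ∧ ∀ f,
      ‖L f‖ ≤ C * ∑ i ∈ s, SchwartzMap.seminorm ℝ i.1 i.2 f := by
  obtain ⟨s, C, -, h⟩ := Seminorm.bound_of_continuous (schwartz_withSeminorms ℝ E F)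
    ((normSeminorm ℝ G').comp L.toLinearMap) (continuous_norm.comp L.continuous)
  refine ⟨s, C, C.coe_nonneg, fun f => (h f).trans ?_⟩
  exact mul_le_mul_of_nonneg_left (finset_sup_seminorm_le_sum s f) C.coe_nonneg

theorem exists_seminorm_le_sum_seminorm {E' F' : Type*} [NormedAddCommGroup E'] [NormedSpace ℝ E']
    [NormedAddCommGroup F'] [NormedSpace ℝ F'] (L : 𝓢(E, F) →L[ℝ] 𝓢(E', F')) (k n : ℕ) :
    ∃ (s : Finset (ℕ × ℕ)) (C : ℝ), 0 ≤ C ∧ ∀ f,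
      SchwartzMap.seminorm ℝ k n (L f) ≤ C * ∑ i ∈ s, SchwartzMap.seminorm ℝ i.1 i.2 f := by
  have hc : Continuous ((SchwartzMap.seminorm ℝ k n).comp L.toLinearMap) :=
    ((schwartz_withSeminorms ℝ E' F').continuous_seminorm (k, n)).comp L.continuous
  obtain ⟨s, C, -, h⟩ := Seminorm.bound_of_continuous (schwartz_withSeminorms ℝ E F) _ hc
  refine ⟨s, C, C.coe_nonneg, fun f => (h f).trans ?_⟩
  exact mul_le_mul_of_nonneg_left (finset_sup_seminorm_le_sum s f) C.coe_nonneg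

theorem continuous_seminorm (k n : ℕ) :
    Continuous fun f : 𝓢(E, F) => SchwartzMap.seminorm ℝ k n f :=
  (schwartz_withSeminorms ℝ E F).continuous_seminorm (k, n)

theorem continuous_eval (x : E) : Continuous fun f : 𝓢(E, F) => f x :=
  (BoundedContinuousFunction.evalCLM ℝ x).continuous.comp
    (SchwartzMap.toBoundedContinuousFunctionCLM ℝ E F).continuous

namespace SchwartzIntegrable

variable [OpensMeasurableSpace Z]

theorem comp_clm {E' F' : Type*} [NormedAddCommGroup E'] [NormedSpace ℝ E'] [NormedAddCommGroup F']
    [NormedSpace ℝ F'] {G : Z → 𝓢(E, F)} (hG : SchwartzIntegrable G μ)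
    (L : 𝓢(E, F) →L[ℝ] 𝓢(E', F')) : SchwartzIntegrable (fun z => L (G z)) μ := by
  refine ⟨L.continuous.comp hG.continuous, fun k n => ?_⟩
  obtain ⟨s, C, -, h⟩ := exists_seminorm_le_sum_seminorm L k n
  refine ((integrable_finsetSum s fun i _ => hG.integrable i.1 i.2).const_mul C).mono'
    ((continuous_seminorm k n).comp (L.continuous.comp hG.continuous)).aestronglyMeasurable
    (Eventually.of_forall fun z => ?_)
  rw [Real.norm_of_nonneg (apply_nonneg _ _)]
  exact h (G z)

variable [SecondCountableTopology Z]

theorem integrable_clm {F' : Type*} [NormedAddCommGroup F'] [NormedSpace ℝ F']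
    {G : Z → 𝓢(E, F)} (hG : SchwartzIntegrable G μ) (L : 𝓢(E, F) →L[ℝ] F') :
    Integrable (fun z => L (G z)) μ := by
  obtain ⟨s, C, -, h⟩ := exists_norm_le_sum_seminorm L
  exact ((integrable_finsetSum s fun i _ => hG.integrable i.1 i.2).const_mul C).mono'
    (L.continuous.comp hG.continuous).aestronglyMeasurable (Eventually.of_forall fun z => h (G z))

open LineDeriv

theorem lineDeriv_eq_integral [CompleteSpace F] {G : Z → 𝓢(E, F)} (hG : SchwartzIntegrable G μ)
    {Φ : 𝓢(E, F)} (hΦ : ∀ y, Φ y = ∫ z, G z y ∂μ) (m y : E) :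
    (∂_{m} Φ) y = ∫ z, (∂_{m} (G z)) y ∂μ := by
  have hmeas : ∀ y, AEStronglyMeasurable (fun z => G z y) μ := fun y =>
    ((continuous_eval y).comp hG.continuous).aestronglyMeasurable
  have hmeas' : AEStronglyMeasurable (fun z => fderiv ℝ (G z) y) μ :=
    ((continuous_eval y).comp ((SchwartzMap.fderivCLM ℝ E F).continuous.comp
      hG.continuous)).aestronglyMeasurable
  have hbd : ∀ z y, ‖fderiv ℝ (G z) y‖ ≤ SchwartzMap.seminorm ℝ 0 1 (G z) := fun z y => by
    rw [← norm_iteratedFDeriv_one]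
    exact SchwartzMap.norm_iteratedFDeriv_le_seminorm ℝ (G z) 1 y
  have hint : Integrable (fun z => fderiv ℝ (G z) y) μ :=
    (hG.integrable 0 1).mono' hmeas' (Eventually.of_forall fun z => hbd z y)
  have h := hasFDerivAt_integral_of_dominated_of_fderiv_le (𝕜 := ℝ) (μ := μ) (x₀ := y)
    (F := fun y z => G z y) (F' := fun y z => fderiv ℝ (G z) y) (s := univ)
    (bound := fun z => SchwartzMap.seminorm ℝ 0 1 (G z)) univ_mem
    (Eventually.of_forall hmeas)
    ((hG.integrable 0 0).mono' (hmeas y) (Eventually.of_forall fun z =>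
      SchwartzMap.norm_le_seminorm ℝ (G z) y)) hmeas'
    (Eventually.of_forall fun z y _ => hbd z y) (hG.integrable 0 1)
    (Eventually.of_forall fun z y _ => (G z).hasFDerivAt y)
  have hΦ' : (Φ : E → F) = fun y => ∫ z, G z y ∂μ := funext hΦ
  rw [SchwartzMap.lineDerivOp_apply_eq_fderiv, hΦ', h.fderiv, ContinuousLinearMap.integral_apply hint]
  rfl

/-- Line derivatives are continuous endomorphisms of the Schwartz space, so they preserve integrable
families, and differentiation under the integral sign can be iterated. -/
theorem iteratedFDeriv_eq_integral [CompleteSpace F] {G : Z → 𝓢(E, F)}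
    (hG : SchwartzIntegrable G μ) {Φ : 𝓢(E, F)} (hΦ : ∀ y, Φ y = ∫ z, G z y ∂μ) (n : ℕ)
    (m : Fin n → E) (y : E) :
    iteratedFDeriv ℝ n Φ y m = ∫ z, iteratedFDeriv ℝ n (G z) y m ∂μ := by
  have key : ∀ (n : ℕ) (m : Fin n → E) (y : E), (∂^{m} Φ) y = ∫ z, (∂^{m} (G z)) y ∂μ := by
    intro n
    induction n with
    | zero => intro m y; simpa using hΦ y
    | succ n ih =>
      intro m y
      simp only [iteratedLineDerivOp_succ_left]
      have hG' : SchwartzIntegrable (fun z => ∂^{Fin.tail m} (G z)) μ :=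
        hG.comp_clm (iteratedLineDerivOpCLM ℝ 𝓢(E, F) (Fin.tail m))
      exact hG'.lineDeriv_eq_integral (ih _) _ _
  simpa only [SchwartzMap.iteratedLineDerivOp_eq_iteratedFDeriv] using key n m y

end SchwartzIntegrable

/-- The Banach space in which the weighted `n`-th derivatives of Schwartz functions live. -/
def WeightedDerivSpace (E F : Type*) [NormedAddCommGroup E] [NormedSpace ℝ E]
    [NormedAddCommGroup F] [NormedSpace ℝ F] (n : ℕ) : Type _ :=
  BoundedContinuousFunction E (E [×n]→L[ℝ] F)

instance (n : ℕ) : NormedAddCommGroup (WeightedDerivSpace E F n) :=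
  inferInstanceAs (NormedAddCommGroup (BoundedContinuousFunction E (E [×n]→L[ℝ] F)))

instance (n : ℕ) : NormedSpace ℝ (WeightedDerivSpace E F n) :=
  inferInstanceAs (NormedSpace ℝ (BoundedContinuousFunction E (E [×n]→L[ℝ] F)))

instance [CompleteSpace F] (n : ℕ) : CompleteSpace (WeightedDerivSpace E F n) :=
  inferInstanceAs (CompleteSpace (BoundedContinuousFunction E (E [×n]→L[ℝ] F)))

/-- Evaluation at a point, as a continuous linear map. -/
def WeightedDerivSpace.eval {n : ℕ} (x : E) (m : Fin n → E) : WeightedDerivSpace E F n →L[ℝ] F :=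
  (ContinuousMultilinearMap.apply ℝ (fun _ : Fin n => E) F m).comp
    (BoundedContinuousFunction.evalCLM ℝ x : BoundedContinuousFunction E (E [×n]→L[ℝ] F) →L[ℝ] _)

theorem WeightedDerivSpace.ext {n : ℕ} {f g : WeightedDerivSpace E F n}
    (h : ∀ x m, eval x m f = eval x m g) : f = g :=
  BoundedContinuousFunction.ext fun x => ContinuousMultilinearMap.ext fun m => h x m

/-- The weighted derivative `‖x‖^k • D^n f`, as an element of a Banach space. -/
def weightedDeriv (k n : ℕ) (f : 𝓢(E, F)) : WeightedDerivSpace E F n :=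
  BoundedContinuousFunction.ofNormedAddCommGroup
    (fun x => ‖x‖ ^ k • iteratedFDeriv ℝ n f x)
    ((by fun_prop : Continuous fun x : E => ‖x‖ ^ k).smul
      ((f.smooth ⊤).continuous_iteratedFDeriv (by exact_mod_cast le_top)))
    (SchwartzMap.seminorm ℝ k n f) (fun x => by
      rw [norm_smul, norm_pow, norm_norm]; exact SchwartzMap.le_seminorm ℝ _ _ f x)

@[simp] theorem eval_weightedDeriv (k n : ℕ) (f : 𝓢(E, F)) (x : E) (m : Fin n → E) :
    WeightedDerivSpace.eval x m (weightedDeriv k n f) = ‖x‖ ^ k • iteratedFDeriv ℝ n f x m := rfl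

theorem norm_weightedDeriv (k n : ℕ) (f : 𝓢(E, F)) :
    ‖weightedDeriv k n f‖ = SchwartzMap.seminorm ℝ k n f := by
  have key : ∀ x, ‖‖x‖ ^ k • iteratedFDeriv ℝ n f x‖ = ‖x‖ ^ k * ‖iteratedFDeriv ℝ n f x‖ :=
    fun x => by rw [norm_smul, norm_pow, norm_norm]
  refine le_antisymm ((BoundedContinuousFunction.norm_le (apply_nonneg _ _)).2 fun x => ?_)
    (SchwartzMap.seminorm_le_bound ℝ _ _ f (norm_nonneg (weightedDeriv k n f)) fun x => ?_)
  · exact (key x).trans_le (SchwartzMap.le_seminorm ℝ _ _ f x)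
  · exact (key x).symm.trans_le (BoundedContinuousFunction.norm_coe_le_norm
      (show BoundedContinuousFunction E (E [×n]→L[ℝ] F) from weightedDeriv k n f) x)

/-- The linear map `weightedDeriv`. -/
def weightedDerivLM (k n : ℕ) : 𝓢(E, F) →ₗ[ℝ] WeightedDerivSpace E F n where
  toFun := weightedDeriv k n
  map_add' f g := by
    have h (x : E) : iteratedFDeriv ℝ n (⇑(f + g)) x =
        iteratedFDeriv ℝ n f x + iteratedFDeriv ℝ n g x :=
      iteratedFDeriv_add_apply ((f.smooth n).contDiffAt) ((g.smooth n).contDiffAt)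
    refine WeightedDerivSpace.ext fun x m => ?_
    rw [map_add, eval_weightedDeriv, eval_weightedDeriv, eval_weightedDeriv, h]
    simp
  map_smul' c f := by
    have h (x : E) : iteratedFDeriv ℝ n (⇑(c • f)) x = c • iteratedFDeriv ℝ n f x :=
      iteratedFDeriv_const_smul_apply ((f.smooth n).contDiffAt)
    refine WeightedDerivSpace.ext fun x m => ?_
    rw [map_smulₛₗ, eval_weightedDeriv, eval_weightedDeriv, h]
    simp only [RingHom.id_apply, _root_.smul_apply]
    rw [smul_comm]

/-- The functional descends to the range of `J`, where it is bounded; Hahn-Banach extends it to `V`.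
-/
theorem exists_clm_comp_eq {X V : Type*} [AddCommGroup X] [Module ℝ X] [NormedAddCommGroup V]
    [NormedSpace ℝ V] (J : X →ₗ[ℝ] V) (hJ : Function.Injective J) (b : X →ₗ[ℝ] ℝ) {C : ℝ}
    (hb : ∀ f, ‖b f‖ ≤ C * ‖J f‖) : ∃ Λ : V →L[ℝ] ℝ, ∀ f, Λ (J f) = b f := by
  let e := LinearEquiv.ofInjective J hJ
  let f₀ : LinearMap.range J →L[ℝ] ℝ :=
    LinearMap.mkContinuous (b ∘ₗ e.symm.toLinearMap) C fun v => by
      obtain ⟨f, rfl⟩ := e.surjective v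
      simp only [LinearMap.comp_apply, LinearEquiv.coe_coe, LinearEquiv.symm_apply_apply]
      exact hb f
  obtain ⟨Λ, hΛ, -⟩ := exists_extension_norm_eq (LinearMap.range J) f₀
  refine ⟨Λ, fun f => ?_⟩
  have h1 := hΛ (e f)
  have h2 : f₀ (e f) = b f := by
    simp only [f₀, LinearMap.mkContinuous_apply, LinearMap.comp_apply, LinearEquiv.coe_coe,
      LinearEquiv.symm_apply_apply]
  rw [← h2, ← h1]
  rfl

/-- A continuous functional is dominated by finitely many seminorms, so it factors through a finite
product of Banach spaces of weighted derivatives. There the family has a Bochner integral, which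
commutes with bounded functionals. -/
theorem SchwartzIntegrable.map_eq_integral_real [OpensMeasurableSpace Z] [SecondCountableTopology Z]
    [CompleteSpace F] {G : Z → 𝓢(E, F)} (hG : SchwartzIntegrable G μ) {Φ : 𝓢(E, F)}
    (hΦ : ∀ y, Φ y = ∫ z, G z y ∂μ) (b : 𝓢(E, F) →L[ℝ] ℝ) : b Φ = ∫ z, b (G z) ∂μ := by
  obtain ⟨s, C, hC, hb⟩ := exists_norm_le_sum_seminorm b
  -- The index `(0, 0)`, the supremum norm, is added to make `J` injective.
  let J : 𝓢(E, F) →ₗ[ℝ] (∀ i : ↥(insert (0, 0) s), WeightedDerivSpace E F i.1.2) :=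
    LinearMap.pi fun i => weightedDerivLM i.1.1 i.1.2
  have hJi : ∀ f i, J f i = weightedDeriv i.1.1 i.1.2 f := fun f i => rfl
  have hle : ∀ f, ∀ i ∈ insert (0, 0) s, SchwartzMap.seminorm ℝ i.1 i.2 f ≤ ‖J f‖ :=
    fun f i hi => by
      rw [← norm_weightedDeriv]
      exact norm_le_pi_norm (J f) ⟨i, hi⟩
  have hinj : Function.Injective J := by
    rw [injective_iff_map_eq_zero]
    intro f hf
    ext x
    have h0 := hle f (0, 0) (Finset.mem_insert_self _ _)
    rw [hf, norm_zero] at h0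
    simpa using (SchwartzMap.norm_le_seminorm ℝ f x).trans h0
  have hbJ : ∀ f, ‖b f‖ ≤ C * s.card * ‖J f‖ := fun f => by
    refine (hb f).trans ?_
    rw [mul_assoc, ← nsmul_eq_mul]
    exact mul_le_mul_of_nonneg_left
      (Finset.sum_le_card_nsmul _ _ _ fun i hi => hle f i (Finset.mem_insert_of_mem hi)) hC
  obtain ⟨Λ, hΛJ⟩ := exists_clm_comp_eq J hinj b.toLinearMap hbJ
  simp only [ContinuousLinearMap.coe_coe] at hΛJ
  have hnorm : ∀ f, ‖J f‖ ≤ ∑ i ∈ insert (0, 0) s, SchwartzMap.seminorm ℝ i.1 i.2 f := fun f => by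
    refine (pi_norm_le_iff_of_nonneg (Finset.sum_nonneg fun i _ => apply_nonneg _ _)).2 fun i => ?_
    rw [hJi, norm_weightedDeriv]
    exact Finset.single_le_sum (f := fun i : ℕ × ℕ => SchwartzMap.seminorm ℝ i.1 i.2 f)
      (fun i _ => apply_nonneg _ _) i.2
  have hJcont : Continuous J := by
    rw [continuous_iff_continuousAt]
    intro f
    rw [ContinuousAt, tendsto_iff_norm_sub_tendsto_zero]
    have hc : Continuous fun g : 𝓢(E, F) =>
        ∑ i ∈ insert (0, 0) s, SchwartzMap.seminorm ℝ i.1 i.2 (g - f) :=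
      continuous_finsetSum _ fun i _ => (continuous_seminorm i.1 i.2).comp (continuous_sub_right f)
    refine squeeze_zero (fun _ => norm_nonneg _) (fun g => ?_)
      (by simpa using hc.tendsto f)
    rw [← map_sub]
    exact hnorm _
  have hJint : Integrable (fun z => J (G z)) μ :=
    (integrable_finsetSum (insert (0, 0) s) fun i _ => hG.integrable i.1 i.2).mono'
      (hJcont.comp hG.continuous).aestronglyMeasurable (Eventually.of_forall fun z => hnorm (G z))
  -- Elements of the product are determined by evaluations, which turn the claim into
  -- differentiation under the integral sign.
  have hJΦ : J Φ = ∫ z, J (G z) ∂μ := by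
    funext i
    refine WeightedDerivSpace.ext fun x m => ?_
    let ev := (WeightedDerivSpace.eval (F := F) x m).comp (ContinuousLinearMap.proj (R := ℝ)
      (φ := fun i : ↥(insert (0, 0) s) => WeightedDerivSpace E F i.1.2) i)
    have e2 : ev (∫ z, J (G z) ∂μ) = ∫ z, ev (J (G z)) ∂μ := (ev.integral_comp_comm hJint).symm
    have e3 : ∀ f, ev (J f) = ‖x‖ ^ i.1.1 • iteratedFDeriv ℝ i.1.2 f x m := fun f => rfl
    change ev (J Φ) = ev (∫ z, J (G z) ∂μ)
    rw [e2]
    simp only [e3]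
    rw [integral_smul, hG.iteratedFDeriv_eq_integral hΦ]
  rw [← hΛJ, hJΦ, ← Λ.integral_comp_comm hJint]
  simp only [hΛJ]

/-- A continuous linear map on Schwartz space commutes with pointwise integrals of integrable
families. -/
theorem SchwartzIntegrable.map_eq_integral [OpensMeasurableSpace Z] [SecondCountableTopology Z]
    [CompleteSpace F] {F' : Type*} [NormedAddCommGroup F'] [NormedSpace ℝ F'] [CompleteSpace F']
    {G : Z → 𝓢(E, F)} (hG : SchwartzIntegrable G μ) {Φ : 𝓢(E, F)}
    (hΦ : ∀ y, Φ y = ∫ z, G z y ∂μ) (b : 𝓢(E, F) →L[ℝ] F') : b Φ = ∫ z, b (G z) ∂μ := by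
  refine (SeparatingDual.eq_iff_forall_dual_eq (R := ℝ)).2 fun ℓ => ?_
  rw [← ℓ.integral_comp_comm (hG.integrable_clm b)]
  exact hG.map_eq_integral_real hΦ (ℓ.comp b)

end SchwartzIntegral

/-! ### Littlewood-Paley kernels -/

section Weights

variable {d : ℕ} {F : Type*} [NormedAddCommGroup F]

/-- The integral of `(1 + ‖x‖)^{-(d+1)}` over `ℝ^d`. -/
def weightIntegral (d : ℕ) : ℝ := ∫ x : Sp d, ((1 + ‖x‖) ^ (d + 1))⁻¹

theorem integrable_weight (d : ℕ) : Integrable fun x : Sp d => ((1 + ‖x‖) ^ (d + 1))⁻¹ := by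
  have h := integrable_one_add_norm (E := Sp d) (μ := volume) (r := (d + 1 : ℕ))
    (by rw [finrank_euclideanSpace_fin]; push_cast; linarith)
  refine h.congr (Eventually.of_forall fun x => ?_)
  simp only
  rw [Real.rpow_neg (by positivity), Real.rpow_natCast]

theorem weightIntegral_nonneg (d : ℕ) : 0 ≤ weightIntegral d :=
  integral_nonneg fun _ => by positivity

theorem norm_le_of_weight {m : ℕ} {y C : ℝ} {v : F} (hy : 0 ≤ y) (h : (1 + y) ^ m * ‖v‖ ≤ C) :
    ‖v‖ ≤ C * ((1 + y) ^ m)⁻¹ := by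
  rwa [← div_eq_mul_inv, le_div_iff₀ (by positivity), mul_comm]

theorem integrable_of_weight {f : Sp d → F} (hf : AEStronglyMeasurable f) {C : ℝ}
    (hC : ∀ x, (1 + ‖x‖) ^ (d + 1) * ‖f x‖ ≤ C) : Integrable f :=
  ((integrable_weight d).const_mul C).mono' hf
    (Eventually.of_forall fun x => norm_le_of_weight (norm_nonneg x) (hC x))

theorem integral_norm_le_of_weight {f : Sp d → F} {C : ℝ}
    (hC : ∀ x, (1 + ‖x‖) ^ (d + 1) * ‖f x‖ ≤ C) : ∫ x, ‖f x‖ ≤ C * weightIntegral d := by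
  rw [weightIntegral, ← integral_const_mul]
  exact integral_mono_of_nonneg (Eventually.of_forall fun _ => norm_nonneg _)
    ((integrable_weight d).const_mul C)
    (Eventually.of_forall fun x => norm_le_of_weight (norm_nonneg x) (hC x))

end Weights

section Real

variable {d : ℕ}

theorem fourierInv_neg_of_even {s : Sp d → ℂ} (hs : ∀ ξ, s (-ξ) = s ξ) (x : Sp d) :
    𝓕⁻ s (-x) = 𝓕⁻ s x := by
  rw [Real.fourierInv_eq', Real.fourierInv_eq', ← integral_neg_eq_self]
  simp [hs]

theorem conj_fourierInv_of_even_real {s : Sp d → ℂ} (hs : ∀ ξ, s (-ξ) = s ξ)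
    (hr : ∀ ξ, starRingEnd ℂ (s ξ) = s ξ) (x : Sp d) :
    starRingEnd ℂ (𝓕⁻ s x) = 𝓕⁻ s x := by
  conv_rhs => rw [← fourierInv_neg_of_even hs x]
  rw [Real.fourierInv_eq', Real.fourierInv_eq', ← integral_conj]
  refine integral_congr_ae (Eventually.of_forall fun ξ => ?_)
  simp only [smul_eq_mul, map_mul, hr, ← Complex.exp_conj, Complex.conj_ofReal, Complex.conj_I,
    inner_neg_right, mul_neg, Complex.ofReal_neg, neg_mul]

end Real

namespace DyadicPartition

variable {d : ℕ} (P : DyadicPartition d)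

theorem symbol_neg (n : ℕ) (ξ : Sp d) : P.symbol n (-ξ) = P.symbol n ξ := by
  cases n with
  | zero => exact P.χ_radial _ _ (norm_neg _)
  | succ j => exact P.ρ_radial _ _ (by rw [smul_neg, norm_neg])

theorem symbolSchwartz_apply (n : ℕ) (ξ : Sp d) :
    P.symbolSchwartz n ξ = (P.symbol n ((2 * Real.pi) • ξ) : ℂ) := rfl

theorem symbolSchwartz_neg (n : ℕ) (ξ : Sp d) :
    P.symbolSchwartz n (-ξ) = P.symbolSchwartz n ξ := by
  rw [symbolSchwartz_apply, symbolSchwartz_apply, smul_neg, symbol_neg]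

/-- The symbol is real and even, so its inverse Fourier transform is already real and the real part
in `kernel` loses nothing. -/
theorem ofReal_kernel (n : ℕ) (x : Sp d) :
    (P.kernel n x : ℂ) = 𝓕⁻ (P.symbolSchwartz n) x := by
  have h : starRingEnd ℂ (𝓕⁻ (P.symbolSchwartz n) x) = 𝓕⁻ (P.symbolSchwartz n) x := by
    rw [SchwartzMap.fourierInv_coe]
    exact conj_fourierInv_of_even_real (P.symbolSchwartz_neg n)
      (fun ξ => by rw [symbolSchwartz_apply, Complex.conj_ofReal]) x
  exact Complex.conj_eq_iff_re.1 h

theorem kernel_neg (n : ℕ) (x : Sp d) : P.kernel n (-x) = P.kernel n x := by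
  have : (P.kernel n (-x) : ℂ) = P.kernel n x := by
    rw [ofReal_kernel, ofReal_kernel, SchwartzMap.fourierInv_coe]
    exact fourierInv_neg_of_even (P.symbolSchwartz_neg n) x
  exact_mod_cast this

theorem reflectAt_kernel (n : ℕ) (x : Sp d) :
    reflectAt (P.kernel n) x = SchwartzMap.compSubConstCLM ℝ x (P.kernel n) := by
  ext y
  simp [reflectAt, ← P.kernel_neg n (y - x)]

/-- Scaling: derivatives of the dilated symbol gain a factor at most `1`, which is discarded, and
the weight costs `2^{jk}`. Crude geometric growth is enough, since the blocks of the local time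
decay faster than any geometric rate. -/
theorem seminorm_symbolSchwartz_succ_le (k n j : ℕ) :
    SchwartzMap.seminorm ℝ k n (P.symbolSchwartz (j + 1)) ≤
      (2 : ℝ) ^ (j * k) * SchwartzMap.seminorm ℝ k n (P.symbolSchwartz 1) := by
  have hc : (0 : ℝ) < (2 ^ j)⁻¹ := by positivity
  have h2 : (2 : ℝ) ^ j * (2 ^ j)⁻¹ = 1 := mul_inv_cancel₀ (by positivity)
  have hc1 : ((2 : ℝ) ^ j)⁻¹ ≤ 1 := inv_le_one_of_one_le₀ (one_le_pow₀ (by norm_num))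
  have heq : (P.symbolSchwartz (j + 1) : Sp d → ℂ) =
      fun ξ => P.symbolSchwartz 1 (((2 : ℝ) ^ j)⁻¹ • ξ) := by
    funext ξ
    simp only [symbolSchwartz_apply, symbol]
    rw [smul_comm]
    simp
  refine SchwartzMap.seminorm_le_bound ℝ k n _ (by positivity) fun x => ?_
  rw [heq, iteratedFDeriv_comp_const_smul _ ((P.symbolSchwartz 1).smooth n)]
  simp only [norm_smul, norm_pow, Real.norm_of_nonneg hc.le]
  have hx : ‖x‖ = 2 ^ j * ‖((2 : ℝ) ^ j)⁻¹ • x‖ := by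
    rw [norm_smul, Real.norm_of_nonneg hc.le, ← mul_assoc, h2, one_mul]
  have hle := SchwartzMap.le_seminorm ℝ k n (P.symbolSchwartz 1) (((2 : ℝ) ^ j)⁻¹ • x)
  set y := ((2 : ℝ) ^ j)⁻¹ • x
  rw [hx, mul_pow, ← pow_mul]
  calc _ = (2 : ℝ) ^ (j * k) * ((((2 : ℝ) ^ j)⁻¹) ^ n *
        (‖y‖ ^ k * ‖iteratedFDeriv ℝ n (P.symbolSchwartz 1) y‖)) := by ring
    _ ≤ (2 : ℝ) ^ (j * k) * (1 * SchwartzMap.seminorm ℝ k n (P.symbolSchwartz 1)) := by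
      gcongr
      exact pow_le_one₀ hc.le hc1
    _ = _ := by ring

theorem exists_seminorm_symbolSchwartz_le (k n : ℕ) :
    ∃ C : ℝ, 0 ≤ C ∧ ∀ j, SchwartzMap.seminorm ℝ k n (P.symbolSchwartz j) ≤ C * 2 ^ (j * k) := by
  refine ⟨SchwartzMap.seminorm ℝ k n (P.symbolSchwartz 0) +
    SchwartzMap.seminorm ℝ k n (P.symbolSchwartz 1), by positivity, fun j => ?_⟩
  have h0 : 0 ≤ SchwartzMap.seminorm ℝ k n (P.symbolSchwartz 0) := apply_nonneg _ _
  have h1 : 0 ≤ SchwartzMap.seminorm ℝ k n (P.symbolSchwartz 1) := apply_nonneg _ _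
  cases j with
  | zero => simp
  | succ j =>
    have h2 : (2 : ℝ) ^ (j * k) ≤ 2 ^ ((j + 1) * k) :=
      pow_le_pow_right₀ (by norm_num) (Nat.mul_le_mul_right k (Nat.le_succ j))
    calc _ ≤ _ := P.seminorm_symbolSchwartz_succ_le k n j
      _ ≤ 2 ^ ((j + 1) * k) * SchwartzMap.seminorm ℝ k n (P.symbolSchwartz 1) := by gcongr
      _ ≤ _ := by rw [mul_comm]; gcongr; linarith

/-- The Schwartz seminorms of the Littlewood-Paley kernels grow at most geometrically. -/
theorem exists_seminorm_kernel_le (k n : ℕ) :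
    ∃ (C : ℝ) (m : ℕ), 0 ≤ C ∧
      ∀ j, SchwartzMap.seminorm ℝ k n (P.kernel j) ≤ C * 2 ^ (j * m) := by
  let L : 𝓢(Sp d, ℂ) →L[ℝ] 𝓢(Sp d, ℝ) :=
    (SchwartzMap.postcompCLM (𝕜 := ℝ) Complex.reCLM).comp
      ((FourierTransform.fourierInvCLM ℂ 𝓢(Sp d, ℂ)).restrictScalars ℝ)
  obtain ⟨s, C, hC, h⟩ := exists_seminorm_le_sum_seminorm L k n
  choose D hD hDle using fun i : ℕ × ℕ => P.exists_seminorm_symbolSchwartz_le i.1 i.2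
  refine ⟨C * ∑ i ∈ s, D i, ∑ i ∈ s, i.1,
    mul_nonneg hC (Finset.sum_nonneg fun i _ => hD i), fun j => ?_⟩
  refine (h (P.symbolSchwartz j)).trans ?_
  rw [mul_assoc, Finset.sum_mul]
  refine mul_le_mul_of_nonneg_left (Finset.sum_le_sum fun i hi => (hDle i j).trans ?_) hC
  refine mul_le_mul_of_nonneg_left (pow_le_pow_right₀ (by norm_num) (Nat.mul_le_mul_left j ?_)) (hD i)
  exact Finset.single_le_sum (f := fun i : ℕ × ℕ => i.1) (fun _ _ => Nat.zero_le _) hi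

theorem exists_weight_kernel_le (k n : ℕ) :
    ∃ (C : ℝ) (m : ℕ), 0 ≤ C ∧
      ∀ j x, (1 + ‖x‖) ^ k * ‖iteratedFDeriv ℝ n (P.kernel j) x‖ ≤ C * 2 ^ (j * m) := by
  choose D m hD hDle using fun i : ℕ × ℕ => P.exists_seminorm_kernel_le i.1 i.2
  refine ⟨2 ^ k * ∑ i ∈ Finset.Iic (k, n), D i, ∑ i ∈ Finset.Iic (k, n), m i,
    mul_nonneg (by positivity) (Finset.sum_nonneg fun i _ => hD i), fun j x => ?_⟩
  refine (SchwartzMap.one_add_le_sup_seminorm_apply (𝕜 := ℝ) (m := (k, n)) le_rfl le_rfl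
    (P.kernel j) x).trans ?_
  rw [mul_assoc]
  refine mul_le_mul_of_nonneg_left ((finset_sup_seminorm_le_sum _ _).trans ?_) (by positivity)
  rw [Finset.sum_mul]
  refine Finset.sum_le_sum fun i hi => (hDle i j).trans ?_
  refine mul_le_mul_of_nonneg_left (pow_le_pow_right₀ (by norm_num) (Nat.mul_le_mul_left j ?_)) (hD i)
  exact Finset.single_le_sum (f := m) (fun _ _ => Nat.zero_le _) hi

end DyadicPartition

/-! ### Littlewood-Paley blocks of Schwartz functions -/

section Complexification

variable {d : ℕ}

/-- A real Schwartz function as a complex one. -/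
def toComplex : 𝓢(Sp d, ℝ) →L[ℝ] 𝓢(Sp d, ℂ) := SchwartzMap.postcompCLM (𝕜 := ℝ) Complex.ofRealCLM

/-- The real part of a complex Schwartz function. -/
def toReal : 𝓢(Sp d, ℂ) →L[ℝ] 𝓢(Sp d, ℝ) := SchwartzMap.postcompCLM (𝕜 := ℝ) Complex.reCLM

@[simp] theorem toComplex_apply (φ : 𝓢(Sp d, ℝ)) (x : Sp d) : toComplex φ x = (φ x : ℂ) := rfl

@[simp] theorem toReal_apply (φ : 𝓢(Sp d, ℂ)) (x : Sp d) : toReal φ x = (φ x).re := rfl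

@[simp] theorem toReal_toComplex (φ : 𝓢(Sp d, ℝ)) : toReal (toComplex φ) = φ := by
  ext x; simp

theorem toComplex_injective : Function.Injective (toComplex : 𝓢(Sp d, ℝ) → 𝓢(Sp d, ℂ)) :=
  Function.LeftInverse.injective toReal_toComplex

/-- The Fourier multiplier with a Schwartz symbol is convolution with the kernel. -/
theorem fourierMultiplierCLM_eq_integral (s φ : 𝓢(Sp d, ℂ)) (x : Sp d) :
    SchwartzMap.fourierMultiplierCLM ℂ s φ x = ∫ z, φ z * 𝓕⁻ s (x - z) := by
  have h1 : SchwartzMap.fourierMultiplierCLM ℂ s φ =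
      SchwartzMap.convolution (ContinuousLinearMap.mul ℂ ℂ) (𝓕⁻ s) φ := by
    have h2 : SchwartzMap.smulLeftCLM ℂ s (𝓕 φ) =
        SchwartzMap.pairing (ContinuousLinearMap.mul ℂ ℂ) (𝓕 (𝓕⁻ s)) (𝓕 φ) := by
      ext y
      rw [SchwartzMap.smulLeftCLM_apply_apply s.hasTemperateGrowth, SchwartzMap.pairing_apply_apply]
      simp
    rw [SchwartzMap.fourierMultiplierCLM_apply, h2, ← SchwartzMap.fourier_convolution]
    simp
  rw [h1, SchwartzMap.convolution_apply, convolution_def, ← integral_sub_left_eq_self _ volume x]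
  simp [mul_comm]

end Complexification

namespace DyadicPartition

variable {d : ℕ} (P : DyadicPartition d)

/-- The Littlewood-Paley block of a real Schwartz function. -/
def lpBlock (n : ℕ) : 𝓢(Sp d, ℝ) →L[ℝ] 𝓢(Sp d, ℝ) :=
  toReal.comp (((SchwartzMap.fourierMultiplierCLM ℂ (P.symbolSchwartz n)).restrictScalars ℝ).comp
    toComplex)

theorem lpBlock_def (n : ℕ) (φ : 𝓢(Sp d, ℝ)) : P.lpBlock n φ =
    toReal (SchwartzMap.fourierMultiplierCLM ℂ (P.symbolSchwartz n) (toComplex φ)) := rfl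

theorem fourierMultiplierCLM_symbol_apply (n : ℕ) (φ : 𝓢(Sp d, ℝ)) (x : Sp d) :
    SchwartzMap.fourierMultiplierCLM ℂ (P.symbolSchwartz n) (toComplex φ) x =
      (∫ z, φ z * P.kernel n (x - z) : ℝ) := by
  rw [fourierMultiplierCLM_eq_integral, ← integral_complex_ofReal]
  refine integral_congr_ae (Eventually.of_forall fun z => ?_)
  simp only [toComplex_apply, ← ofReal_kernel]
  push_cast; rfl

theorem lpBlock_apply (n : ℕ) (φ : 𝓢(Sp d, ℝ)) (x : Sp d) :
    P.lpBlock n φ x = ∫ z, φ z * P.kernel n (x - z) := by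
  rw [lpBlock_def, toReal_apply, fourierMultiplierCLM_symbol_apply, Complex.ofReal_re]

theorem toComplex_lpBlock (n : ℕ) (φ : 𝓢(Sp d, ℝ)) : toComplex (P.lpBlock n φ) =
    SchwartzMap.fourierMultiplierCLM ℂ (P.symbolSchwartz n) (toComplex φ) := by
  ext x
  rw [toComplex_apply, lpBlock_apply, fourierMultiplierCLM_symbol_apply]

theorem lpBlock_compSubConstCLM (n : ℕ) (x : Sp d) (φ : 𝓢(Sp d, ℝ)) :
    P.lpBlock n (SchwartzMap.compSubConstCLM ℝ x φ) =
      SchwartzMap.compSubConstCLM ℝ x (P.lpBlock n φ) := by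
  ext y
  rw [SchwartzMap.compSubConstCLM_apply, lpBlock_apply, lpBlock_apply,
    ← integral_add_right_eq_self _ x]
  refine integral_congr_ae (Eventually.of_forall fun z => ?_)
  simp only [SchwartzMap.compSubConstCLM_apply, add_sub_cancel_right]
  congr 2; abel

/-! ### Partition of unity and interaction of neighbouring blocks -/

/-- The indices of the blocks whose symbols meet that of the `n`-th block. -/
def near (n : ℕ) : Finset ℕ := Finset.Icc (n - 1) (n + 1)

theorem card_near_le (n : ℕ) : (near n).card ≤ 3 := by
  rw [near, Nat.card_Icc]; omega

theorem mem_near_le {n m : ℕ} (h : m ∈ near n) : m ≤ n + 1 ∧ n ≤ m + 1 := by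
  rw [near, Finset.mem_Icc] at h; omega

theorem symbol_mul_symbol_eq_zero {n m : ℕ} (h : m ∉ near n) (x : Sp d) :
    P.symbol n x * P.symbol m x = 0 := by
  have key : ∀ n m, n + 2 ≤ m → P.symbol n x * P.symbol m x = 0 := fun n m hnm => by
    have hdis : Disjoint (tsupport (P.symbol n)) (tsupport (P.symbol m)) := by
      obtain ⟨j, rfl⟩ : ∃ j, m = j + 1 := ⟨m - 1, by omega⟩
      cases n with
      | zero => exact P.disjoint_χ_ρ j (by omega)
      | succ i => exact P.disjoint_ρ_ρ i j (by omega)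
    by_contra hne
    have h1 := subset_tsupport _ (Function.mem_support.2 (left_ne_zero_of_mul hne))
    have h2 := subset_tsupport _ (Function.mem_support.2 (right_ne_zero_of_mul hne))
    exact Set.disjoint_left.1 hdis h1 h2
  rw [near, Finset.mem_Icc] at h
  rcases Nat.lt_or_ge m n with hlt | hge
  · rw [mul_comm]; exact key m n (by omega)
  · exact key n m (by omega)

/-- The partial sums of the dyadic partition of unity are dilations of the low-frequency
function. -/
theorem sum_symbol (N : ℕ) (x : Sp d) :
    ∑ n ∈ Finset.range (N + 1), P.symbol n x = P.χ (((2 : ℝ) ^ N)⁻¹ • x) := by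
  have h1 := P.sum_eq_one x
  have h2 := P.sum_eq_one (((2 : ℝ) ^ N)⁻¹ • x)
  -- The tail of the partition of unity at `x` from index `N` on is the whole sum over `ρ` at
  -- `2^{-N} x`.
  have h3 : HasSum (fun j : ℕ => P.ρ (((2 : ℝ) ^ (j + N))⁻¹ • x))
      (1 - P.χ (((2 : ℝ) ^ N)⁻¹ • x)) := by
    refine h2.congr_fun fun j => ?_
    rw [smul_smul, pow_add, mul_inv]
  have h4 := (hasSum_nat_add_iff' N).2 h1
  have h5 := h4.unique h3
  rw [Finset.sum_range_succ']
  simp only [symbol]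
  linarith

theorem χ_eq_one {x : Sp d} (hx : ‖x‖ < P.a) : P.χ x = 1 := by
  have h0 : ∀ j : ℕ, P.ρ (((2 : ℝ) ^ j)⁻¹ • x) = 0 := fun j => by
    by_contra hne
    have h1 := P.ρ_supp (subset_tsupport _ (Function.mem_support.2 hne))
    have h2 : ((2 : ℝ) ^ j)⁻¹ ≤ 1 := inv_le_one_of_one_le₀ (one_le_pow₀ (by norm_num))
    have h3 : ‖((2 : ℝ) ^ j)⁻¹ • x‖ ≤ ‖x‖ := by
      rw [norm_smul, Real.norm_of_nonneg (by positivity)]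
      exact mul_le_of_le_one_left (norm_nonneg _) h2
    have h4 : P.a ≤ ‖((2 : ℝ) ^ j)⁻¹ • x‖ := h1.1
    linarith
  have h := P.sum_eq_one x
  simp only [h0] at h
  have := h.unique hasSum_zero
  linarith

theorem exists_sum_symbol_eq_one (x : Sp d) :
    ∃ N₀, ∀ N, N₀ ≤ N → ∑ n ∈ Finset.range (N + 1), P.symbol n x = 1 := by
  obtain ⟨N₀, hN₀⟩ := pow_unbounded_of_one_lt (‖x‖ / P.a) (by norm_num : (1 : ℝ) < 2)
  refine ⟨N₀, fun N hN => ?_⟩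
  have h1 : (2 : ℝ) ^ N₀ ≤ 2 ^ N := pow_le_pow_right₀ (by norm_num) hN
  rw [sum_symbol, P.χ_eq_one]
  rw [norm_smul, Real.norm_of_nonneg (by positivity), inv_mul_lt_iff₀ (by positivity)]
  rw [div_lt_iff₀ P.a_pos] at hN₀
  have := P.a_pos
  nlinarith

/-- The sum over `near n` can be enlarged to a partial sum that equals one at `x`: the added symbols
have zero product with the `n`-th. -/
theorem symbol_mul_sum_near (n : ℕ) (x : Sp d) :
    P.symbol n x * ∑ m ∈ near n, P.symbol m x = P.symbol n x := by
  obtain ⟨N₀, hN₀⟩ := P.exists_sum_symbol_eq_one x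
  have h1 := hN₀ (N₀ + (n + 1)) (by omega)
  have hsub : near n ⊆ Finset.range (N₀ + (n + 1) + 1) := fun m hm => by
    have := mem_near_le hm
    rw [Finset.mem_range]; omega
  have h2 : P.symbol n x * ∑ m ∈ near n, P.symbol m x =
      P.symbol n x * ∑ m ∈ Finset.range (N₀ + (n + 1) + 1), P.symbol m x := by
    rw [Finset.mul_sum, Finset.mul_sum]
    exact Finset.sum_subset hsub fun m _ hm => P.symbol_mul_symbol_eq_zero hm x
  rw [h2, h1, mul_one]

theorem symbolSchwartz_mul_sum_near (n : ℕ) (ξ : Sp d) :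
    P.symbolSchwartz n ξ * ∑ m ∈ near n, P.symbolSchwartz m ξ = P.symbolSchwartz n ξ := by
  simp only [symbolSchwartz_apply]
  exact_mod_cast P.symbol_mul_sum_near n ((2 * Real.pi) • ξ)

theorem fourier_toComplex_lpBlock (n : ℕ) (φ : 𝓢(Sp d, ℝ)) (ξ : Sp d) :
    𝓕 (toComplex (P.lpBlock n φ)) ξ = P.symbolSchwartz n ξ * 𝓕 (toComplex φ) ξ := by
  rw [toComplex_lpBlock, SchwartzMap.fourierMultiplierCLM_apply,
    FourierTransform.fourier_fourierInv_eq,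
    SchwartzMap.smulLeftCLM_apply_apply (P.symbolSchwartz n).hasTemperateGrowth, smul_eq_mul]

theorem eq_of_fourier_toComplex_eq {φ ψ : 𝓢(Sp d, ℝ)}
    (h : ∀ ξ, 𝓕 (toComplex φ) ξ = 𝓕 (toComplex ψ) ξ) : φ = ψ := by
  have h1 : 𝓕 (toComplex φ) = 𝓕 (toComplex ψ) := SchwartzMap.ext h
  apply toComplex_injective
  rw [← FourierTransform.fourierInv_fourier_eq (F := 𝓢(Sp d, ℂ)) (toComplex φ), h1,
    FourierTransform.fourierInv_fourier_eq]

theorem fourier_toComplex_sum (s : Finset ℕ) (f : ℕ → 𝓢(Sp d, ℝ)) (ξ : Sp d) :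
    𝓕 (toComplex (∑ m ∈ s, f m)) ξ = ∑ m ∈ s, 𝓕 (toComplex (f m)) ξ := by
  have : 𝓕 (toComplex (∑ m ∈ s, f m)) = ∑ m ∈ s, 𝓕 (toComplex (f m)) := by
    rw [map_sum]
    exact map_sum (FourierTransform.fourierCLM ℂ 𝓢(Sp d, ℂ)) _ _
  rw [this]
  simp

/-- Blocks only see the neighbouring blocks. -/
theorem lpBlock_sum_near (n : ℕ) (φ : 𝓢(Sp d, ℝ)) :
    P.lpBlock n (∑ m ∈ near n, P.lpBlock m φ) = P.lpBlock n φ := by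
  refine eq_of_fourier_toComplex_eq fun ξ => ?_
  rw [fourier_toComplex_lpBlock, fourier_toComplex_sum, fourier_toComplex_lpBlock]
  simp only [fourier_toComplex_lpBlock]
  rw [← Finset.sum_mul, ← mul_assoc, symbolSchwartz_mul_sum_near]

theorem fourier_toComplex_kernel (n : ℕ) (ξ : Sp d) :
    𝓕 (toComplex (P.kernel n)) ξ = P.symbolSchwartz n ξ := by
  have : toComplex (P.kernel n) = 𝓕⁻ (P.symbolSchwartz n) := by
    ext x; rw [toComplex_apply, ofReal_kernel]
  rw [this, FourierTransform.fourier_fourierInv_eq]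

theorem lpBlock_sum_near_kernel (n : ℕ) :
    P.lpBlock n (∑ m ∈ near n, P.kernel m) = P.kernel n := by
  refine eq_of_fourier_toComplex_eq fun ξ => ?_
  rw [fourier_toComplex_lpBlock, fourier_toComplex_sum]
  simp only [fourier_toComplex_kernel]
  rw [symbolSchwartz_mul_sum_near]

end DyadicPartition

/-! ### Convergence of the Littlewood-Paley decomposition and its pairing with distributions -/

namespace DyadicPartition

variable {d : ℕ} (P : DyadicPartition d)

/-- The symbol of the sum of the blocks `≥ N` (up to sign). -/
def tailSymbol (N : ℕ) (ξ : Sp d) : ℂ := P.symbolSchwartz 0 (((2 : ℝ) ^ N)⁻¹ • ξ) - 1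

theorem sum_symbolSchwartz (N : ℕ) (ξ : Sp d) :
    ∑ n ∈ Finset.range (N + 1), P.symbolSchwartz n ξ = P.tailSymbol N ξ + 1 := by
  rw [tailSymbol, sub_add_cancel]
  simp only [symbolSchwartz_apply]
  rw [← Complex.ofReal_sum, sum_symbol, smul_comm]
  rfl

theorem contDiff_tailSymbol (N : ℕ) : ContDiff ℝ ∞ (P.tailSymbol N) :=
  (((P.symbolSchwartz 0).smooth ⊤).comp (contDiff_const_smul _)).sub contDiff_const

theorem tailSymbol_eq_zero {N : ℕ} {ξ : Sp d} (hξ : 2 * Real.pi * ‖ξ‖ < P.a * 2 ^ N) :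
    P.tailSymbol N ξ = 0 := by
  have : ‖(2 * Real.pi) • ((2 : ℝ) ^ N)⁻¹ • ξ‖ < P.a := by
    rw [norm_smul, norm_smul, Real.norm_of_nonneg (by positivity), Real.norm_of_nonneg (by positivity),
      mul_left_comm, inv_mul_lt_iff₀ (by positivity), mul_comm _ P.a]
    exact hξ
  rw [tailSymbol, symbolSchwartz_apply, symbol, P.χ_eq_one this]
  simp

theorem exists_norm_iteratedFDeriv_tailSymbol_le (i : ℕ) :
    ∃ B : ℝ, 0 ≤ B ∧ ∀ N ξ, ‖iteratedFDeriv ℝ i (P.tailSymbol N) ξ‖ ≤ B := by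
  refine ⟨SchwartzMap.seminorm ℝ 0 i (P.symbolSchwartz 0) + 1, by positivity, fun N ξ => ?_⟩
  have hsm : ContDiff ℝ i fun η : Sp d => P.symbolSchwartz 0 (((2 : ℝ) ^ N)⁻¹ • η) :=
    ((P.symbolSchwartz 0).smooth i).comp (contDiff_const_smul _)
  have hc : (0 : ℝ) < (2 ^ N)⁻¹ := by positivity
  have hc1 : ((2 : ℝ) ^ N)⁻¹ ≤ 1 := inv_le_one_of_one_le₀ (one_le_pow₀ (by norm_num))
  have h1 : ‖iteratedFDeriv ℝ i (fun η : Sp d => P.symbolSchwartz 0 (((2 : ℝ) ^ N)⁻¹ • η)) ξ‖ ≤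
      SchwartzMap.seminorm ℝ 0 i (P.symbolSchwartz 0) := by
    rw [iteratedFDeriv_comp_const_smul _ ((P.symbolSchwartz 0).smooth i), norm_smul, norm_pow,
      Real.norm_of_nonneg hc.le]
    refine (mul_le_of_le_one_left (norm_nonneg _) (pow_le_one₀ hc.le hc1)).trans ?_
    exact SchwartzMap.norm_iteratedFDeriv_le_seminorm ℝ _ i _
  have h2 : ‖iteratedFDeriv ℝ i (fun _ : Sp d => (1 : ℂ)) ξ‖ ≤ 1 := by
    cases i with
    | zero => simp
    | succ i => rw [iteratedFDeriv_const_of_ne (by omega)]; simp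
  have h3 : iteratedFDeriv ℝ i (P.tailSymbol N) ξ =
      iteratedFDeriv ℝ i (fun η : Sp d => P.symbolSchwartz 0 (((2 : ℝ) ^ N)⁻¹ • η)) ξ -
      iteratedFDeriv ℝ i (fun _ : Sp d => (1 : ℂ)) ξ :=
    iteratedFDeriv_sub_apply hsm.contDiffAt contDiff_const.contDiffAt
  rw [h3]
  exact (norm_sub_le _ _).trans (add_le_add h1 h2)

/-- The error is `tailSymbol N * f`. Its first factor vanishes on a ball of radius proportional to
`2^N` and has derivatives bounded uniformly in `N`; outside the ball one more power of `‖ξ‖`,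
available since `f` is Schwartz, buys a factor `2^{-N}`. -/
theorem tendsto_sum_smulLeftCLM_symbol (f : 𝓢(Sp d, ℂ)) :
    Tendsto (fun N => ∑ n ∈ Finset.range (N + 1), SchwartzMap.smulLeftCLM ℂ (P.symbolSchwartz n) f)
      atTop (𝓝 f) := by
  rw [(schwartz_withSeminorms ℝ (Sp d) ℂ).tendsto_nhds]
  rintro ⟨k, n⟩ ε hε
  choose B hB hBle using P.exists_norm_iteratedFDeriv_tailSymbol_le
  set D : ℝ := ∑ i ∈ Finset.range (n + 1), (n.choose i : ℝ) * B i *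
    SchwartzMap.seminorm ℝ (k + 1) (n - i) f with hD
  have hD0 : 0 ≤ D := Finset.sum_nonneg fun i _ =>
    mul_nonneg (mul_nonneg (Nat.cast_nonneg _) (hB i)) (apply_nonneg _ _)
  have ha := P.a_pos
  have hlim : Tendsto (fun N : ℕ => 2 * Real.pi * D / P.a / (2 : ℝ) ^ N) atTop (𝓝 0) :=
    tendsto_const_nhds.div_atTop (tendsto_pow_atTop_atTop_of_one_lt (by norm_num))
  filter_upwards [hlim.eventually (gt_mem_nhds hε)] with N hN
  refine lt_of_le_of_lt ?_ hN
  rw [SchwartzMap.schwartzSeminormFamily_apply]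
  refine SchwartzMap.seminorm_le_bound ℝ k n _ (by positivity) fun ξ => ?_
  have heq : (⇑(∑ n ∈ Finset.range (N + 1), SchwartzMap.smulLeftCLM ℂ (P.symbolSchwartz n) f - f) :
      Sp d → ℂ) = fun η => P.tailSymbol N η * f η := by
    funext η
    have h1 : (∑ n ∈ Finset.range (N + 1), SchwartzMap.smulLeftCLM ℂ (P.symbolSchwartz n) f) η =
        ∑ n ∈ Finset.range (N + 1), P.symbolSchwartz n η * f η := by
      simp [SchwartzMap.smulLeftCLM_apply_apply (SchwartzMap.hasTemperateGrowth _)]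
    rw [_root_.sub_apply, h1, ← Finset.sum_mul, sum_symbolSchwartz]
    ring
  rw [heq]
  rcases lt_or_ge (2 * Real.pi * ‖ξ‖) (P.a * 2 ^ N) with hξ | hξ
  · have hev : (fun η => P.tailSymbol N η * f η) =ᶠ[𝓝 ξ] fun _ => 0 := by
      have ho : IsOpen {η : Sp d | 2 * Real.pi * ‖η‖ < P.a * 2 ^ N} :=
        isOpen_lt (by fun_prop) continuous_const
      filter_upwards [ho.mem_nhds hξ] with η hη
      rw [P.tailSymbol_eq_zero hη, zero_mul]
    rw [(hev.iteratedFDeriv ℝ n).eq_of_nhds, iteratedFDeriv_fun_zero]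
    simp only [Pi.zero_apply, norm_zero, mul_zero]
    positivity
  · have h1 := norm_iteratedFDeriv_mul_le (n := n) (P.contDiff_tailSymbol N) (f.smooth ⊤) ξ
      (by exact_mod_cast le_top)
    have h2 : 1 ≤ 2 * Real.pi * ‖ξ‖ / (P.a * 2 ^ N) := by
      rw [one_le_div (by positivity)]; exact hξ
    have h3 : ∀ i ∈ Finset.range (n + 1), ‖ξ‖ ^ (k + 1) * ((n.choose i : ℝ) *
        ‖iteratedFDeriv ℝ i (P.tailSymbol N) ξ‖ * ‖iteratedFDeriv ℝ (n - i) f ξ‖) ≤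
        (n.choose i : ℝ) * B i * SchwartzMap.seminorm ℝ (k + 1) (n - i) f := fun i _ => by
      have e1 := hBle i N ξ
      have e2 := SchwartzMap.le_seminorm ℝ (k + 1) (n - i) f ξ
      have := hB i
      calc _ = (n.choose i : ℝ) * ‖iteratedFDeriv ℝ i (P.tailSymbol N) ξ‖ *
            (‖ξ‖ ^ (k + 1) * ‖iteratedFDeriv ℝ (n - i) f ξ‖) := by ring
        _ ≤ _ := by gcongr
    have h4 : ‖ξ‖ ^ (k + 1) * ‖iteratedFDeriv ℝ n (fun η => P.tailSymbol N η * f η) ξ‖ ≤ D := by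
      refine (mul_le_mul_of_nonneg_left h1 (by positivity)).trans ?_
      rw [Finset.mul_sum]
      exact Finset.sum_le_sum h3
    calc ‖ξ‖ ^ k * ‖iteratedFDeriv ℝ n (fun η => P.tailSymbol N η * f η) ξ‖
        = 1 * (‖ξ‖ ^ k * ‖iteratedFDeriv ℝ n (fun η => P.tailSymbol N η * f η) ξ‖) := by ring
      _ ≤ 2 * Real.pi * ‖ξ‖ / (P.a * 2 ^ N) *
          (‖ξ‖ ^ k * ‖iteratedFDeriv ℝ n (fun η => P.tailSymbol N η * f η) ξ‖) := by gcongr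
      _ = 2 * Real.pi / (P.a * 2 ^ N) *
          (‖ξ‖ ^ (k + 1) * ‖iteratedFDeriv ℝ n (fun η => P.tailSymbol N η * f η) ξ‖) := by ring
      _ ≤ 2 * Real.pi / (P.a * 2 ^ N) * D := by gcongr
      _ = _ := by field_simp

/-- The Littlewood-Paley decomposition converges in the Schwartz space. -/
theorem tendsto_sum_lpBlock (φ : 𝓢(Sp d, ℝ)) :
    Tendsto (fun N => ∑ n ∈ Finset.range (N + 1), P.lpBlock n φ) atTop (𝓝 φ) := by
  let L : 𝓢(Sp d, ℂ) →L[ℝ] 𝓢(Sp d, ℝ) :=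
    toReal.comp ((FourierTransform.fourierInvCLM ℂ 𝓢(Sp d, ℂ)).restrictScalars ℝ)
  have h := (L.continuous.tendsto _).comp (P.tendsto_sum_smulLeftCLM_symbol (𝓕 (toComplex φ)))
  have e1 : L (𝓕 (toComplex φ)) = φ := by
    change toReal (𝓕⁻ (𝓕 (toComplex φ))) = φ
    rw [FourierTransform.fourierInv_fourier_eq, toReal_toComplex]
  have e2 : (⇑L ∘ fun N => ∑ n ∈ Finset.range (N + 1),
      SchwartzMap.smulLeftCLM ℂ (P.symbolSchwartz n) (𝓕 (toComplex φ))) =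
      fun N => ∑ n ∈ Finset.range (N + 1), P.lpBlock n φ := by
    funext N
    rw [Function.comp_apply, map_sum]
    rfl
  rwa [e1, e2] at h

variable {F : Type*} [NormedAddCommGroup F] [NormedSpace ℝ F]

theorem block_eq (n : ℕ) (b : TempDist d F) (x : Sp d) :
    P.block n b x = b (SchwartzMap.compSubConstCLM ℝ x (P.kernel n)) := by
  rw [block, reflectAt_kernel]

theorem continuous_block (n : ℕ) (b : TempDist d F) : Continuous (P.block n b) := by
  have : P.block n b = fun x => b (SchwartzMap.compSubConstCLM ℝ x (P.kernel n)) :=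
    funext fun x => P.block_eq n b x
  rw [this]
  exact b.continuous.comp (continuous_compSubConstCLM (P.kernel n))

/-- Translation by `z` enlarges a seminorm by at most a constant times `(1 + ‖z‖)^k`; the decay of
`φ` absorbs this with `d + 1` powers to spare for integrability. -/
theorem schwartzIntegrable_smul_compSubConstCLM (φ ψ : 𝓢(Sp d, ℝ)) :
    SchwartzIntegrable (fun z : Sp d => φ z • SchwartzMap.compSubConstCLM ℝ z ψ) volume := by
  have hc : Continuous fun z : Sp d => φ z • SchwartzMap.compSubConstCLM ℝ z ψ :=
    φ.continuous.smul (continuous_compSubConstCLM ψ)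
  refine ⟨hc, fun k n => ?_⟩
  obtain ⟨C, hC, h⟩ := exists_seminorm_compSubConstCLM_le ψ k n
  obtain ⟨D, hD, h'⟩ := exists_weight_iteratedFDeriv_le φ (d + 1 + k) 0
  refine integrable_of_weight ((continuous_seminorm k n).comp hc).aestronglyMeasurable
    (C := C * D) fun z => ?_
  have h1 := h z
  have h2 := h' z
  rw [norm_iteratedFDeriv_zero, pow_add] at h2
  rw [Real.norm_of_nonneg (apply_nonneg _ _), map_smul_eq_mul]
  calc (1 + ‖z‖) ^ (d + 1) * (‖φ z‖ * SchwartzMap.seminorm ℝ k n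
        (SchwartzMap.compSubConstCLM ℝ z ψ))
      ≤ (1 + ‖z‖) ^ (d + 1) * (‖φ z‖ * (C * (1 + ‖z‖) ^ k)) := by gcongr
    _ = C * ((1 + ‖z‖) ^ (d + 1) * (1 + ‖z‖) ^ k * ‖φ z‖) := by ring
    _ ≤ C * D := by gcongr

theorem integrable_smul_block (n : ℕ) (b : TempDist d F) (φ : 𝓢(Sp d, ℝ)) :
    Integrable fun z => φ z • P.block n b z := by
  refine ((schwartzIntegrable_smul_compSubConstCLM φ (P.kernel n)).integrable_clm b).congr
    (Eventually.of_forall fun z => ?_)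
  simp only [map_smul, block_eq]

/-- The block of a distribution, paired with a test function. -/
theorem apply_lpBlock [CompleteSpace F] (n : ℕ) (b : TempDist d F) (φ : 𝓢(Sp d, ℝ)) :
    b (P.lpBlock n φ) = ∫ z, φ z • P.block n b z := by
  rw [(schwartzIntegrable_smul_compSubConstCLM φ (P.kernel n)).map_eq_integral
    (Φ := P.lpBlock n φ) (fun y => by rw [lpBlock_apply]; rfl) b]
  simp only [map_smul, block_eq]

/-- The fattened kernel. -/
def nearKernel (n : ℕ) : 𝓢(Sp d, ℝ) := ∑ m ∈ near n, P.kernel m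

theorem apply_lpBlock_near [CompleteSpace F] (n : ℕ) (b : TempDist d F) (φ : 𝓢(Sp d, ℝ)) :
    b (P.lpBlock n φ) = ∫ z, (∑ m ∈ near n, P.lpBlock m φ) z • P.block n b z := by
  rw [← lpBlock_sum_near, apply_lpBlock]

theorem tendsto_sum_apply_lpBlock (b : TempDist d F) (φ : 𝓢(Sp d, ℝ)) :
    Tendsto (fun N => ∑ n ∈ Finset.range (N + 1), b (P.lpBlock n φ)) atTop (𝓝 (b φ)) := by
  have h := (b.continuous.tendsto _).comp (P.tendsto_sum_lpBlock φ)
  refine h.congr fun N => ?_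
  rw [Function.comp_apply, map_sum]

end DyadicPartition

/-! ### Bernstein-type bounds for the blocks of a Besov distribution -/

section Shift

variable {E F : Type*} [NormedAddCommGroup E] [NormedSpace ℝ E] [NormedAddCommGroup F]
  [NormedSpace ℝ F]

/-- The difference of a Schwartz function and its translate. -/
def shiftDiff (h : E) (ψ : 𝓢(E, F)) : 𝓢(E, F) := SchwartzMap.compSubConstCLM ℝ h ψ - ψ

theorem weight_iteratedFDeriv_shiftDiff_le {ψ : 𝓢(E, F)} {k n : ℕ} {C : ℝ}
    (hC : ∀ x, (1 + ‖x‖) ^ k * ‖iteratedFDeriv ℝ (n + 1) ψ x‖ ≤ C) {h : E} (hh : ‖h‖ ≤ 1) (x : E) :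
    (1 + ‖x‖) ^ k * ‖iteratedFDeriv ℝ n (shiftDiff h ψ) x‖ ≤ 2 ^ k * C * ‖h‖ := by
  have hsub : iteratedFDeriv ℝ n (shiftDiff h ψ) x =
      iteratedFDeriv ℝ n ψ (x + -h) - iteratedFDeriv ℝ n ψ x := by
    rw [← sub_eq_add_neg, ← iteratedFDeriv_compSubConstCLM]
    exact iteratedFDeriv_sub_apply ((SchwartzMap.smooth _ n).contDiffAt)
      ((SchwartzMap.smooth _ n).contDiffAt)
  have hdiff : Differentiable ℝ (iteratedFDeriv ℝ n ψ) :=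
    (ψ.smooth ⊤).differentiable_iteratedFDeriv (by exact_mod_cast ENat.natCast_lt_top n)
  rw [hsub]
  have := weight_norm_sub_le hdiff (fun y => by rw [norm_fderiv_iteratedFDeriv]; exact hC y)
    (x := x) (h := -h) (by rwa [norm_neg])
  rwa [norm_neg] at this

end Shift

/-- A function with bounded values, first and second differences at scale one satisfies the same
bounds at all scales. -/
theorem difference_bounds_of_le_one {E F : Type*} [NormedAddCommGroup E] [NormedAddCommGroup F]
    {f : E → F} {C : ℝ}
    (h0 : ∀ x, ‖f x‖ ≤ C) (h1 : ∀ x h, ‖h‖ ≤ 1 → ‖f (x + h) - f x‖ ≤ C * ‖h‖)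
    (h2 : ∀ x h k, ‖h‖ ≤ 1 → ‖k‖ ≤ 1 →
      ‖f (x + h + k) - f (x + h) - f (x + k) + f x‖ ≤ C * (‖h‖ * ‖k‖)) :
    (∀ x h, ‖f (x + h) - f x‖ ≤ 2 * C * ‖h‖) ∧
    ∀ x h k, ‖f (x + h + k) - f (x + h) - f (x + k) + f x‖ ≤ 4 * C * (‖h‖ * ‖k‖) := by
  have hC : 0 ≤ C := (norm_nonneg _).trans (h0 0)
  have H1 : ∀ x h, ‖f (x + h) - f x‖ ≤ 2 * C * ‖h‖ := fun x h => by
    rcases le_total ‖h‖ 1 with hh | hh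
    · exact (h1 x h hh).trans (by nlinarith [mul_nonneg hC (norm_nonneg h)])
    · have := norm_sub_le (f (x + h)) (f x)
      have a1 := h0 (x + h)
      have a2 := h0 x
      nlinarith
  refine ⟨H1, fun x h k => ?_⟩
  rcases le_total ‖h‖ 1 with hh | hh
  · rcases le_total ‖k‖ 1 with hk | hk
    · refine (h2 x h k hh hk).trans ?_
      have : 0 ≤ C * (‖h‖ * ‖k‖) := by positivity
      linarith
    · have a1 := H1 (x + k) h
      have a2 := H1 x h
      have e : f (x + h + k) - f (x + h) - f (x + k) + f x =
          (f (x + k + h) - f (x + k)) - (f (x + h) - f x) := by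
        rw [add_right_comm]; abel
      rw [e]
      refine (norm_sub_le _ _).trans ((add_le_add a1 a2).trans ?_)
      have : C * ‖h‖ * 1 ≤ C * ‖h‖ * ‖k‖ := by gcongr
      linarith
  · have a1 := H1 (x + h) k
    have a2 := H1 x k
    have e : f (x + h + k) - f (x + h) - f (x + k) + f x =
        (f (x + h + k) - f (x + h)) - (f (x + k) - f x) := by abel
    rw [e]
    refine (norm_sub_le _ _).trans ((add_le_add a1 a2).trans ?_)
    have : C * ‖k‖ * 1 ≤ C * ‖k‖ * ‖h‖ := by gcongr
    linarith

section Hoelder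

variable {d : ℕ} {F : Type*} [NormedAddCommGroup F] [NormedSpace ℝ F]

/-- A Hölder inequality: a rapidly decaying function pairs with any `L^p` function, with a constant
independent of `p` and of the translation. -/
theorem norm_integral_smul_le_of_weight {G : Sp d → ℝ} {f : Sp d → F} (hf : Continuous f) {D A : ℝ}
    (hA : 0 ≤ A) {p : ℝ≥0∞} (hp : 1 ≤ p) (hfp : eLpNorm f p volume ≤ ENNReal.ofReal A)
    (hG : ∀ y, (1 + ‖y‖) ^ (d + 1) * ‖G y‖ ≤ D) (x : Sp d) :
    ‖∫ z, G (z - x) • f z‖ ≤ D * (A * (1 + weightIntegral d)) := by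
  have hD : 0 ≤ D := le_trans (by positivity) (hG 0)
  have hW := weightIntegral_nonneg d
  let wt : Sp d → ℝ := fun z => ((1 + ‖z - x‖) ^ (d + 1))⁻¹
  have hwt : Continuous wt := by
    refine Continuous.inv₀ (by fun_prop) fun z => ?_
    positivity
  have hwt0 : ∀ z, 0 ≤ wt z := fun z => by positivity
  have hwt1 : ∀ z, wt z ≤ 1 := fun z =>
    inv_le_one_of_one_le₀ (one_le_pow₀ (by linarith [norm_nonneg (z - x)]))
  let w : Sp d → ℝ≥0∞ := fun z => ENNReal.ofReal (wt z)
  have hw : Measurable w := hwt.measurable.ennreal_ofReal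
  -- For this finite measure, dominated by Lebesgue measure, the inclusion of `L^p` in `L¹` gives
  -- the bound for all `p ≥ 1` at once; the power of its total mass lies in `[0,1]`, hence is at
  -- most `1 + weightIntegral d`.
  let ν : Measure (Sp d) := volume.withDensity w
  have hν : ν ≤ volume := by
    have h1 : ν ≤ volume.withDensity 1 := withDensity_mono (Eventually.of_forall fun z => by
      simpa [w] using hwt1 z)
    rwa [withDensity_one] at h1
  have hνu : ν univ = ENNReal.ofReal (weightIntegral d) := by
    rw [withDensity_apply _ MeasurableSet.univ, Measure.restrict_univ,
      ← ofReal_integral_eq_lintegral_ofReal ((integrable_weight d).comp_sub_right x)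
        (Eventually.of_forall hwt0), weightIntegral,
      ← integral_sub_right_eq_self (fun z : Sp d => ((1 + ‖z‖) ^ (d + 1))⁻¹) x]
  have h1 : ‖∫ z, G (z - x) • f z‖ₑ ≤ ENNReal.ofReal D * eLpNorm f 1 ν := by
    rw [eLpNorm_one_eq_lintegral_enorm, lintegral_withDensity_eq_lintegral_mul _ hw
      hf.enorm.measurable, ← lintegral_const_mul _ (hw.mul hf.enorm.measurable)]
    refine (enorm_integral_le_lintegral_enorm _).trans (lintegral_mono fun z => ?_)
    rw [enorm_smul, Pi.mul_apply, ← mul_assoc, ← ENNReal.ofReal_mul hD]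
    gcongr
    rw [← ofReal_norm]
    exact ENNReal.ofReal_le_ofReal (norm_le_of_weight (norm_nonneg _) (hG _))
  have h2 : eLpNorm f 1 ν ≤ ENNReal.ofReal (A * (1 + weightIntegral d)) := by
    have h3 := eLpNorm_le_eLpNorm_mul_rpow_measure_univ (μ := ν) hp hf.aestronglyMeasurable
    have hexp0 : 0 ≤ 1 / (1 : ℝ≥0∞).toReal - 1 / p.toReal ∧
        1 / (1 : ℝ≥0∞).toReal - 1 / p.toReal ≤ 1 := by
      rw [ENNReal.toReal_one, div_one]
      rcases eq_or_ne p ⊤ with rfl | hpt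
      · simp
      · have : 1 ≤ p.toReal := by
          rw [← ENNReal.toReal_one]; exact ENNReal.toReal_mono hpt hp
        have h5 : 1 / p.toReal ≤ 1 := by rw [div_le_one (by linarith)]; exact this
        have h6 : 0 ≤ 1 / p.toReal := by positivity
        constructor <;> linarith
    have h4 : ν univ ^ (1 / (1 : ℝ≥0∞).toReal - 1 / p.toReal) ≤
        ENNReal.ofReal (1 + weightIntegral d) := by
      rw [hνu, ENNReal.ofReal_rpow_of_nonneg hW hexp0.1]
      refine ENNReal.ofReal_le_ofReal ?_
      calc weightIntegral d ^ _ ≤ (1 + weightIntegral d) ^ _ :=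
            Real.rpow_le_rpow hW (by linarith) hexp0.1
        _ ≤ (1 + weightIntegral d) ^ (1 : ℝ) :=
            Real.rpow_le_rpow_of_exponent_le (by linarith) hexp0.2
        _ = _ := Real.rpow_one _
    rw [ENNReal.ofReal_mul hA]
    exact h3.trans (mul_le_mul' ((eLpNorm_mono_measure f hν).trans hfp) h4)
  have h5 : ‖∫ z, G (z - x) • f z‖ₑ ≤ ENNReal.ofReal (D * (A * (1 + weightIntegral d))) := by
    rw [ENNReal.ofReal_mul hD]
    exact h1.trans (mul_le_mul_right h2 _)
  rw [← ofReal_norm] at h5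
  exact (ENNReal.ofReal_le_ofReal_iff (by positivity)).1 h5

end Hoelder

namespace DyadicPartition

variable {d : ℕ} (P : DyadicPartition d) {F : Type*} [NormedAddCommGroup F] [NormedSpace ℝ F]

theorem mul_eLpNorm_block_le_besovNorm {α : ℝ} {p q : ℝ≥0∞} (hq : q ≠ 0) (b : TempDist d F)
    (n : ℕ) : ENNReal.ofReal ((2 : ℝ) ^ (((n : ℝ) - 1) * α)) * eLpNorm (P.block n b) p volume ≤
      P.besovNorm α p q b := by
  have := enorm_le_eLpNorm_count (p := q) (fun n : ℕ =>
    ENNReal.ofReal ((2 : ℝ) ^ (((n : ℝ) - 1) * α)) * eLpNorm (P.block n b) p volume) n hq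
  rwa [enorm_eq_self] at this

theorem eLpNorm_block_le {α : ℝ} {p q : ℝ≥0∞} (hq : q ≠ 0) (b : TempDist d F) {B : ℝ}
    (hB : P.besovNorm α p q b ≤ ENNReal.ofReal B) (n : ℕ) :
    eLpNorm (P.block n b) p volume ≤ ENNReal.ofReal ((2 : ℝ) ^ ((1 - (n : ℝ)) * α) * B) := by
  have h1 := (P.mul_eLpNorm_block_le_besovNorm (p := p) (α := α) hq b n).trans hB
  have h2 : (0 : ℝ) < (2 : ℝ) ^ (((n : ℝ) - 1) * α) := Real.rpow_pos_of_pos (by norm_num) _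
  have h3 : (2 : ℝ) ^ ((1 - (n : ℝ)) * α) * (2 : ℝ) ^ (((n : ℝ) - 1) * α) = 1 := by
    rw [← Real.rpow_add (by norm_num)]; ring_nf; simp
  calc eLpNorm (P.block n b) p volume
      = ENNReal.ofReal ((2 : ℝ) ^ ((1 - (n : ℝ)) * α)) *
        (ENNReal.ofReal ((2 : ℝ) ^ (((n : ℝ) - 1) * α)) * eLpNorm (P.block n b) p volume) := by
        rw [← mul_assoc, ← ENNReal.ofReal_mul (by positivity), h3, ENNReal.ofReal_one, one_mul]
    _ ≤ ENNReal.ofReal ((2 : ℝ) ^ ((1 - (n : ℝ)) * α)) * ENNReal.ofReal B := by gcongr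
    _ = _ := by rw [← ENNReal.ofReal_mul (by positivity)]

theorem exists_eLpNorm_block_le {α : ℝ} {p q : ℝ≥0∞} (hq : q ≠ 0) {b : TempDist d F}
    (hb : P.MemBesov α p q b) : ∃ (A : ℝ) (m : ℕ), 0 ≤ A ∧
      ∀ n, eLpNorm (P.block n b) p volume ≤ ENNReal.ofReal (A * 2 ^ (n * m)) := by
  set B := (P.besovNorm α p q b).toReal
  have hB : P.besovNorm α p q b ≤ ENNReal.ofReal B := (ENNReal.ofReal_toReal hb.ne).ge
  obtain ⟨m, hm⟩ := exists_nat_ge |α|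
  have hB0 : 0 ≤ B := ENNReal.toReal_nonneg
  refine ⟨2 ^ m * B, m, by positivity, fun n => ?_⟩
  refine (P.eLpNorm_block_le hq b hB n).trans (ENNReal.ofReal_le_ofReal ?_)
  have h1 : (2 : ℝ) ^ ((1 - (n : ℝ)) * α) ≤ 2 ^ m * 2 ^ (n * m) := by
    rw [← pow_add, ← Real.rpow_natCast]
    refine Real.rpow_le_rpow_of_exponent_le (by norm_num) ?_
    push_cast
    have h2 : (1 - (n : ℝ)) * α ≤ |1 - (n : ℝ)| * |α| := by
      rw [← abs_mul]; exact le_abs_self _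
    have h3 : |1 - (n : ℝ)| ≤ 1 + n := by
      have hn : (0 : ℝ) ≤ n := Nat.cast_nonneg n
      rw [abs_le]; constructor <;> linarith
    calc _ ≤ |1 - (n : ℝ)| * |α| := h2
      _ ≤ (1 + n) * m := by gcongr
      _ = _ := by ring
  calc _ ≤ 2 ^ m * 2 ^ (n * m) * B := by gcongr
    _ = _ := by ring

theorem exists_weight_nearKernel_le (k n : ℕ) :
    ∃ (C : ℝ) (m : ℕ), 0 ≤ C ∧
      ∀ j x, (1 + ‖x‖) ^ k * ‖iteratedFDeriv ℝ n (P.nearKernel j) x‖ ≤ C * 2 ^ (j * m) := by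
  obtain ⟨C, m, hC, h⟩ := P.exists_weight_kernel_le k n
  refine ⟨3 * (C * 2 ^ m), m, by positivity, fun j x => ?_⟩
  have h1 : iteratedFDeriv ℝ n (P.nearKernel j) x =
      ∑ i ∈ near j, iteratedFDeriv ℝ n (P.kernel i) x := by
    have : (P.nearKernel j : Sp d → ℝ) = fun y => ∑ i ∈ near j, P.kernel i y := by
      funext y; simp [nearKernel]
    rw [this]
    exact iteratedFDeriv_fun_sum_apply fun i _ => ((P.kernel i).smooth n).contDiffAt
  have h2 : ∀ i ∈ near j, (1 + ‖x‖) ^ k * ‖iteratedFDeriv ℝ n (P.kernel i) x‖ ≤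
      C * 2 ^ m * 2 ^ (j * m) := fun i hi => by
    refine (h i x).trans ?_
    rw [mul_assoc, ← pow_add]
    refine mul_le_mul_of_nonneg_left (pow_le_pow_right₀ (by norm_num) ?_) hC
    have := (mem_near_le hi).1
    calc i * m ≤ (j + 1) * m := Nat.mul_le_mul_right m this
      _ = m + j * m := by ring
  rw [h1]
  calc _ ≤ (1 + ‖x‖) ^ k * ∑ i ∈ near j, ‖iteratedFDeriv ℝ n (P.kernel i) x‖ := by
        gcongr; exact norm_sum_le _ _
    _ = ∑ i ∈ near j, (1 + ‖x‖) ^ k * ‖iteratedFDeriv ℝ n (P.kernel i) x‖ := Finset.mul_sum _ _ _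
    _ ≤ (near j).card • (C * 2 ^ m * 2 ^ (j * m)) := Finset.sum_le_card_nsmul _ _ _ h2
    _ ≤ 3 * (C * 2 ^ m * 2 ^ (j * m)) := by
      rw [nsmul_eq_mul]
      gcongr
      exact_mod_cast card_near_le j
    _ = _ := by ring

/-- A reproducing formula: `K_n` is the `n`-th block of the fattened kernel. Values of a block
become integrals of that block against a Schwartz function, and differences in `x` fall on this
function. This is what makes the Bernstein bounds work. -/
theorem block_eq_apply_lpBlock (n : ℕ) (b : TempDist d F) (x : Sp d) :
    P.block n b x = b (P.lpBlock n (SchwartzMap.compSubConstCLM ℝ x (P.nearKernel n))) := by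
  rw [block_eq]
  conv_lhs => rw [← P.lpBlock_sum_near_kernel n, ← lpBlock_compSubConstCLM]
  rfl

theorem block_add_sub (n : ℕ) (b : TempDist d F) (x h : Sp d) :
    P.block n b (x + h) - P.block n b x = b (P.lpBlock n (SchwartzMap.compSubConstCLM ℝ x
      (shiftDiff h (P.nearKernel n)))) := by
  rw [block_eq_apply_lpBlock, block_eq_apply_lpBlock, shiftDiff, ← map_sub, ← map_sub]
  congr 2
  ext y
  simp [add_comm x h]

theorem block_second_difference (n : ℕ) (b : TempDist d F) (x h k : Sp d) :
    P.block n b (x + h + k) - P.block n b (x + h) - P.block n b (x + k) + P.block n b x =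
      b (P.lpBlock n (SchwartzMap.compSubConstCLM ℝ x
        (shiftDiff k (shiftDiff h (P.nearKernel n))))) := by
  have e : P.block n b (x + h + k) - P.block n b (x + h) - P.block n b (x + k) + P.block n b x =
      (P.block n b (x + k + h) - P.block n b (x + k)) - (P.block n b (x + h) - P.block n b x) := by
    rw [add_right_comm]; abel
  rw [e, block_add_sub, block_add_sub, shiftDiff, ← map_sub, ← map_sub]
  congr 2
  ext y
  simp [shiftDiff, sub_sub, add_comm x, add_assoc]

variable [CompleteSpace F]

/-- Bernstein-type bounds: the blocks of a Besov distribution have polynomially growing (in the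
frequency) values, first and second differences. -/
theorem exists_block_bounds {α : ℝ} {p q : ℝ≥0∞} (hp : 1 ≤ p) (hq : q ≠ 0) {b : TempDist d F}
    (hb : P.MemBesov α p q b) : ∃ (C : ℝ) (m : ℕ), 0 ≤ C ∧ ∀ n,
      (∀ x, ‖P.block n b x‖ ≤ C * 2 ^ (n * m)) ∧
      (∀ x h, ‖P.block n b (x + h) - P.block n b x‖ ≤ C * 2 ^ (n * m) * ‖h‖) ∧
      ∀ x h k, ‖P.block n b (x + h + k) - P.block n b (x + h) - P.block n b (x + k) +
        P.block n b x‖ ≤ C * 2 ^ (n * m) * (‖h‖ * ‖k‖) := by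
  obtain ⟨A, mA, hA, hbA⟩ := P.exists_eLpNorm_block_le hq hb
  obtain ⟨C₀, m₀, hC₀, hk₀⟩ := P.exists_weight_nearKernel_le (d + 1) 0
  obtain ⟨C₁, m₁, hC₁, hk₁⟩ := P.exists_weight_nearKernel_le (d + 1) 1
  obtain ⟨C₂, m₂, hC₂, hk₂⟩ := P.exists_weight_nearKernel_le (d + 1) 2
  have hW := weightIntegral_nonneg d
  set m := m₀ + m₁ + m₂ with hm
  -- Each difference over a shift of length at most one costs a factor `2^(d + 1)` in the weight;
  -- the second difference costs two.
  set D := 4 ^ (d + 1) * (C₀ + C₁ + C₂) with hD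
  have hD0 : 0 ≤ D := by positivity
  have pow_le : ∀ n m', m' ≤ m → (2 : ℝ) ^ (n * m') ≤ 2 ^ (n * m) := fun n m' h =>
    pow_le_pow_right₀ (by norm_num) (Nat.mul_le_mul_left n h)
  have h21 : (1 : ℝ) ≤ 2 ^ (d + 1) := one_le_pow₀ (by norm_num)
  have h42 : (4 : ℝ) ^ (d + 1) = 2 ^ (d + 1) * 2 ^ (d + 1) := by rw [← mul_pow]; norm_num
  have h24 : (2 : ℝ) ^ (d + 1) ≤ 4 ^ (d + 1) := by rw [h42]; nlinarith
  have w0 : ∀ n y, (1 + ‖y‖) ^ (d + 1) * ‖P.nearKernel n y‖ ≤ D * 2 ^ (n * m) := fun n y => by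
    have := hk₀ n y
    rw [norm_iteratedFDeriv_zero] at this
    refine this.trans ?_
    have h1 := pow_le n m₀ (by omega)
    have h3 : C₀ ≤ D := by rw [hD]; nlinarith
    gcongr
  have w1 : ∀ n h y, ‖h‖ ≤ 1 → (1 + ‖y‖) ^ (d + 1) * ‖shiftDiff h (P.nearKernel n) y‖ ≤
      D * 2 ^ (n * m) * ‖h‖ := fun n h y hh => by
    have := weight_iteratedFDeriv_shiftDiff_le (n := 0) (hk₁ n) hh y
    rw [norm_iteratedFDeriv_zero] at this
    refine this.trans ?_
    have h1 := pow_le n m₁ (by omega)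
    have h3 : 2 ^ (d + 1) * C₁ ≤ D := by
      rw [hD]
      exact mul_le_mul h24 (by linarith) hC₁ (by positivity)
    rw [← mul_assoc]
    gcongr
  have w2 : ∀ n h k y, ‖h‖ ≤ 1 → ‖k‖ ≤ 1 →
      (1 + ‖y‖) ^ (d + 1) * ‖shiftDiff k (shiftDiff h (P.nearKernel n)) y‖ ≤
      D * 2 ^ (n * m) * (‖h‖ * ‖k‖) := fun n h k y hh hk => by
    have := weight_iteratedFDeriv_shiftDiff_le (n := 0)
      (fun x => weight_iteratedFDeriv_shiftDiff_le (n := 1) (hk₂ n) hh x) hk y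
    rw [norm_iteratedFDeriv_zero] at this
    refine this.trans ?_
    have h1 := pow_le n m₂ (by omega)
    have h3 : 4 ^ (d + 1) * C₂ ≤ D := by
      rw [hD]
      gcongr
      linarith
    calc 2 ^ (d + 1) * (2 ^ (d + 1) * (C₂ * 2 ^ (n * m₂)) * ‖h‖) * ‖k‖
        = 4 ^ (d + 1) * C₂ * 2 ^ (n * m₂) * (‖h‖ * ‖k‖) := by rw [h42]; ring
      _ ≤ _ := by gcongr
  have key : ∀ n (ψ : 𝓢(Sp d, ℝ)) (D' : ℝ), (∀ y, (1 + ‖y‖) ^ (d + 1) * ‖ψ y‖ ≤ D') → ∀ x,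
      ‖b (P.lpBlock n (SchwartzMap.compSubConstCLM ℝ x ψ))‖ ≤
        D' * (A * 2 ^ (n * mA) * (1 + weightIntegral d)) := fun n ψ D' hψ x => by
    rw [apply_lpBlock]
    exact norm_integral_smul_le_of_weight (P.continuous_block n b) (by positivity) hp (hbA n) hψ x
  set C := D * (A * (1 + weightIntegral d)) with hC
  have hC0 : 0 ≤ C := by positivity
  have hCn : ∀ n, D * 2 ^ (n * m) * (A * 2 ^ (n * mA) * (1 + weightIntegral d)) =
      C * 2 ^ (n * (m + mA)) := fun n => by rw [hC, mul_add, pow_add]; ring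
  refine ⟨4 * C, m + mA, by positivity, fun n => ?_⟩
  have b0 : ∀ x, ‖P.block n b x‖ ≤ C * 2 ^ (n * (m + mA)) := fun x => by
    rw [block_eq_apply_lpBlock, ← hCn]
    exact key n _ _ (w0 n) x
  have hb' := difference_bounds_of_le_one b0
    (fun x h hh => by
      rw [block_add_sub, ← hCn]
      refine (key n _ _ (fun y => w1 n h y hh) x).trans_eq ?_
      ring)
    (fun x h k hh hk => by
      rw [block_second_difference, ← hCn]
      refine (key n _ _ (fun y => w2 n h k y hh hk) x).trans_eq ?_
      ring)
  have hX : 0 ≤ C * 2 ^ (n * (m + mA)) := by positivity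
  refine ⟨fun x => (b0 x).trans (by linarith), fun x h => (hb'.1 x h).trans ?_,
    fun x h k => (hb'.2 x h k).trans_eq (by ring)⟩
  refine mul_le_mul_of_nonneg_right ?_ (norm_nonneg h)
  linarith

end DyadicPartition

/-! ### Smoothness of `x ↦ ⟨b, ψ(· - x)⟩` from block bounds -/

theorem norm_le_of_tendsto_sum_geometric {F : Type*} [NormedAddCommGroup F] {a : ℕ → F} {l : F}
    {D : ℝ} (ha : ∀ n, ‖a n‖ ≤ D * (1 / 2) ^ n)
    (hl : Tendsto (fun N => ∑ n ∈ Finset.range (N + 1), a n) atTop (𝓝 l)) : ‖l‖ ≤ D * 2 := by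
  have hD : 0 ≤ D := by simpa using (norm_nonneg _).trans (ha 0)
  refine le_of_tendsto hl.norm (Eventually.of_forall fun N => ?_)
  calc ‖∑ n ∈ Finset.range (N + 1), a n‖ ≤ ∑ n ∈ Finset.range (N + 1), D * (1 / 2) ^ n :=
        (norm_sum_le _ _).trans (Finset.sum_le_sum fun n _ => ha n)
    _ = D * ∑ n ∈ Finset.range (N + 1), (1 / 2 : ℝ) ^ n := by rw [Finset.mul_sum]
    _ ≤ D * 2 := mul_le_mul_of_nonneg_left (sum_geometric_two_le _) hD

namespace DyadicPartition

variable {d : ℕ} (P : DyadicPartition d) {F : Type*} [NormedAddCommGroup F] [NormedSpace ℝ F]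

/-- The sum of the blocks of a Schwartz function with frequencies next to `2^n`. -/
def nearBlock (n : ℕ) (ψ : 𝓢(Sp d, ℝ)) : 𝓢(Sp d, ℝ) := ∑ m ∈ near n, P.lpBlock m ψ

theorem nearBlock_compSubConstCLM (n : ℕ) (x : Sp d) (ψ : 𝓢(Sp d, ℝ)) :
    P.nearBlock n (SchwartzMap.compSubConstCLM ℝ x ψ) =
      SchwartzMap.compSubConstCLM ℝ x (P.nearBlock n ψ) := by
  simp only [nearBlock, lpBlock_compSubConstCLM, map_sum]

theorem integrable_nearBlock_smul_block (n : ℕ) (b : TempDist d F) (ψ : 𝓢(Sp d, ℝ)) (x : Sp d) :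
    Integrable fun z => P.nearBlock n ψ z • P.block n b (z + x) := by
  have := (P.integrable_smul_block n b
    (SchwartzMap.compSubConstCLM ℝ x (P.nearBlock n ψ))).comp_add_right x
  refine this.congr (Eventually.of_forall fun z => ?_)
  simp

theorem apply_lpBlock_compSubConstCLM [CompleteSpace F] (n : ℕ) (b : TempDist d F)
    (ψ : 𝓢(Sp d, ℝ)) (x : Sp d) :
    b (P.lpBlock n (SchwartzMap.compSubConstCLM ℝ x ψ)) =
      ∫ z, P.nearBlock n ψ z • P.block n b (z + x) := by
  rw [apply_lpBlock_near, ← nearBlock, nearBlock_compSubConstCLM, ← integral_add_right_eq_self _ x]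
  simp

theorem integral_norm_nearBlock_le {ψ : 𝓢(Sp d, ℝ)} {B : ℝ} {m : ℕ}
    (hψ : ∀ n, ∫ x, ‖P.lpBlock n ψ x‖ ≤ B * (2 ^ (n * m))⁻¹) (n : ℕ) :
    ∫ x, ‖P.nearBlock n ψ x‖ ≤ 3 * 2 ^ m * B * (2 ^ (n * m))⁻¹ := by
  have hB : 0 ≤ B := by
    have := (integral_nonneg fun x => norm_nonneg _).trans (hψ 0)
    simpa using this
  have h1 : ∀ i ∈ near n, ∫ x, ‖P.lpBlock i ψ x‖ ≤ 2 ^ m * B * (2 ^ (n * m))⁻¹ := fun i hi => by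
    refine (hψ i).trans ?_
    have h2 : (2 : ℝ) ^ (n * m) ≤ 2 ^ m * 2 ^ (i * m) := by
      rw [← pow_add]
      refine pow_le_pow_right₀ (by norm_num) ?_
      calc n * m ≤ (i + 1) * m := Nat.mul_le_mul_right m (mem_near_le hi).2
        _ = m + i * m := by ring
    have h3 : ((2 : ℝ) ^ (i * m))⁻¹ ≤ 2 ^ m * (2 ^ (n * m))⁻¹ := by
      rw [← div_eq_mul_inv, le_div_iff₀ (by positivity), inv_mul_le_iff₀ (by positivity)]
      linarith
    calc B * (2 ^ (i * m))⁻¹ ≤ B * (2 ^ m * (2 ^ (n * m))⁻¹) := by gcongr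
      _ = _ := by ring
  have hint : ∀ i ∈ near n, Integrable fun x => ‖P.lpBlock i ψ x‖ := fun i _ =>
    (P.lpBlock i ψ).integrable.norm
  calc ∫ x, ‖P.nearBlock n ψ x‖ ≤ ∫ x, ∑ i ∈ near n, ‖P.lpBlock i ψ x‖ := by
        refine integral_mono (P.nearBlock n ψ).integrable.norm (integrable_finsetSum _ hint)
          fun x => ?_
        simp only [nearBlock, _root_.sum_apply]
        exact norm_sum_le _ _
    _ = ∑ i ∈ near n, ∫ x, ‖P.lpBlock i ψ x‖ := integral_finsetSum _ hint
    _ ≤ (near n).card • (2 ^ m * B * (2 ^ (n * m))⁻¹) := Finset.sum_le_card_nsmul _ _ _ h1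
    _ ≤ 3 * (2 ^ m * B * (2 ^ (n * m))⁻¹) := by
      rw [nsmul_eq_mul]
      gcongr
      exact_mod_cast card_near_le n
    _ = _ := by ring

/-- Decay of order `m + 1` against growth of order `m` leaves the summable factor `2^{-n}`. -/
theorem norm_integral_nearBlock_smul_le {ψ : 𝓢(Sp d, ℝ)} {B C X : ℝ} {m : ℕ}
    (hψ : ∀ n, ∫ x, ‖P.lpBlock n ψ x‖ ≤ B * (2 ^ (n * (m + 1)))⁻¹) (n : ℕ) {V : Sp d → F}
    (hV : ∀ z, ‖V z‖ ≤ C * 2 ^ (n * m) * X) :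
    ‖∫ z, P.nearBlock n ψ z • V z‖ ≤ 3 * 2 ^ (m + 1) * B * C * X * (1 / 2) ^ n := by
  have h0 : 0 ≤ C * 2 ^ (n * m) * X := (norm_nonneg _).trans (hV 0)
  calc ‖∫ z, P.nearBlock n ψ z • V z‖
      ≤ ∫ z, ‖P.nearBlock n ψ z‖ * (C * 2 ^ (n * m) * X) := by
        refine norm_integral_le_of_norm_le
          ((P.nearBlock n ψ).integrable.norm.mul_const _) (Eventually.of_forall fun z => ?_)
        rw [norm_smul]
        exact mul_le_mul_of_nonneg_left (hV z) (norm_nonneg _)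
    _ = (∫ z, ‖P.nearBlock n ψ z‖) * (C * 2 ^ (n * m) * X) := integral_mul_const _ _
    _ ≤ 3 * 2 ^ (m + 1) * B * (2 ^ (n * (m + 1)))⁻¹ * (C * 2 ^ (n * m) * X) :=
        mul_le_mul_of_nonneg_right (P.integral_norm_nearBlock_le hψ n) h0
    _ = _ := by
        rw [mul_add, pow_add, mul_one, one_div, inv_pow]
        field_simp
        ring

/-- If the blocks of `b` grow polynomially in the frequency together with their first and second
differences, and those of `ψ` decay quickly in `L¹`, then `x ↦ ⟨b, ψ(· - x)⟩` has bounded values,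
first and second differences. -/
theorem apply_compSubConstCLM_bounds [CompleteSpace F] {b : TempDist d F} {C : ℝ} {m : ℕ}
    (hb : ∀ n, (∀ x, ‖P.block n b x‖ ≤ C * 2 ^ (n * m)) ∧
      (∀ x h, ‖P.block n b (x + h) - P.block n b x‖ ≤ C * 2 ^ (n * m) * ‖h‖) ∧
      ∀ x h k, ‖P.block n b (x + h + k) - P.block n b (x + h) - P.block n b (x + k) +
        P.block n b x‖ ≤ C * 2 ^ (n * m) * (‖h‖ * ‖k‖))
    {ψ : 𝓢(Sp d, ℝ)} {B : ℝ} (hψ : ∀ n, ∫ x, ‖P.lpBlock n ψ x‖ ≤ B * (2 ^ (n * (m + 1)))⁻¹)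
    {f : Sp d → F} (hf : ∀ x, f x = b (SchwartzMap.compSubConstCLM ℝ x ψ)) :
    (∀ x, ‖f x‖ ≤ 6 * 2 ^ (m + 1) * C * B) ∧
    (∀ x h, ‖f (x + h) - f x‖ ≤ 6 * 2 ^ (m + 1) * C * B * ‖h‖) ∧
    ∀ x h k, ‖f (x + h + k) - f (x + h) - f (x + k) + f x‖ ≤
      6 * 2 ^ (m + 1) * C * B * (‖h‖ * ‖k‖) := by
  -- The translation is carried by the blocks of `b` only, so differences of `f` are series with
  -- differences of these blocks.
  have hlim : ∀ x, Tendsto (fun N => ∑ n ∈ Finset.range (N + 1),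
      ∫ z, P.nearBlock n ψ z • P.block n b (z + x)) atTop (𝓝 (f x)) := fun x => by
    rw [hf]
    simpa only [apply_lpBlock_compSubConstCLM] using
      P.tendsto_sum_apply_lpBlock b (SchwartzMap.compSubConstCLM ℝ x ψ)
  have hint := fun n x => P.integrable_nearBlock_smul_block n b ψ x
  refine ⟨fun x => ?_, fun x h => ?_, fun x h k => ?_⟩
  · refine (norm_le_of_tendsto_sum_geometric (D := 3 * 2 ^ (m + 1) * B * C * 1)
      (fun n => ?_) (hlim x)).trans_eq (by ring)
    exact P.norm_integral_nearBlock_smul_le hψ n fun z => by rw [mul_one]; exact (hb n).1 _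
  · refine (norm_le_of_tendsto_sum_geometric (D := 3 * 2 ^ (m + 1) * B * C * ‖h‖)
      (a := fun n => ∫ z, P.nearBlock n ψ z • (P.block n b (z + x + h) - P.block n b (z + x)))
      (fun n => P.norm_integral_nearBlock_smul_le hψ n fun z => (hb n).2.1 _ _) ?_).trans_eq
      (by ring)
    refine ((hlim (x + h)).sub (hlim x)).congr fun N => ?_
    rw [← Finset.sum_sub_distrib]
    refine Finset.sum_congr rfl fun n _ => ?_
    rw [← integral_sub (hint n _) (hint n _)]
    simp only [smul_sub, add_assoc]
  · refine (norm_le_of_tendsto_sum_geometric (D := 3 * 2 ^ (m + 1) * B * C * (‖h‖ * ‖k‖))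
      (a := fun n => ∫ z, P.nearBlock n ψ z • (P.block n b (z + x + h + k) -
        P.block n b (z + x + h) - P.block n b (z + x + k) + P.block n b (z + x)))
      (fun n => P.norm_integral_nearBlock_smul_le hψ n fun z => (hb n).2.2 _ _ _) ?_).trans_eq
      (by ring)
    refine ((((hlim (x + h + k)).sub (hlim (x + h))).sub (hlim (x + k))).add (hlim x)).congr
      fun N => ?_
    rw [← Finset.sum_sub_distrib, ← Finset.sum_sub_distrib, ← Finset.sum_add_distrib]
    refine Finset.sum_congr rfl fun n _ => ?_
    have I₁ : Integrable fun z => P.nearBlock n ψ z • P.block n b (z + (x + h + k)) -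
        P.nearBlock n ψ z • P.block n b (z + (x + h)) := (hint n _).sub (hint n _)
    have I₂ : Integrable fun z => P.nearBlock n ψ z • P.block n b (z + (x + h + k)) -
        P.nearBlock n ψ z • P.block n b (z + (x + h)) -
        P.nearBlock n ψ z • P.block n b (z + (x + k)) := I₁.sub (hint n _)
    rw [← integral_sub (hint n _) (hint n _), ← integral_sub I₁ (hint n _),
      ← integral_add I₂ (hint n _)]
    simp only [smul_sub, smul_add, add_assoc]

end DyadicPartition

/-! ### `L¹` bounds for blocks of compactly supported functions -/

namespace DyadicPartition

variable {d : ℕ} (P : DyadicPartition d)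

/-- The block `K_{n-1} * g` of an integrable function. -/
def blockFun (n : ℕ) (g : Sp d → ℝ) (x : Sp d) : ℝ := ∫ z, g z * P.kernel n (x - z)

theorem lpBlock_eq_blockFun (n : ℕ) (φ : 𝓢(Sp d, ℝ)) : (P.lpBlock n φ : Sp d → ℝ) =
    P.blockFun n φ := funext fun x => P.lpBlock_apply n φ x

variable {P} {g : Sp d → ℝ}

theorem integrable_mul_kernel (n : ℕ) (hg : Integrable g) (x : Sp d) :
    Integrable fun z => g z * P.kernel n (x - z) := by
  obtain ⟨C, hC, h⟩ := exists_weight_iteratedFDeriv_le (P.kernel n) 0 0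
  refine hg.mul_bdd (c := C) (by fun_prop) (Eventually.of_forall fun z => ?_)
  simpa [norm_iteratedFDeriv_zero] using h (x - z)

theorem continuous_blockFun (n : ℕ) (hg : Integrable g) : Continuous (P.blockFun n g) := by
  obtain ⟨C, hC, h⟩ := exists_weight_iteratedFDeriv_le (P.kernel n) 0 0
  refine continuous_of_dominated (bound := fun z => ‖g z‖ * C)
    (fun x => (integrable_mul_kernel n hg x).aestronglyMeasurable)
    (fun x => Eventually.of_forall fun z => ?_) (hg.norm.mul_const _)
    (Eventually.of_forall fun z => by fun_prop)
  rw [norm_mul]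
  gcongr
  simpa [norm_iteratedFDeriv_zero] using h (x - z)

variable (P)

/-- The blocks of a compactly supported integrable function are bounded in `L¹` by the geometric
mean of their supremum and the `L¹` norm of the function. -/
theorem exists_integral_norm_blockFun_le (R : ℝ) (hR : 0 ≤ R) : ∃ (C : ℝ) (m : ℕ), 0 ≤ C ∧
    ∀ (n : ℕ) (g : Sp d → ℝ) (A B : ℝ), Integrable g → (∀ᵐ z, R < ‖z‖ → g z = 0) →
      ∫ z, ‖g z‖ ≤ B → (∀ x, ‖P.blockFun n g x‖ ≤ A) →
      Integrable (P.blockFun n g) ∧ ∫ x, ‖P.blockFun n g x‖ ≤ C * 2 ^ (n * m) * √(A * B) := by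
  -- The weight has twice the integrable power, because taking a geometric mean halves it.
  obtain ⟨C, m, hC, h⟩ := P.exists_weight_kernel_le (2 * (d + 1)) 0
  have hW := weightIntegral_nonneg d
  set C' := C * (1 + R) ^ (2 * (d + 1)) with hC'
  have hC'0 : 0 ≤ C' := by positivity
  refine ⟨(1 + C') * weightIntegral d, m, by positivity, fun n g A B hg hsupp hB hA => ?_⟩
  have hA0 : 0 ≤ A := (norm_nonneg _).trans (hA 0)
  have hB0 : 0 ≤ B := (integral_nonneg fun _ => norm_nonneg _).trans hB
  have h1 : ∀ x, (1 + ‖x‖) ^ (2 * (d + 1)) * ‖P.blockFun n g x‖ ≤ C' * 2 ^ (n * m) * B :=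
    fun x => by
    calc (1 + ‖x‖) ^ (2 * (d + 1)) * ‖P.blockFun n g x‖
        = ‖∫ z, (1 + ‖x‖) ^ (2 * (d + 1)) * (g z * P.kernel n (x - z))‖ := by
          rw [integral_const_mul, norm_mul,
            Real.norm_of_nonneg (by positivity : 0 ≤ (1 + ‖x‖) ^ (2 * (d + 1))), blockFun]
      _ ≤ ∫ z, C' * 2 ^ (n * m) * ‖g z‖ := by
          refine norm_integral_le_of_norm_le (hg.norm.const_mul _) ?_
          filter_upwards [hsupp] with z hz
          by_cases hzR : R < ‖z‖
          · rw [hz hzR]; simp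
          · have h2 := h n (x - z)
            rw [norm_iteratedFDeriv_zero] at h2
            have h3 : (1 + ‖x‖) ≤ (1 + R) * (1 + ‖x - z‖) := by
              have := norm_le_norm_sub_add x z
              nlinarith [norm_nonneg (x - z)]
            rw [norm_mul, norm_mul,
              Real.norm_of_nonneg (by positivity : 0 ≤ (1 + ‖x‖) ^ (2 * (d + 1)))]
            calc (1 + ‖x‖) ^ (2 * (d + 1)) * (‖g z‖ * ‖P.kernel n (x - z)‖)
                ≤ ((1 + R) * (1 + ‖x - z‖)) ^ (2 * (d + 1)) *
                  (‖g z‖ * ‖P.kernel n (x - z)‖) := by gcongr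
              _ = (1 + R) ^ (2 * (d + 1)) * ((1 + ‖x - z‖) ^ (2 * (d + 1)) *
                  ‖P.kernel n (x - z)‖) * ‖g z‖ := by rw [mul_pow]; ring
              _ ≤ (1 + R) ^ (2 * (d + 1)) * (C * 2 ^ (n * m)) * ‖g z‖ := by gcongr
              _ = _ := by rw [hC']; ring
      _ = C' * 2 ^ (n * m) * ∫ z, ‖g z‖ := integral_const_mul _ _
      _ ≤ _ := by gcongr
  -- Geometric mean of the weighted bound `h1` and the supremum bound `A`. Since `(1 + C') * 2^(n *
  -- m) ≥ 1`, its square may be used in place of the factor itself.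
  have h2 : ∀ x, (1 + ‖x‖) ^ (d + 1) * ‖P.blockFun n g x‖ ≤
      (1 + C') * 2 ^ (n * m) * √(A * B) := fun x => by
    have hp : (1 : ℝ) ≤ 2 ^ (n * m) := one_le_pow₀ (by norm_num)
    refine abs_le_of_sq_le_sq' ?_ (by positivity) |>.2
    calc ((1 + ‖x‖) ^ (d + 1) * ‖P.blockFun n g x‖) ^ 2
        = ((1 + ‖x‖) ^ (2 * (d + 1)) * ‖P.blockFun n g x‖) * ‖P.blockFun n g x‖ := by ring
      _ ≤ (C' * 2 ^ (n * m) * B) * A := mul_le_mul (h1 x) (hA x) (norm_nonneg _) (by positivity)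
      _ = (C' * 2 ^ (n * m)) * (A * B) := by ring
      _ ≤ ((1 + C') * 2 ^ (n * m)) ^ 2 * (A * B) := by
          gcongr
          have h4 : C' * 2 ^ (n * m) ≤ (1 + C') * 2 ^ (n * m) := by gcongr; linarith
          have h5 : 1 ≤ (1 + C') * 2 ^ (n * m) := by nlinarith
          nlinarith
      _ = ((1 + C') * 2 ^ (n * m) * √(A * B)) ^ 2 := by
          rw [mul_pow _ (√(A * B)), Real.sq_sqrt (by positivity)]
  refine ⟨integrable_of_weight (continuous_blockFun n hg).aestronglyMeasurable h2,
    (integral_norm_le_of_weight h2).trans_eq (by ring)⟩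

end DyadicPartition

/-! ### Local times -/

section LocalTime

variable {d : ℕ} {T : ℝ} {w : ℝ → Sp d} {L : ℝ → Sp d → ℝ}

theorem occupation_univ {t : ℝ} : occupation w t univ = ENNReal.ofReal t := by
  have : {r : ℝ | r ∈ Icc 0 t ∧ w r ∈ (univ : Set (Sp d))} = Icc 0 t := by ext; simp
  rw [occupation, this, Real.volume_Icc, sub_zero]

theorem occupation_mono {s t : ℝ} (hst : s ≤ t) (A : Set (Sp d)) :
    occupation w s A ≤ occupation w t A :=
  measure_mono fun _ hr => ⟨⟨hr.1.1, hr.1.2.trans hst⟩, hr.2⟩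

/-- `g` is a density of the occupation measure of `w` at time `t`. -/
structure IsOccupationDensity (w : ℝ → Sp d) (t : ℝ) (g : Sp d → ℝ) : Prop where
  measurable : Measurable g
  nonneg : ∀ z, 0 ≤ g z
  density : ∀ A, MeasurableSet A → occupation w t A = ∫⁻ z in A, ENNReal.ofReal (g z)

theorem IsLocalTime.isOccupationDensity (hL : IsLocalTime T w L) {t : ℝ} (ht : t ∈ Icc 0 T) :
    IsOccupationDensity w t (L t) :=
  ⟨hL.measurable.comp (measurable_const.prodMk measurable_id : Measurable fun z : Sp d =>
    ((⟨t, ht⟩ : Icc (0 : ℝ) T), z)), hL.nonneg t ht, hL.density t ht⟩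

theorem IsSmoothLocalTimeAt.isOccupationDensity {t : ℝ} {ψ : 𝓢(Sp d, ℝ)}
    (h : IsSmoothLocalTimeAt w t ψ) : IsOccupationDensity w t ψ :=
  ⟨ψ.continuous.measurable, h.1, h.2⟩

namespace IsOccupationDensity

variable {s t : ℝ} {f g : Sp d → ℝ}

theorem lintegral_eq (hg : IsOccupationDensity w t g) :
    ∫⁻ z, ENNReal.ofReal (g z) = ENNReal.ofReal t := by
  rw [← occupation_univ (w := w), hg.density univ MeasurableSet.univ, Measure.restrict_univ]

theorem integrable (hg : IsOccupationDensity w t g) : Integrable g := by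
  refine ⟨hg.measurable.aestronglyMeasurable, ?_⟩
  rw [hasFiniteIntegral_iff_ofReal (Eventually.of_forall hg.nonneg), hg.lintegral_eq]
  exact ENNReal.ofReal_lt_top

theorem integral_eq (hg : IsOccupationDensity w t g) (ht : 0 ≤ t) : ∫ z, g z = t := by
  rw [integral_eq_lintegral_of_nonneg_ae (Eventually.of_forall hg.nonneg)
    hg.measurable.aestronglyMeasurable, hg.lintegral_eq, ENNReal.toReal_ofReal ht]

theorem ae_le (hf : IsOccupationDensity w s f) (hg : IsOccupationDensity w t g) (hst : s ≤ t) :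
    f ≤ᵐ[volume] g := by
  refine ae_le_of_forall_setIntegral_le hf.integrable hg.integrable fun A hA _ => ?_
  rw [integral_eq_lintegral_of_nonneg_ae (Eventually.of_forall hf.nonneg)
      hf.measurable.aestronglyMeasurable,
    integral_eq_lintegral_of_nonneg_ae (Eventually.of_forall hg.nonneg)
      hg.measurable.aestronglyMeasurable, ← hf.density A hA, ← hg.density A hA]
  refine ENNReal.toReal_mono ?_ (occupation_mono hst A)
  refine ((measure_mono (fun r hr => hr.1 : _ ⊆ Icc 0 t)).trans_lt ?_).ne
  simp

theorem ae_eq (hf : IsOccupationDensity w t f) (hg : IsOccupationDensity w t g) :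
    f =ᵐ[volume] g := (hf.ae_le hg le_rfl).antisymm (hg.ae_le hf le_rfl)

theorem ae_eq_zero (hg : IsOccupationDensity w t g) {A : Set (Sp d)} (hA : MeasurableSet A)
    (hw : ∀ r ∈ Icc 0 t, w r ∉ A) : ∀ᵐ z, z ∈ A → g z = 0 := by
  have h1 : occupation w t A = 0 := by
    have : {r | r ∈ Icc 0 t ∧ w r ∈ A} = ∅ := by
      ext r; simpa using fun h1 h2 => hw r ⟨h1, h2⟩
    rw [occupation, this, measure_empty]
  rw [hg.density A hA, setLIntegral_eq_zero_iff hA hg.measurable.ennreal_ofReal] at h1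
  filter_upwards [h1] with z hz hzA
  exact le_antisymm (ENNReal.ofReal_eq_zero.1 (hz hzA)) (hg.nonneg z)

/-- The increment is nonnegative almost everywhere and its mass is the elapsed time. This full power
of `t - s` is what lets the interpolated time exponent approach `1`. -/
theorem integral_norm_sub (hf : IsOccupationDensity w s f) (hg : IsOccupationDensity w t g)
    (hs : 0 ≤ s) (hst : s ≤ t) : ∫ z, ‖g z - f z‖ = t - s := by
  have : ∫ z, ‖g z - f z‖ = ∫ z, (g z - f z) := by
    refine integral_congr_ae ?_
    filter_upwards [hf.ae_le hg hst] with z hz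
    exact Real.norm_of_nonneg (sub_nonneg.2 hz)
  rw [this, integral_sub hg.integrable hf.integrable, hg.integral_eq (hs.trans hst),
    hf.integral_eq hs]

end IsOccupationDensity

/-- The blocks of a local time in `C^γ([0,T], 𝒞^α)`. -/
theorem MemHolderBesov.exists_norm_blockFun_le {P : DyadicPartition d} {γ α : ℝ}
    (hL : IsLocalTime T w L) (h : MemHolderBesov P T γ α L) : ∃ C : ℝ, 0 ≤ C ∧
      ∀ s ∈ Icc 0 T, ∀ t ∈ Icc 0 T, ∀ n x, ‖P.blockFun n (fun z => L t z - L s z) x‖ ≤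
        2 ^ ((1 - (n : ℝ)) * α) * (C * |t - s| ^ γ) := by
  obtain ⟨Λ, hΛ, -, C, hC⟩ := h
  refine ⟨C, C.2, fun s hs t ht n => ?_⟩
  have hblock : P.block n (Λ t - Λ s) = P.blockFun n (fun z => L t z - L s z) := by
    funext x
    rw [P.block_eq, sub_apply, (hΛ t ht _).2, (hΛ s hs _).2,
      ← integral_sub (hΛ t ht _).1 (hΛ s hs _).1]
    refine integral_congr_ae (Eventually.of_forall fun z => ?_)
    simp only [SchwartzMap.compSubConstCLM_apply]
    rw [← P.kernel_neg n (z - x), neg_sub]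
    ring
  have h1 := P.eLpNorm_block_le (α := α) (p := ⊤) (q := ⊤) (by simp) (Λ t - Λ s)
    (B := C * |t - s| ^ γ) (by
      rw [ENNReal.ofReal_mul (NNReal.coe_nonneg C), ENNReal.ofReal_coe_nnreal]
      exact hC s hs t ht) n
  rw [eLpNorm_exponent_top, hblock] at h1
  have h2 : ∀ᵐ x, ‖P.blockFun n (fun z => L t z - L s z) x‖ ≤
      2 ^ ((1 - (n : ℝ)) * α) * (C * |t - s| ^ γ) := by
    filter_upwards [ae_le_eLpNormEssSup (f := P.blockFun n (fun z => L t z - L s z))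
      (μ := volume)] with x hx
    have h3 := hx.trans h1
    rw [← ofReal_norm] at h3
    exact (ENNReal.ofReal_le_ofReal_iff (by positivity)).1 h3
  have hcont : Continuous (P.blockFun n (fun z => L t z - L s z)) :=
    DyadicPartition.continuous_blockFun n ((hL.isOccupationDensity ht).integrable.sub
      (hL.isOccupationDensity hs).integrable)
  -- The block is continuous and the bound holds on a dense set, so it holds everywhere.
  exact fun x => (isClosed_le hcont.norm continuous_const).closure_subset_iff.2 (fun _ h => h)
    (Measure.dense_of_ae h2 x)

end LocalTime

/-! ### The smooth version of an integrable function with decaying blocks -/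

section FourierDecay

variable {d : ℕ}

theorem continuous_fourier_of_integrable {f : Sp d → ℂ} (hf : Integrable f) : Continuous (𝓕 f) :=
  VectorFourier.fourierIntegral_continuous Real.continuous_fourierChar
    (by exact continuous_inner) hf

theorem integral_fourier_smul_eq_of_integrable {f g : Sp d → ℂ} (hf : Integrable f)
    (hg : Integrable g) : ∫ ξ, 𝓕 f ξ • g ξ = ∫ x, f x • 𝓕 g x := by
  have h := VectorFourier.integral_fourierIntegral_smul_eq_flip (L := innerₗ (Sp d))
      (μ := volume) (ν := volume) Real.continuous_fourierChar (by exact continuous_inner) hf hg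
  rwa [flip_innerₗ] at h

theorem integral_fourierInv_smul_eq_of_integrable {f g : Sp d → ℂ} (hf : Integrable f)
    (hg : Integrable g) : ∫ ξ, 𝓕⁻ f ξ • g ξ = ∫ x, f x • 𝓕⁻ g x := by
  have h := VectorFourier.integral_fourierIntegral_smul_eq_flip (L := -innerₗ (Sp d))
      (μ := volume) (ν := volume) Real.continuous_fourierChar (by exact continuous_inner.neg) hf hg
  have hL : (-innerₗ (Sp d)).flip = -innerₗ (Sp d) := by
    ext x y; simp [real_inner_comm]
  rwa [hL] at h

/-- An integrable function with rapidly decaying Fourier transform has a smooth version. -/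
theorem exists_contDiff_ae_eq_of_fourier_decay {g : Sp d → ℝ} (hg : Integrable g)
    (hdecay : ∀ k : ℕ, ∃ C : ℝ, ∀ ξ, (1 + ‖ξ‖) ^ k * ‖𝓕 (fun z => (g z : ℂ)) ξ‖ ≤ C) :
    ∃ G : Sp d → ℝ, ContDiff ℝ ∞ G ∧ g =ᵐ[volume] G := by
  set gC : Sp d → ℂ := fun z => (g z : ℂ) with hgC
  have hgCi : Integrable gC := hg.ofReal
  have hcont : Continuous (𝓕 gC) := continuous_fourier_of_integrable hgCi
  have hint : ∀ n : ℕ, Integrable fun v => ‖v‖ ^ n * ‖𝓕 gC v‖ := fun n => by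
    obtain ⟨C, hC⟩ := hdecay (d + 1 + n)
    refine integrable_of_weight (C := C) (by fun_prop) fun ξ => le_trans ?_ (hC ξ)
    rw [norm_mul, norm_norm, Real.norm_of_nonneg (by positivity), pow_add _ (d + 1) n, ← mul_assoc]
    gcongr
    linarith
  have hFi : Integrable (𝓕 gC) := by
    rw [← integrable_norm_iff hcont.aestronglyMeasurable]
    simpa using hint 0
  have hsm : ContDiff ℝ ∞ (𝓕⁻ (𝓕 gC)) := by
    have h1 : ContDiff ℝ ∞ (𝓕 (𝓕 gC)) := Real.contDiff_fourier fun n _ => hint n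
    have h2 : 𝓕⁻ (𝓕 gC) = fun x => 𝓕 (𝓕 gC) (-x) :=
      funext fun x => Real.fourierInv_eq_fourier_neg _ x
    rw [h2]
    exact h1.comp contDiff_neg
  have hG : ContDiff ℝ ∞ fun x => (𝓕⁻ (𝓕 gC) x).re := Complex.reCLM.contDiff.comp hsm
  -- The real part of `𝓕⁻ (𝓕 g)` is identified with `g` by testing: against a test function, both
  -- transforms are moved onto the latter, where they cancel.
  refine ⟨_, hG, ae_eq_of_integral_contDiff_smul_eq hg.locallyIntegrable
    hG.continuous.locallyIntegrable fun φ hφ hφc => ?_⟩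
  obtain ⟨φC, hφCx⟩ : ∃ φC : 𝓢(Sp d, ℂ), ∀ x, φC x = (φ x : ℂ) :=
    ⟨toComplex (hφc.toSchwartzMap hφ), fun x => rfl⟩
  have e1 : ∫ ξ, (𝓕⁻ φC) ξ • 𝓕 gC ξ = ∫ x, φC x • 𝓕⁻ (𝓕 gC) x := by
    rw [SchwartzMap.fourierInv_coe]
    exact integral_fourierInv_smul_eq_of_integrable φC.integrable hFi
  have e2 : ∫ ξ, (𝓕 (𝓕⁻ φC)) ξ • gC ξ = ∫ x, (𝓕⁻ φC) x • 𝓕 gC x := by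
    rw [SchwartzMap.fourier_coe]
    exact integral_fourier_smul_eq_of_integrable (𝓕⁻ φC).integrable hgCi
  rw [FourierTransform.fourier_fourierInv_eq, e1] at e2
  have hsupp : HasCompactSupport fun x => (φ x : ℂ) :=
    hφc.comp_left (g := fun r : ℝ => (r : ℂ)) Complex.ofReal_zero
  have hint1 : Integrable fun x => φC x • 𝓕⁻ (𝓕 gC) x := by
    refine Continuous.integrable_of_hasCompactSupport (φC.continuous.smul hsm.continuous) ?_
    simp only [hφCx]
    exact hsupp.smul_right
  have e3 : ∫ x, φ x • (𝓕⁻ (𝓕 gC) x).re = (∫ x, φC x • 𝓕⁻ (𝓕 gC) x).re := by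
    rw [← Complex.reCLM_apply, ← ContinuousLinearMap.integral_comp_comm _ hint1]
    refine integral_congr_ae (Eventually.of_forall fun x => ?_)
    simp [hφCx]
  rw [e3, ← e2]
  have e4 : ∀ x, φC x • gC x = ((φ x • g x : ℝ) : ℂ) := fun x => by simp [hφCx, hgC]
  simp only [e4]
  rw [integral_complex_ofReal, Complex.ofReal_re]

namespace DyadicPartition

variable (P : DyadicPartition d)

theorem fourier_blockFun (n : ℕ) {g : Sp d → ℝ} (hg : Integrable g) (ξ : Sp d) :
    𝓕 (fun x => (P.blockFun n g x : ℂ)) ξ =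
      P.symbolSchwartz n ξ * 𝓕 (fun z => (g z : ℂ)) ξ := by
  have h1 : (fun x => (P.blockFun n g x : ℂ)) =
      convolution (fun z => (g z : ℂ)) (toComplex (P.kernel n)) (ContinuousLinearMap.mul ℂ ℂ)
        volume := by
    funext x
    rw [blockFun, ← integral_complex_ofReal, convolution]
    refine integral_congr_ae (Eventually.of_forall fun z => ?_)
    simp
  have h2 := Real.fourier_mul_convolution_eq (f₁ := fun z => (g z : ℂ)) hg.ofReal
    (toComplex (P.kernel n)).integrable ξ
  rw [h1, h2, ← SchwartzMap.fourier_coe, fourier_toComplex_kernel, mul_comm]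

theorem norm_le_of_symbol_ne_zero {n : ℕ} {x : Sp d} (h : P.symbol n x ≠ 0) :
    ‖x‖ ≤ (P.b + P.c) * 2 ^ n := by
  have hb := P.b_pos
  have hc := P.c_pos
  cases n with
  | zero =>
    have := P.χ_supp (subset_tsupport _ h)
    simp only [mem_ofPred_eq] at this
    rw [pow_zero]; linarith
  | succ j =>
    have := (P.ρ_supp (subset_tsupport P.ρ h)).2
    rw [norm_smul, Real.norm_of_nonneg (by positivity), inv_mul_le_iff₀ (by positivity)] at this
    have h2 : (0 : ℝ) < 2 ^ j := by positivity
    rw [pow_succ]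
    nlinarith

/-- The Fourier transform of a block is bounded by its `L¹` norm, and `1 + ‖ξ‖` is at most a
multiple of `2^n` where the `n`-th symbol is nonzero. One order of decay beyond `k` makes the sum
over the blocks converge. -/
theorem fourier_decay_of_blockFun {g : Sp d → ℝ} (hg : Integrable g)
    (h : ∀ N : ℕ, ∃ C : ℝ, ∀ n, ∫ x, ‖P.blockFun n g x‖ ≤ C * (2 ^ (n * N))⁻¹) (k : ℕ) :
    ∃ C : ℝ, ∀ ξ, (1 + ‖ξ‖) ^ k * ‖𝓕 (fun z => (g z : ℂ)) ξ‖ ≤ C := by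
  obtain ⟨C, hC⟩ := h (k + 1)
  have hb := P.b_pos
  have hc := P.c_pos
  set D := 1 + (P.b + P.c) with hD
  refine ⟨D ^ k * C * 2, fun ξ => ?_⟩
  set G := 𝓕 (fun z => (g z : ℂ)) ξ with hG
  have hterm : ∀ n, ‖((1 + ‖ξ‖) ^ k : ℝ) • (P.symbolSchwartz n ξ * G)‖ ≤
      D ^ k * C * (1 / 2) ^ n := fun n => by
    have hC0 : 0 ≤ C := by
      have := (integral_nonneg fun x => norm_nonneg _).trans (hC 0)
      simpa using this
    have h1 : ‖P.symbolSchwartz n ξ * G‖ ≤ C * (2 ^ (n * (k + 1)))⁻¹ := by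
      rw [hG, ← fourier_blockFun P n hg]
      refine (VectorFourier.norm_fourierIntegral_le_integral_norm _ _ _ _ _).trans ?_
      simpa using hC n
    rw [norm_smul, Real.norm_of_nonneg (by positivity)]
    by_cases hs : P.symbol n ((2 * Real.pi) • ξ) = 0
    · rw [symbolSchwartz_apply, hs]
      simp only [Complex.ofReal_zero, zero_mul, norm_zero, mul_zero]
      positivity
    · have h2 := P.norm_le_of_symbol_ne_zero hs
      rw [norm_smul, Real.norm_of_nonneg (by positivity)] at h2
      have h3 : 1 + ‖ξ‖ ≤ D * 2 ^ n := by
        have h4 : (1 : ℝ) ≤ 2 ^ n := one_le_pow₀ (by norm_num)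
        have h5 : ‖ξ‖ ≤ 2 * Real.pi * ‖ξ‖ :=
          le_mul_of_one_le_left (norm_nonneg _) (by linarith [Real.pi_gt_three])
        rw [hD]; linarith
      calc (1 + ‖ξ‖) ^ k * ‖P.symbolSchwartz n ξ * G‖
          ≤ (D * 2 ^ n) ^ k * (C * (2 ^ (n * (k + 1)))⁻¹) := by gcongr
        _ = D ^ k * C * (1 / 2) ^ n := by
          rw [mul_pow, ← pow_mul, mul_add, pow_add, mul_one, one_div, inv_pow]
          field_simp
  have hlim : Tendsto (fun N => ∑ n ∈ Finset.range (N + 1),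
      ((1 + ‖ξ‖) ^ k : ℝ) • (P.symbolSchwartz n ξ * G)) atTop (𝓝 (((1 + ‖ξ‖) ^ k : ℝ) • G)) := by
    obtain ⟨N₀, hN₀⟩ := P.exists_sum_symbol_eq_one ((2 * Real.pi) • ξ)
    refine tendsto_const_nhds.congr' ?_
    filter_upwards [eventually_ge_atTop N₀] with N hN
    rw [← Finset.smul_sum, ← Finset.sum_mul]
    simp only [symbolSchwartz_apply]
    rw [← Complex.ofReal_sum, hN₀ N hN, Complex.ofReal_one, one_mul]
  have := norm_le_of_tendsto_sum_geometric hterm hlim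
  rwa [norm_smul, Real.norm_of_nonneg (by positivity)] at this

end DyadicPartition

end FourierDecay

/-! ### Smoothness of the averaging operator of an infinitely regularizing path -/

section Regularizing

variable {d : ℕ} {P : DyadicPartition d} {T : ℝ} {w : ℝ → Sp d} {L : ℝ → Sp d → ℝ}

theorem blockFun_congr_ae {n : ℕ} {f g : Sp d → ℝ} (h : f =ᵐ[volume] g) :
    P.blockFun n f = P.blockFun n g := by
  funext x
  refine integral_congr_ae ?_
  filter_upwards [h] with z hz
  rw [hz]

/-- Increments of the local time have rapidly decaying blocks in `L¹`. -/
theorem IsLocalTime.exists_integral_norm_blockFun_le (hw : ContinuousOn w (Icc 0 T))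
    (hL : IsLocalTime T w L) {γ : ℝ} (hγ : 0 < γ) (h : ∀ α : ℝ, MemHolderBesov P T γ α L) (N : ℕ) :
    ∃ C : ℝ, 0 ≤ C ∧ ∀ s t, 0 ≤ s → s ≤ t → t ≤ T → ∀ n,
      ∫ x, ‖P.blockFun n (fun z => L t z - L s z) x‖ ≤
        C * (t - s) ^ ((1 + γ) / 2) * (2 ^ (n * N))⁻¹ := by
  obtain ⟨R, hR⟩ := (isCompact_Icc.image_of_continuousOn hw).isBounded.exists_norm_le
  obtain ⟨C₁, m, hC₁, h₁⟩ := P.exists_integral_norm_blockFun_le |R| (abs_nonneg R)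
  -- In this exponent, `m` compensates the growth in the interpolation bound and the factor `2` its
  -- square root.
  obtain ⟨C₂, hC₂, h₂⟩ := (h (2 * (N + m : ℕ))).exists_norm_blockFun_le hL
  refine ⟨C₁ * 2 ^ (N + m) * √C₂, by positivity, fun s t hs hst ht n => ?_⟩
  have hsT : s ∈ Icc 0 T := ⟨hs, hst.trans ht⟩
  have htT : t ∈ Icc 0 T := ⟨hs.trans hst, ht⟩
  have hds := hL.isOccupationDensity hsT
  have hdt := hL.isOccupationDensity htT
  have hzero : ∀ r ∈ Icc 0 T, ∀ᵐ z, |R| < ‖z‖ → L r z = 0 := fun r hr =>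
    (hL.isOccupationDensity hr).ae_eq_zero (A := {z | |R| < ‖z‖})
      (isOpen_lt continuous_const continuous_norm).measurableSet fun u hu hmem =>
        absurd ((hR _ ⟨u, ⟨hu.1, hu.2.trans hr.2⟩, rfl⟩).trans (le_abs_self R)) (not_le.2 hmem)
  have hts : 0 ≤ t - s := sub_nonneg.2 hst
  refine (h₁ n _ _ (t - s) (hdt.integrable.sub hds.integrable) ?_
    (hds.integral_norm_sub hdt hs hst).le (h₂ s hsT t htT n)).2.trans_eq ?_
  · filter_upwards [hzero t htT, hzero s hsT] with z h1 h2 hz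
    simp [h1 hz, h2 hz]
  · have e1 : (2 : ℝ) ^ ((1 - (n : ℝ)) * (2 * (N + m : ℕ))) =
        (2 ^ (N + m) * (2 ^ (n * (N + m)))⁻¹) ^ 2 := by
      have e : (1 - (n : ℝ)) * (2 * (N + m : ℕ)) =
          (2 * (N + m) : ℕ) - (n * (N + m) * 2 : ℕ) := by
        push_cast; ring
      rw [e, Real.rpow_sub (by norm_num), Real.rpow_natCast, Real.rpow_natCast, mul_pow, inv_pow,
        ← pow_mul, ← pow_mul, div_eq_mul_inv, mul_comm 2]
    have e2 : (t - s) ^ γ * (t - s) = ((t - s) ^ ((1 + γ) / 2)) ^ 2 := by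
      rw [← Real.rpow_mul_natCast hts, ← Real.rpow_add_one' hts (by linarith)]
      congr 1
      push_cast
      ring
    have e3 : 2 ^ ((1 - (n : ℝ)) * (2 * (N + m : ℕ))) * (C₂ * |t - s| ^ γ) * (t - s) =
        (2 ^ (N + m) * (2 ^ (n * (N + m)))⁻¹ * √C₂ * (t - s) ^ ((1 + γ) / 2)) ^ 2 := by
      rw [abs_of_nonneg hts, mul_pow, mul_pow _ (√C₂), Real.sq_sqrt hC₂, ← e2, ← e1]
      ring
    rw [e3, Real.sqrt_sq (by positivity), mul_add n, pow_add _ (n * N)]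
    field_simp

/-- The local time of a continuous infinitely regularizing path is smooth with compact support. -/
theorem IsLocalTime.exists_isSmoothLocalTimeAt (hw : ContinuousOn w (Icc 0 T))
    (hL : IsLocalTime T w L) {γ : ℝ} (hγ : 0 < γ) (h : ∀ α : ℝ, MemHolderBesov P T γ α L)
    {t : ℝ} (ht : t ∈ Icc 0 T) : ∃ ψ, IsSmoothLocalTimeAt w t ψ := by
  have hdt := hL.isOccupationDensity ht
  -- Since `L_0 = 0`, the bound on increments from time `0` applies to `L_t` itself.
  have hblock : ∀ N : ℕ, ∃ C : ℝ, ∀ n, ∫ x, ‖P.blockFun n (L t) x‖ ≤ C * (2 ^ (n * N))⁻¹ :=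
    fun N => by
    obtain ⟨C, -, hC⟩ := hL.exists_integral_norm_blockFun_le hw hγ h N
    refine ⟨C * (t - 0) ^ ((1 + γ) / 2), fun n => ?_⟩
    simpa only [hL.zero, sub_zero] using hC 0 t le_rfl ht.1 ht.2 n
  obtain ⟨G, hG, hae⟩ := exists_contDiff_ae_eq_of_fourier_decay hdt.integrable
    (P.fourier_decay_of_blockFun hdt.integrable hblock)
  have of_ae : ∀ {p : Sp d → Prop}, IsClosed {z | p z} → (∀ᵐ z, p z) → ∀ z, p z :=
    fun hc hp z => hc.closure_subset (Measure.dense_of_ae hp z)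
  have hG0 : ∀ z, 0 ≤ G z := of_ae (isClosed_le continuous_const hG.continuous) (by
    filter_upwards [hae] with z hz
    rw [← hz]
    exact hdt.nonneg z)
  obtain ⟨R, hR⟩ := (isCompact_Icc.image_of_continuousOn hw).isBounded.exists_norm_le
  have hGR : ∀ z, ‖z‖ ≤ R ∨ G z = 0 := of_ae
    ((isClosed_le continuous_norm continuous_const).union
      (isClosed_eq hG.continuous continuous_const)) (by
    filter_upwards [hae, hdt.ae_eq_zero (A := {z | R < ‖z‖})
      (isOpen_lt continuous_const continuous_norm).measurableSet fun u hu hmem =>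
        absurd (hR _ ⟨u, ⟨hu.1, hu.2.trans ht.2⟩, rfl⟩) (not_le.2 hmem)] with z h1 h2
    rw [← h1]
    exact (le_or_gt ‖z‖ R).imp_right h2)
  have hGc : HasCompactSupport G := HasCompactSupport.intro (isCompact_closedBall 0 R)
    fun z hz => (hGR z).resolve_left fun h => hz (by simpa using h)
  refine ⟨hGc.toSchwartzMap hG, hG0, fun A hA => ?_⟩
  rw [hdt.density A hA]
  refine lintegral_congr_ae (ae_restrict_of_ae ?_)
  filter_upwards [hae] with z hz
  rw [hz]
  rfl

/-- The averaging operator of an infinitely regularizing path is a regular Young field for every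
Besov drift. -/
theorem exists_youngField_avgOp (hw : ContinuousOn w (Icc 0 T))
    (hreg : IsInfinitelyRegularizing P T w) {b : TempDist d (Sp d)} {α : ℝ} {p q : ℝ≥0∞}
    (hp : 1 ≤ p) (hq : q ≠ 0) (hb : P.MemBesov α p q b) {γ : ℝ} (hγ : γ ∈ Ioo (3 / 4 : ℝ) 1) :
    ∃ M, YoungField T M γ (avgOp w b) := by
  obtain ⟨L, hL, hreg⟩ := hreg
  -- Interpolation turns the exponent `2γ - 1` into `γ`; the restriction `γ > 3/4` is exactly `2γ -
  -- 1 > 1/2`.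
  have hγ' : 2 * γ - 1 ∈ Ioo (1 / 2 : ℝ) 1 := ⟨by linarith [hγ.1], by linarith [hγ.2]⟩
  have hγ0 : 0 < 2 * γ - 1 := by linarith [hγ'.1]
  obtain ⟨C, m, hC, hbb⟩ := P.exists_block_bounds hp hq hb
  obtain ⟨C', hC', hL1⟩ := hL.exists_integral_norm_blockFun_le hw hγ0 (hreg _ hγ') (m + 1)
  -- The Schwartz version picked in `avgOp` agrees with `L t` almost everywhere, as both are
  -- densities of one occupation measure. Outside `[0,T]` the value is arbitrary.
  have hψ : ∀ t, ∃ ψ : 𝓢(Sp d, ℝ), t ∈ Icc 0 T → L t =ᵐ[volume] ψ ∧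
      ∀ x, avgOp w b t x = b (SchwartzMap.compSubConstCLM ℝ x ψ) := fun t => by
    by_cases ht : t ∈ Icc 0 T
    · have hex := hL.exists_isSmoothLocalTimeAt hw hγ0 (hreg _ hγ') ht
      refine ⟨hex.choose, fun _ => ⟨(hL.isOccupationDensity ht).ae_eq
        hex.choose_spec.isOccupationDensity, fun x => ?_⟩⟩
      rw [avgOp, dif_pos hex]
    · exact ⟨0, fun h => absurd h ht⟩
  choose ψ hψ using hψ
  have key : ∀ s t, 0 ≤ s → s ≤ t → t ≤ T → _ := fun s t hs hst ht =>
    P.apply_compSubConstCLM_bounds hbb (ψ := ψ t - ψ s) (B := C' * (t - s) ^ γ)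
      (f := incr (avgOp w b) s t) (fun n => by
        have h1 := hL1 s t hs hst ht n
        have hae : (fun z => L t z - L s z) =ᵐ[volume] ⇑(ψ t - ψ s) := by
          filter_upwards [(hψ t ⟨hs.trans hst, ht⟩).1, (hψ s ⟨hs, hst.trans ht⟩).1] with z h2 h3
          rw [h2, h3, sub_apply]
        rw [P.lpBlock_eq_blockFun, ← blockFun_congr_ae hae]
        convert h1 using 4
        ring)
      (fun x => by
        rw [incr, (hψ t ⟨hs.trans hst, ht⟩).2, (hψ s ⟨hs, hst.trans ht⟩).2, map_sub, map_sub])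
  refine ⟨6 * 2 ^ (m + 1) * C * C', ⟨by positivity, fun s t x hs hst ht => ?_,
    fun s t x y hs hst ht => ?_, fun s t p h k hs hst ht => ?_⟩⟩
  · exact ((key s t hs hst ht).1 x).trans_eq (by ring)
  · have := (key s t hs hst ht).2.1 y (x - y)
    rw [add_sub_cancel] at this
    exact this.trans_eq (by ring)
  · exact ((key s t hs hst ht).2.2 p h k).trans_eq (by ring)

end Regularizing

end PerturbedODE

end

/-- If the drift `b` lies in some Besov space `B^α_{p,q}`, then `T^*(x) = ∞` for all `x`: the
value `∞` is an existence time (so there is a unique solution on all of `[0,T]`), and it is the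
only one. -/
theorem proposition1p3 (d : ℕ) (P : PerturbedODE.DyadicPartition d) (T : ℝ) (hT : 0 < T)
    (w : ℝ → PerturbedODE.Sp d) (hw : ContinuousOn w (Set.Icc 0 T))
    (hreg : PerturbedODE.IsInfinitelyRegularizing P T w)
    (b : PerturbedODE.TempDist d (PerturbedODE.Sp d))
    (α : ℝ) (p q : ℝ≥0∞) (hp : 1 ≤ p) (hq : 1 ≤ q) (hb : P.MemBesov α p q b)
    (x : PerturbedODE.Sp d) :
    PerturbedODE.IsExistenceTime T w b x ⊤ ∧
      ∀ S : EReal, PerturbedODE.IsExistenceTime T w b x S → S = ⊤ :=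
  PerturbedODE.isExistenceTime_top_of_youngField hT hw
    (fun _ hγ => PerturbedODE.exists_youngField_avgOp hw hreg hp
      (zero_lt_one.trans_le hq).ne' hb hγ) x
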